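/- Setting. Fix an overlapping factor $\kappa\ge 1$, a symbol period $T_s>0$, a number $K$ of users, a number $N_s$ of multicarrier symbols. For every $M$ there are $2M$ subcarriers with central frequencies $\omega_m=\frac{2\pi}{2M}(m-1)$, partitioned into sets $\mathcal I_1,\dots,\mathcal I_K$, one per user. The symbols of user $k$ are $\mathbf A_k=\mathbf B_k+\mathrm j\mathbf C_k$ ($2M\times N_s$), where the real entries of $\mathbf B_k,\mathbf C_k$ are independent of one another and across $k,m,n$, have zero mean and a variance that depends on $M,k,m$ only and is bounded uniformly in $M,k,m$, and vanish for $m\notin\mathcal I_k$. The real pulses $p_N[n],q_N[n]$, $1\le n\le N=2M\kappa$, satisfy: (AS1) they are bounded uniformly in $M$; (AS2) $q_N^{(r)}[n]=T_s^r\,q^{(r)}\bigl((n-\frac{N+1}{2})\frac{T_s}{2M}\bigr)$, $r=0,1,2$, $q_N=q_N^{(0)}$, for a real function $q\in C^2([-\kappa T_s/2,\kappa T_s/2])$ such that $q,q',q''$ vanish at $\pm\kappa T_s/2$. We write $q_N'=q_N^{(1)}$, $q_N''=q_N^{(2)}$. Transmission chain. With $e_m(t)=\exp\bigl[\mathrm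 j\omega_m(t+\frac{M+1}{2})\bigr]$ and $\bar p_N(t)=p_N[t+1]$ for $0\le t<N$, $\bar p_N(t)=0$ otherwise, user $k$ transmits $$s_k(t)=\frac{1}{\sqrt{2M}}\sum_{m=1}^{2M}\sum_{n=1}^{N_s}\Bigl([\mathbf B_k]_{m,n}(\bar p_N e_m)(t-2M(n-1))+\mathrm j[\mathbf C_k]_{m,n}(\bar p_N e_m)(t-2M(n-1)-M)\Bigr),$$ which reaches the receiver as $r_k(t)=\sum_{l\in\mathbb Z}h_k[l]s_k(t-l)$, where the channel impulse response $h_k$ does not depend on $M$, $\sum_l l^2|h_k[l]|<\infty$, and $H_k(\omega)=\sum_l h_k[l]e^{-\mathrm j\omega l}$. With a one-tap equalizer $W_m$ (any complex numbers, bounded uniformly in $m$ and $M$), the output used to estimate $[\mathbf B_k]_{m,n}$ is $$z_{k,m}^{\rm odd}=W_m\frac{2}{\sqrt{2M}}\sum_{u=1}^{N}q_N[u]\,e_m(t_u)^*\,r_k(t_u),\qquad t_u=2M(n-1+\kappa)-u .$$ The contribution of user $k$ to the distortion at subcarrier $m$ is $P_{e,k}(m)=2\,\mathbb E\bigl|\Re[z^{\rm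 odd}_{k,m}-W_mH_k(\omega_m)[\mathbf B_k]_{m,n}]\bigr|^2$. Matrices. $\mathbf J_M$ is the anti-identity, $\mathbf U^\pm=\mathbf I_2\otimes(\mathbf I_M\pm\mathbf J_M)$, $\circledast$ is row-wise convolution, $[\mathbf P]_{\nu,a}=p_N[\nu+2M(a-1)]$ ($2M\times\kappa$) has top and bottom halves $\mathbf P_1,\mathbf P_2$, and likewise $\mathbf Q$ for $q_N$; $$\mathcal R(p_N,q_N)=\begin{bmatrix}\mathbf P_1\circledast\mathbf J_M\mathbf Q_2\\ \mathbf P_2\circledast\mathbf J_M\mathbf Q_1\end{bmatrix},\qquad \mathcal S(p_N,q_N)=\begin{bmatrix}\mathbf P_2\circledast\mathbf J_M\mathbf Q_2\\ \mathbf P_1\circledast\mathbf J_M\mathbf Q_1\end{bmatrix}=\begin{bmatrix}\mathcal S_1(p_N,q_N)\\ \mathcal S_2(p_N,q_N)\end{bmatrix},$$ and the same with $q_N^{(r)}$ for $q_N$; $\mathbb I=[\mathbf 0_{2M\times(\kappa-1)},\mathbf 1,\mathbf 0_{2M\times(\kappa-1)}]$; $\mathbf F$ is the $2M\times 2M$ matrix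 with entries $(2M)^{-1/2}\exp[\mathrm j\frac{2\pi}{2M}(m-1)(n-1)]$ and $\mathbf f(m)$ its $m$-th column; $\mathcal F_k(m)=\bigl(\mathbf F^H\,\mathbb E[\mathbf b_k\mathbf b_k^H]\,\mathbf F\bigr)\odot\mathbf f(m)\mathbf f^H(m)$ with $\mathbf b_k$ a column of $\mathbf B_k$ and $\odot$ the entrywise product. Put $\mathcal R_r=\mathcal R(p_N,q_N^{(r)})$, $\mathcal D=\mathcal R_0-\frac12\mathbb I$, $\mathcal S_{i,r}=\mathcal S_i(p_N,q_N^{(r)})$ and $$\mathcal X_{r,s}=\begin{bmatrix}\mathcal S_{1,r}\mathcal S_{1,s}^T&[\mathbf 0,\mathcal S_{1,r}][\mathcal S_{2,s},\mathbf 0]^T\\ [\mathcal S_{2,r},\mathbf 0][\mathbf 0,\mathcal S_{1,s}]^T&\mathcal S_{2,r}\mathcal S_{2,s}^T\end{bmatrix}.$$ Claim. Suppose moreover that for every $M$ the pulses meet the perfect-reconstruction conditions $\mathbf U^+\mathcal R(p_N,q_N)=\mathbb I$, $\mathbf U^-\mathcal S(p_N,q_N)=\mathbf 0$ and are symmetric: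 $p_N[n]=p_N[N-n+1]$, $q_N[n]=q_N[N-n+1]$. Then, as $M\to\infty$, for all users $k$ and all symbols $n$ with $\kappa+1\le n\le N_s-\kappa+1$, and uniformly in $m\in\{1,\dots,2M\}$, $$P_{e,k}(m)=2\Bigl[\eta_{0,0}(m)+\frac{2}{2M}\eta_{0,1}(m)+\frac1{4M^2}\eta_{0,2}(m)+\frac1{4M^2}\eta_{1,1}(m)\Bigr]+o(M^{-2}),$$ where $$\eta_{0,0}(m)=2\,\Im^2[W_mH_k(\omega_m)]\,\Re\,\mathrm{tr}\bigl[\mathbf U^-\mathcal F_k(m)\mathcal D\mathcal D^T+\mathbf U^+\mathcal F_k(m)\mathcal X_{0,0}\bigr],$$ $$\eta_{0,1}(m)=-2\,\Im[W_mH_k(\omega_m)]\,\Im[W_mH_k'(\omega_m)]\,\Im\,\mathrm{tr}\bigl[\mathbf U^+\mathcal F_k(m)\mathcal D\mathcal R_1^T+\mathbf U^-\mathcal F_k(m)\mathcal X_{0,1}\bigr],$$ $$\eta_{0,2}(m)=-2\,\Im[W_mH_k(\omega_m)]\,\Im[W_mH_k''(\omega_m)]\,\Re\,\mathrm{tr}\bigl[\mathbf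 U^-\mathcal F_k(m)\mathcal D\mathcal R_2^T+\mathbf U^+\mathcal F_k(m)\mathcal X_{0,2}\bigr],$$ $$\eta_{1,1}(m)=2\,\Im^2[W_mH_k'(\omega_m)]\,\Re\,\mathrm{tr}\bigl[\mathbf U^+\mathcal F_k(m)\mathcal R_1\mathcal R_1^T+\mathbf U^-\mathcal F_k(m)\mathcal X_{1,1}\bigr]+2\,\Re^2[W_mH_k'(\omega_m)]\,\Re\,\mathrm{tr}\bigl[\mathbf U^-\mathcal F_k(m)\mathcal R_1\mathcal R_1^T+\mathbf U^+\mathcal F_k(m)\mathcal X_{1,1}\bigr].$$ The same expansion holds for $2\,\mathbb E\bigl|\Re[z^{\rm odd}_{k,m}]-W_mH_k(\omega_m)[\mathbf B_k]_{m,n}\bigr|^2$, uniformly over those $m$ for which $m\notin\mathcal I_k$ or $W_mH_k(\omega_m)$ is real. -/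

import Mathlib

open Filter MeasureTheory ProbabilityTheory Asymptotics
open scoped Topology Matrix ComplexConjugate

/-! All vectors and matrices are indexed from `0`: subcarrier `m` of the text is `m - 1 : Fin (2 * M)`,
tap `p_N[n]` is `p (n - 1)`, the `n`-th multicarrier symbol is `n - 1 : Fin Ns`. -/

namespace FBMC

noncomputable section

/-! ### Prototype pulses and their polyphase matrices -/

/-- A real prototype pulse with `N = 2 M κ` taps. -/
abbrev Pulse (M κ : ℕ) : Type := Fin (κ * (2 * M)) → ℝ

/-- Symmetry `p_N[n] = p_N[N - n + 1]`. -/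
def IsSymm {M κ : ℕ} (p : Pulse M κ) : Prop := ∀ i, p i.rev = p i

/-- The taps are bounded uniformly in `M`. -/
def UniformlyBounded {κ : ℕ} (p : (M : ℕ) → Pulse M κ) : Prop :=
  ∃ C : ℝ, ∀ M i, |p M i| ≤ C

/-- The domain `[-κ T_s / 2, κ T_s / 2]` of the analog receive pulse. -/
def pulseDomain (κ : ℕ) (Ts : ℝ) : Set ℝ := Set.Icc (-(κ * Ts / 2)) (κ * Ts / 2)

/-- The real function `q` is twice continuously differentiable on its domain, and `q`, `q'`, `q''`
vanish at both end points. -/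
structure IsAnalogPulse (κ : ℕ) (Ts : ℝ) (q : ℝ → ℝ) : Prop where
  contDiffOn : ContDiffOn ℝ 2 q (pulseDomain κ Ts)
  left_zero : ∀ r : ℕ, r ≤ 2 → iteratedDerivWithin r q (pulseDomain κ Ts) (-(κ * Ts / 2)) = 0
  right_zero : ∀ r : ℕ, r ≤ 2 → iteratedDerivWithin r q (pulseDomain κ Ts) (κ * Ts / 2) = 0

/-- The sampled pulse `q_N^{(r)}[n] = T_s^r q^{(r)}((n - (N + 1) / 2) T_s / (2 M))`,
where `n = i + 1` and `N = 2 M κ`. -/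
def sampled (κ : ℕ) (Ts : ℝ) (q : ℝ → ℝ) (r M : ℕ) : Pulse M κ := fun i =>
  Ts ^ r * iteratedDerivWithin r q (pulseDomain κ Ts)
    ((((i : ℕ) : ℝ) + 1 - (2 * M * κ + 1) / 2) * (Ts / (2 * M)))

/-- Row `ν`, column `a` is the tap with (zero-based) index `ν + 2 M a`. -/
def polyphase {M κ : ℕ} (p : Pulse M κ) : Matrix (Fin (2 * M)) (Fin κ) ℝ :=
  Matrix.of fun ν a => p (finProdFinEquiv (a, ν))

/-- The first `M` and the last `M` of `2 M` indices. -/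
def halves (M : ℕ) : Fin (2 * M) ≃ Fin M ⊕ Fin M :=
  (finCongr (two_mul M)).trans finSumFinEquiv.symm

/-- Top `M` rows. -/
def upper {M : ℕ} {α : Type*} (A : Matrix (Fin (2 * M)) α ℝ) : Matrix (Fin M) α ℝ :=
  A.submatrix (fun i => (halves M).symm (Sum.inl i)) id

/-- Bottom `M` rows. -/
def lower {M : ℕ} {α : Type*} (A : Matrix (Fin (2 * M)) α ℝ) : Matrix (Fin M) α ℝ :=
  A.submatrix (fun i => (halves M).symm (Sum.inr i)) id

/-- `A` on top of `B`. -/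
def stack {M : ℕ} {α : Type*} (A B : Matrix (Fin M) α ℝ) : Matrix (Fin (2 * M)) α ℝ :=
  (Matrix.fromRows A B).submatrix (halves M) id

/-- The block matrix `[A, B; C, D]`. -/
def blocks {M : ℕ} (A B C D : Matrix (Fin M) (Fin M) ℝ) : Matrix (Fin (2 * M)) (Fin (2 * M)) ℝ :=
  (Matrix.fromBlocks A B C D).submatrix (halves M) (halves M)

/-- The anti-identity matrix `J_M`. -/
def antiId (M : ℕ) : Matrix (Fin M) (Fin M) ℝ :=
  Matrix.of fun i j => if j = i.rev then 1 else 0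

/-- Row-wise convolution of two matrices with `κ` columns. -/
def rowConv {ι : Type*} {κ : ℕ} (A B : Matrix ι (Fin κ) ℝ) : Matrix ι (Fin (2 * κ - 1)) ℝ :=
  Matrix.of fun i c => ∑ a : Fin κ, ∑ b : Fin κ,
    if (a : ℕ) + (b : ℕ) = (c : ℕ) then A i a * B i b else 0

/-- `𝓡(p, q) = [P₁ ⊛ J Q₂; P₂ ⊛ J Q₁]`. -/
def recR {M κ : ℕ} (p q : Pulse M κ) : Matrix (Fin (2 * M)) (Fin (2 * κ - 1)) ℝ :=
  stack (rowConv (upper (polyphase p)) (antiId M * lower (polyphase q)))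
    (rowConv (lower (polyphase p)) (antiId M * upper (polyphase q)))

/-- `𝓢(p, q) = [P₂ ⊛ J Q₂; P₁ ⊛ J Q₁]`. -/
def recS {M κ : ℕ} (p q : Pulse M κ) : Matrix (Fin (2 * M)) (Fin (2 * κ - 1)) ℝ :=
  stack (rowConv (lower (polyphase p)) (antiId M * lower (polyphase q)))
    (rowConv (upper (polyphase p)) (antiId M * upper (polyphase q)))

/-- The matrix `[0, 1, 0]` whose central column is made of ones, all others being null. -/
def centralOnes (M κ : ℕ) : Matrix (Fin (2 * M)) (Fin (2 * κ - 1)) ℝ :=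
  Matrix.of fun _ c => if (c : ℕ) + 1 = κ then 1 else 0

/-- `U⁺ = I₂ ⊗ (I_M + J_M)`. -/
def Uplus (M : ℕ) : Matrix (Fin (2 * M)) (Fin (2 * M)) ℝ :=
  blocks (1 + antiId M) 0 0 (1 + antiId M)

/-- `U⁻ = I₂ ⊗ (I_M - J_M)`. -/
def Uminus (M : ℕ) : Matrix (Fin (2 * M)) (Fin (2 * M)) ℝ :=
  blocks (1 - antiId M) 0 0 (1 - antiId M)

/-- The perfect-reconstruction conditions. -/
def IsPR {M κ : ℕ} (p q : Pulse M κ) : Prop :=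
  Uplus M * recR p q = centralOnes M κ ∧ Uminus M * recS p q = 0

/-- `𝓡(p, q) - 𝕀 / 2`. -/
def recD {M κ : ℕ} (p q : Pulse M κ) : Matrix (Fin (2 * M)) (Fin (2 * κ - 1)) ℝ :=
  recR p q - (1 / 2 : ℝ) • centralOnes M κ

/-- `[0, A]`. -/
def padLeft {ι : Type*} {n : ℕ} (A : Matrix ι (Fin n) ℝ) : Matrix ι (Fin (n + 1)) ℝ :=
  Matrix.of fun i => (Fin.cons 0 (A i) : Fin (n + 1) → ℝ)

/-- `[A, 0]`. -/
def padRight {ι : Type*} {n : ℕ} (A : Matrix ι (Fin n) ℝ) : Matrix ι (Fin (n + 1)) ℝ :=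
  Matrix.of fun i => (Fin.snoc (A i) 0 : Fin (n + 1) → ℝ)

/-- `𝓧^𝓢_{(p, q₁, p, q₂)}`. -/
def XS {M κ : ℕ} (p q₁ q₂ : Pulse M κ) : Matrix (Fin (2 * M)) (Fin (2 * M)) ℝ :=
  blocks
    (upper (recS p q₁) * (upper (recS p q₂))ᵀ)
    (padLeft (upper (recS p q₁)) * (padRight (lower (recS p q₂)))ᵀ)
    (padRight (lower (recS p q₁)) * (padLeft (upper (recS p q₂)))ᵀ)
    (lower (recS p q₁) * (lower (recS p q₂))ᵀ)

/-! ### The terms of the distortion formula -/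

/-- The `2M × 2M` unitary Fourier matrix. -/
def fourier (M : ℕ) : Matrix (Fin (2 * M)) (Fin (2 * M)) ℂ :=
  Matrix.of fun a b => ((Real.sqrt (2 * M) : ℝ) : ℂ)⁻¹ *
    Complex.exp (Complex.I * (2 * Real.pi / (2 * M) * (a : ℕ) * (b : ℕ) : ℝ))

/-- `(F^H Q F) ⊙ f(m) f(m)^H`, with `f(m)` the `m`-th column of the Fourier matrix `F`. -/
def circ {M : ℕ} (Q : Matrix (Fin (2 * M)) (Fin (2 * M)) ℝ) (m : Fin (2 * M)) :
    Matrix (Fin (2 * M)) (Fin (2 * M)) ℂ :=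
  ((fourier M)ᴴ * Q.map Complex.ofReal * fourier M) ⊙
    Matrix.vecMulVec (fun i => fourier M i m) (fun i => conj (fourier M i m))

/-- `tr[U 𝓕 X]` for real matrices `U` and `X`. -/
def tr3 {M : ℕ} (U : Matrix (Fin (2 * M)) (Fin (2 * M)) ℝ)
    (F : Matrix (Fin (2 * M)) (Fin (2 * M)) ℂ) (X : Matrix (Fin (2 * M)) (Fin (2 * M)) ℝ) : ℂ :=
  Matrix.trace (U.map Complex.ofReal * F * X.map Complex.ofReal)

/-- `η_{0,0}(m)`, with `w₀ = W_m H_k(ω_m)`. -/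
def eta00 {M κ : ℕ} (p q : Pulse M κ) (F : Matrix (Fin (2 * M)) (Fin (2 * M)) ℂ) (w₀ : ℂ) : ℝ :=
  2 * w₀.im ^ 2 *
    (tr3 (Uminus M) F (recD p q * (recD p q)ᵀ) + tr3 (Uplus M) F (XS p q q)).re

/-- `η_{0,1}(m)`, with `w₀ = W_m H_k(ω_m)`, `w₁ = W_m H_k'(ω_m)` and `q₁ = q_N'`. -/
def eta01 {M κ : ℕ} (p q q₁ : Pulse M κ) (F : Matrix (Fin (2 * M)) (Fin (2 * M)) ℂ)
    (w₀ w₁ : ℂ) : ℝ :=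
  -2 * w₀.im * w₁.im *
    (tr3 (Uplus M) F (recD p q * (recR p q₁)ᵀ) + tr3 (Uminus M) F (XS p q q₁)).im

/-- `η_{0,2}(m)`, with `w₀ = W_m H_k(ω_m)`, `w₂ = W_m H_k''(ω_m)` and `q₂ = q_N''`. -/
def eta02 {M κ : ℕ} (p q q₂ : Pulse M κ) (F : Matrix (Fin (2 * M)) (Fin (2 * M)) ℂ)
    (w₀ w₂ : ℂ) : ℝ :=
  -2 * w₀.im * w₂.im *
    (tr3 (Uminus M) F (recD p q * (recR p q₂)ᵀ) + tr3 (Uplus M) F (XS p q q₂)).re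

/-- `η_{1,1}(m)`, with `w₁ = W_m H_k'(ω_m)` and `q₁ = q_N'`. -/
def eta11 {M κ : ℕ} (p q₁ : Pulse M κ) (F : Matrix (Fin (2 * M)) (Fin (2 * M)) ℂ) (w₁ : ℂ) : ℝ :=
  2 * w₁.im ^ 2 *
      (tr3 (Uplus M) F (recR p q₁ * (recR p q₁)ᵀ) + tr3 (Uminus M) F (XS p q₁ q₁)).re +
    2 * w₁.re ^ 2 *
      (tr3 (Uminus M) F (recR p q₁ * (recR p q₁)ᵀ) + tr3 (Uplus M) F (XS p q₁ q₁)).re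

/-- `2 [η_{0,0} + (2 / 2M) η_{0,1} + (1 / 4M²) η_{0,2} + (1 / 4M²) η_{1,1}]`. -/
def distortionFormula {M κ : ℕ} (p q q₁ q₂ : Pulse M κ)
    (F : Matrix (Fin (2 * M)) (Fin (2 * M)) ℂ) (w₀ w₁ w₂ : ℂ) : ℝ :=
  2 * (eta00 p q F w₀ + 2 / (2 * M) * eta01 p q q₁ F w₀ w₁
    + 1 / (4 * (M : ℝ) ^ 2) * eta02 p q q₂ F w₀ w₂
    + 1 / (4 * (M : ℝ) ^ 2) * eta11 p q₁ F w₁)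

/-! ### The transmission chain: synthesis filterbank, channel, analysis filterbank, equalizer -/

/-- Central frequency `ω_m` of a subcarrier. -/
def centralFreq (M : ℕ) (m : Fin (2 * M)) : ℝ := 2 * Real.pi / (2 * M) * (m : ℕ)

/-- Frequency response `H(ω) = ∑ₗ h[l] e^{-jωl}` of an impulse response `h`. -/
def freqResp (h : ℤ → ℂ) (ω : ℝ) : ℂ :=
  ∑' l : ℤ, h l * Complex.exp (-Complex.I * (ω * (l : ℝ) : ℝ))

/-- The carrier `e^{j ω_m (t + (M + 1) / 2)}` of a subcarrier; the phase `e^{j ω_m (M + 1) / 2}` is the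
conjugate of the corresponding entry of the diagonal matrix `Φ`. -/
def carrier (M : ℕ) (m : Fin (2 * M)) (t : ℤ) : ℂ :=
  Complex.exp (Complex.I * (centralFreq M m * ((t : ℝ) + ((M : ℝ) + 1) / 2) : ℝ))

/-- The transmit pulse as a sequence over `ℤ`, null outside its `N` taps. -/
def tap {M κ : ℕ} (p : Pulse M κ) (t : ℤ) : ℝ :=
  if h : 0 ≤ t ∧ t.toNat < κ * (2 * M) then p ⟨t.toNat, h.2⟩ else 0

/-- The FBMC/OQAM signal carrying the symbols `b + j c`: every `2 M` samples a new multicarrier symbol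
starts, and its imaginary part is staggered by half a symbol, that is by `M` samples. -/
def txSignal {M κ Ns : ℕ} (p : Pulse M κ) (b c : Fin (2 * M) → Fin Ns → ℝ) (t : ℤ) : ℂ :=
  ((Real.sqrt (2 * M) : ℝ) : ℂ)⁻¹ * ∑ m : Fin (2 * M), ∑ n : Fin Ns,
    ((b m n : ℂ) * (tap p (t - 2 * M * (n : ℕ)) : ℂ) * carrier M m (t - 2 * M * (n : ℕ)) +
      Complex.I * (c m n : ℂ) * (tap p (t - 2 * M * (n : ℕ) - M) : ℂ) *
        carrier M m (t - 2 * M * (n : ℕ) - M))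

/-- The channel output: a weighted combination of delayed replicas of the input. -/
def channelOut (h : ℤ → ℂ) (s : ℤ → ℂ) (t : ℤ) : ℂ := ∑' l : ℤ, h l * s (t - l)

/-- Output of the analysis filterbank at subcarrier `m`, in the `c`-th (zero-based) odd column,
for the received signal `r`: demodulation by the conjugate carrier followed by filtering with `q_N`,
read when the filter covers the samples `2 M (c + 1 - κ), …, 2 M (c + 1) - 1`. -/
def analysisOdd {M κ : ℕ} (q : Pulse M κ) (r : ℤ → ℂ) (m : Fin (2 * M)) (c : ℤ) : ℂ :=
  2 * ((Real.sqrt (2 * M) : ℝ) : ℂ)⁻¹ * ∑ u : Fin (κ * (2 * M)),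
    (q u : ℂ) * conj (carrier M m (2 * M * (c + 1) - 1 - (u : ℕ))) *
      r (2 * M * (c + 1) - 1 - (u : ℕ))

/-- `z_{k,m}^{odd} = [Z_k^{odd}]_{m, n + κ - 1}`: the equalized output of the analysis filterbank used to
estimate the real part of the `n`-th symbol. With `n` zero-based, the zero-based column is
`n + κ - 1` too. -/
def zOdd {M κ Ns : ℕ} (p q : Pulse M κ) (h : ℤ → ℂ) (W : Fin (2 * M) → ℂ)
    (b c : Fin (2 * M) → Fin Ns → ℝ) (m : Fin (2 * M)) (n : Fin Ns) : ℂ :=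
  W m * analysisOdd q (channelOut h (txSignal p b c)) m ((n : ℕ) + κ - 1)

/-! ### Symbols and distortion -/

/-- The statistical model of the symbols `A_k = B_k + j C_k` of `K` users. Subcarrier `m` is reserved
for the user `owner m`, so that the sets `𝓘_k = owner ⁻¹' {k}` partition the subcarriers. The
entries of `B_k`, `C_k` are independent of one another and across `k`, `m`, `n`, have zero mean and a
finite variance `σ2 k m` common to real and imaginary parts and to all the symbols `n`, and are
identically null at the subcarriers that are not reserved for user `k`. -/
structure IsSymbolModel {Ω : Type*} [MeasurableSpace Ω] (μ : Measure Ω) {M K Ns : ℕ}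
    (owner : Fin (2 * M) → Fin K) (B C : Fin K → Fin (2 * M) → Fin Ns → Ω → ℝ)
    (σ2 : Fin K → Fin (2 * M) → ℝ) : Prop where
  memLp_B : ∀ k m n, MemLp (B k m n) 2 μ
  memLp_C : ∀ k m n, MemLp (C k m n) 2 μ
  mean_B : ∀ k m n, ∫ x, B k m n x ∂μ = 0
  mean_C : ∀ k m n, ∫ x, C k m n x ∂μ = 0
  var_B : ∀ k m n, ∫ x, B k m n x ^ 2 ∂μ = σ2 k m
  var_C : ∀ k m n, ∫ x, C k m n x ^ 2 ∂μ = σ2 k m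
  null_B : ∀ k m n, owner m ≠ k → ∀ x, B k m n x = 0
  null_C : ∀ k m n, owner m ≠ k → ∀ x, C k m n x = 0
  indep : iIndepFun
    (Sum.elim (fun i : Fin K × Fin (2 * M) × Fin Ns => B i.1 i.2.1 i.2.2)
      (fun i : Fin K × Fin (2 * M) × Fin Ns => C i.1 i.2.1 i.2.2)) μ

/-- `E[b b^H]` for the `n`-th column `b` of the random real matrix `B`. -/
def secondMoment {Ω : Type*} [MeasurableSpace Ω] (μ : Measure Ω) {M Ns : ℕ}
    (B : Fin (2 * M) → Fin Ns → Ω → ℝ) (n : Fin Ns) : Matrix (Fin (2 * M)) (Fin (2 * M)) ℝ :=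
  Matrix.of fun i j => ∫ x, B i n x * B j n x ∂μ

/-- The contribution of a user to the distortion at subcarrier `m`:
`2 E |Re[z_{k,m}^{odd} - W_m H_k(ω_m) b_{k,m}]|²`. -/
def distortion {Ω : Type*} [MeasurableSpace Ω] (μ : Measure Ω) {M κ Ns : ℕ} (p q : Pulse M κ)
    (h : ℤ → ℂ) (W : Fin (2 * M) → ℂ) (B C : Fin (2 * M) → Fin Ns → Ω → ℝ)
    (m : Fin (2 * M)) (n : Fin Ns) : ℝ :=
  2 * ∫ x, |(zOdd p q h W (fun i j => B i j x) (fun i j => C i j x) m n -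
    W m * freqResp h (centralFreq M m) * (B m n x : ℂ)).re| ^ 2 ∂μ

/-- The same quantity with the real part taken of the filterbank output only:
`2 E |Re[z_{k,m}^{odd}] - W_m H_k(ω_m) b_{k,m}|²`. -/
def distortion' {Ω : Type*} [MeasurableSpace Ω] (μ : Measure Ω) {M κ Ns : ℕ} (p q : Pulse M κ)
    (h : ℤ → ℂ) (W : Fin (2 * M) → ℂ) (B C : Fin (2 * M) → Fin Ns → Ω → ℝ)
    (m : Fin (2 * M)) (n : Fin Ns) : ℝ :=
  2 * ∫ x, ‖((zOdd p q h W (fun i j => B i j x) (fun i j => C i j x) m n).re : ℂ) -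
    W m * freqResp h (centralFreq M m) * (B m n x : ℂ)‖ ^ 2 ∂μ

/-- The value that the distortion formula assigns to a user with channel `h` and symbols `B`, for the
analog receive pulse `q` (with samples `q_N`, `q_N'`, `q_N''`). -/
def predictedDistortion {Ω : Type*} [MeasurableSpace Ω] (μ : Measure Ω) {M κ Ns : ℕ} (Ts : ℝ)
    (p : Pulse M κ) (q : ℝ → ℝ) (h : ℤ → ℂ) (W : Fin (2 * M) → ℂ)
    (B : Fin (2 * M) → Fin Ns → Ω → ℝ) (m : Fin (2 * M)) (n : Fin Ns) : ℝ :=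
  distortionFormula p (sampled κ Ts q 0 M) (sampled κ Ts q 1 M) (sampled κ Ts q 2 M)
    (circ (secondMoment μ B n) m)
    (W m * freqResp h (centralFreq M m))
    (W m * iteratedDeriv 1 (freqResp h) (centralFreq M m))
    (W m * iteratedDeriv 2 (freqResp h) (centralFreq M m))

end

end FBMC

/-!
The output of the receiver is a linear function of the symbols, and the symbols are centred and
independent, so the distortion is a weighted sum of squares of the real parts of the responses to
the individual symbols (`distortion_eq_sum`). The receiver sees the pulse `q` filtered by the channel.
As `q`, `q'`, `q''` vanish at the end points, `q` extends by zero to a `C²` function on the line, and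
its second-order Taylor expansion over the delays of the channel turns the filtered pulse into a
combination of `q_N`, `q_N'`, `q_N''` with coefficients `H`, `-j H' / 2M`, `-H'' / 8M²`, up to an error
that is `o(M⁻²)` uniformly in time and frequency (`exists_filteredPulse_bound`). By Parseval's
identity for the carriers (`sum_norm_sq_symbolResponse_le`) the responses to bounded sequences are
bounded in `ℓ²`, uniformly in `M`, so that this error and the terms of order `M⁻³` of the square
contribute `o(M⁻²)` to the distortion (`abs_quadratic_expansion_le`).

The four remaining terms are *equal* to the four terms of the formula. The responses to `q_N^{(r)}` are
the Fourier transforms of the columns of `𝓡_r` and of `[0, 𝓢₁; 𝓢₂, 0]`, at the frequency of one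
subcarrier relative to the other (`symbolResponse_tapSeq`, `symbolResponse_tapSeq_staggered`); the
symbol of interest provides the shift from `𝓡` to `𝓓` (`realColumn_sub_eq`). In the traces `U⁺` and
`U⁻` take real and imaginary parts of such transforms, because reversing the order inside each half
conjugates the phases (`tr3_Uplus_eq`, `tr3_Uminus_eq`). By perfect reconstruction the responses of
order zero are purely imaginary, so that only the imaginary part of `W_m H_k(ω_m)` counts. The
products of real and imaginary parts that are absent from the formula cancel between a column and
its mirror image: the pulses being symmetric, reversal of rows and columns conjugates the transforms,
up to a sign that alternates with the order of the derivative (`ColumnSymmetry`). That `q` is even,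
hence `q'` odd and `q''` even, follows from the symmetry of the sampled pulses for all `M`
(`extendedDeriv_zero_neg`).
-/

namespace FBMC

noncomputable section

/-! ### Carriers -/

lemma exp_I_add_two_pi_mul_int (a : ℝ) (k : ℤ) :
    Complex.exp (Complex.I * ((a + 2 * Real.pi * k : ℝ) : ℂ)) = Complex.exp (Complex.I * (a : ℂ)) := by
  have h := Complex.exp_int_mul_two_pi_mul_I k
  push_cast
  rw [mul_add, Complex.exp_add]
  rw [show Complex.I * (2 * Real.pi * (k : ℂ)) = k * (2 * Real.pi * Complex.I) by ring, h, mul_one]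

lemma inv_sqrt_mul_inv_sqrt (M : ℕ) :
    ((Real.sqrt (2 * M) : ℝ) : ℂ)⁻¹ * ((Real.sqrt (2 * M) : ℝ) : ℂ)⁻¹ = (2 * (M : ℂ))⁻¹ := by
  rw [← mul_inv, ← Complex.ofReal_mul, Real.mul_self_sqrt (by positivity)]
  push_cast
  rfl

lemma pos_of_subcarrier {M : ℕ} (m : Fin (2 * M)) : 0 < M := by
  have := m.pos
  omega

lemma norm_carrier {M : ℕ} (m : Fin (2 * M)) (t : ℤ) : ‖carrier M m t‖ = 1 := by
  rw [carrier, mul_comm]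
  exact Complex.norm_exp_ofReal_mul_I _

lemma conj_carrier {M : ℕ} (m : Fin (2 * M)) (t : ℤ) :
    conj (carrier M m t) =
      Complex.exp (Complex.I * (-(centralFreq M m * ((t : ℝ) + ((M : ℝ) + 1) / 2)) : ℝ)) := by
  rw [carrier, ← Complex.exp_conj]
  congr 1
  simp only [map_mul, Complex.conj_I, Complex.conj_ofReal]
  push_cast
  ring

/-- The carriers have period `2 M`. -/
lemma carrier_add_period {M : ℕ} (m : Fin (2 * M)) (t k : ℤ) :
    carrier M m (t + 2 * M * k) = carrier M m t := by
  have hM : (M : ℝ) ≠ 0 := by exact_mod_cast (pos_of_subcarrier m).ne'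
  rw [carrier, carrier]
  refine Eq.trans ?_ (exp_I_add_two_pi_mul_int _ ((m : ℕ) * k))
  congr 3
  rw [centralFreq]
  push_cast
  field_simp
  ring

lemma exp_I_pi_mul_nat (n : ℕ) :
    Complex.exp (Complex.I * ((Real.pi * n : ℝ) : ℂ)) = (-1) ^ n := by
  rw [← Complex.exp_pi_mul_I, ← Complex.exp_nat_mul]
  congr 1
  push_cast
  ring

lemma carrier_add_half {M : ℕ} (m : Fin (2 * M)) (t : ℤ) :
    carrier M m (t + M) = (-1) ^ (m : ℕ) * carrier M m t := by
  have hM : (M : ℝ) ≠ 0 := by exact_mod_cast (pos_of_subcarrier m).ne'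
  rw [← exp_I_pi_mul_nat, carrier, carrier, ← Complex.exp_add, ← mul_add, ← Complex.ofReal_add]
  congr 3
  rw [centralFreq]
  push_cast
  field_simp
  ring

/-- The phase `(M + 1) / 2` makes each half of the symbol period conjugate symmetric. -/
lemma carrier_reflect {M : ℕ} (m : Fin (2 * M)) (s t k : ℤ) (h : s + t + M + 1 = 2 * M * k) :
    carrier M m s = conj (carrier M m t) := by
  have hM : (M : ℝ) ≠ 0 := by exact_mod_cast (pos_of_subcarrier m).ne'
  rw [conj_carrier, carrier]
  refine Eq.trans ?_ (exp_I_add_two_pi_mul_int _ ((m : ℕ) * k))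
  congr 3
  have hs : (s : ℝ) = 2 * M * k - t - M - 1 := by
    have : s = 2 * M * k - t - M - 1 := by omega
    rw [this]; push_cast; ring
  rw [centralFreq, hs]
  push_cast
  field_simp
  ring

lemma carrier_add_channel_delay {M : ℕ} (m : Fin (2 * M)) (t l : ℤ) :
    conj (carrier M m (t + l)) =
      conj (carrier M m t) * Complex.exp (-Complex.I * (centralFreq M m * (l : ℝ) : ℝ)) := by
  rw [conj_carrier, conj_carrier, ← Complex.exp_add]
  congr 1
  push_cast
  ring

/-! ### Orthogonality -/

lemma sum_exp_two_pi_div (N : ℕ) (hN : N ≠ 0) (d : ℤ) :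
    ∑ k : Fin N, Complex.exp (Complex.I * ((2 * Real.pi / N * d * (k : ℕ) : ℝ) : ℂ)) =
      if (N : ℤ) ∣ d then (N : ℂ) else 0 := by
  have hprim := Complex.isPrimitiveRoot_exp N hN
  set ζ := Complex.exp (2 * Real.pi * Complex.I / N)
  have hterm : ∀ k : ℕ, Complex.exp (Complex.I * ((2 * Real.pi / N * d * k : ℝ) : ℂ)) =
      (ζ ^ d) ^ k := by
    intro k
    rw [← Complex.exp_int_mul, ← Complex.exp_nat_mul]
    congr 1
    push_cast
    ring
  rw [Fin.sum_univ_eq_sum_range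
    (fun k => Complex.exp (Complex.I * ((2 * Real.pi / N * d * k : ℝ) : ℂ))) N]
  simp only [hterm]
  split_ifs with hd
  · rw [(hprim.zpow_eq_one_iff_dvd d).2 hd]
    simp
  · have hne : ζ ^ d ≠ 1 := fun h => hd ((hprim.zpow_eq_one_iff_dvd d).1 h)
    rw [geom_sum_eq hne]
    have : (ζ ^ d) ^ N = 1 := by
      rw [← zpow_natCast, ← zpow_mul, mul_comm, zpow_mul, zpow_natCast, hprim.pow_eq_one,
        one_zpow]
    rw [this]
    simp

lemma int_dvd_sub_iff {N : ℕ} (a b : Fin N) : (N : ℤ) ∣ ((a : ℕ) : ℤ) - (b : ℕ) ↔ a = b := by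
  constructor
  · intro h
    have h1 := a.isLt
    have h2 := b.isLt
    have := Int.eq_zero_of_abs_lt_dvd h (by rw [abs_lt]; omega)
    ext
    omega
  · rintro rfl
    simp

lemma sum_carrier_mul_conj_carrier {M : ℕ} (hM : M ≠ 0) (s t : Fin (2 * M)) :
    ∑ m : Fin (2 * M), carrier M m (s : ℕ) * conj (carrier M m (t : ℕ)) =
      if s = t then 2 * (M : ℂ) else 0 := by
  have h := sum_exp_two_pi_div (2 * M) (by omega) (((s : ℕ) : ℤ) - (t : ℕ))
  rw [if_congr (int_dvd_sub_iff s t) rfl rfl] at h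
  push_cast at h
  rw [← h]
  refine Finset.sum_congr rfl fun m _ => ?_
  rw [conj_carrier, carrier, ← Complex.exp_add]
  congr 1
  simp only [centralFreq]
  push_cast
  ring

/-- The phase of subcarrier `m'` relative to subcarrier `m`, at one sample of a symbol period. -/
def relPhase {M : ℕ} (m m' ν : Fin (2 * M)) : ℂ :=
  carrier M m' (ν : ℕ) * conj (carrier M m (ν : ℕ))

lemma sum_relPhase {M : ℕ} (m m' : Fin (2 * M)) :
    ∑ ν, relPhase m m' ν = if m' = m then 2 * (M : ℂ) else 0 := by
  have hM := (pos_of_subcarrier m).ne'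
  have h := sum_exp_two_pi_div (2 * M) (by omega) (((m' : ℕ) : ℤ) - (m : ℕ))
  rw [if_congr (int_dvd_sub_iff m' m) rfl rfl] at h
  have hc : ∑ ν, relPhase m m' ν = (if m' = m then 2 * (M : ℂ) else 0) *
      Complex.exp (Complex.I *
        (2 * Real.pi / (2 * M) * (((m' : ℕ) : ℝ) - (m : ℕ)) * (((M : ℝ) + 1) / 2) : ℝ)) := by
    push_cast at h
    rw [← h, Finset.sum_mul]
    refine Finset.sum_congr rfl fun ν _ => ?_
    rw [relPhase, conj_carrier, carrier, ← Complex.exp_add, ← Complex.exp_add]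
    congr 1
    simp only [centralFreq]
    push_cast
    ring
  rw [hc]
  split_ifs with hmm
  · subst hmm
    simp
  · simp

/-- Parseval's identity for the carriers. -/
lemma sum_norm_sq_carrier_transform {M : ℕ} (hM : M ≠ 0) (y : Fin (2 * M) → ℂ) :
    ∑ m : Fin (2 * M), ‖∑ ν, y ν * carrier M m (ν : ℕ)‖ ^ 2 = 2 * M * ∑ ν, ‖y ν‖ ^ 2 := by
  have key : ∑ m : Fin (2 * M), ((‖∑ ν, y ν * carrier M m (ν : ℕ)‖ ^ 2 : ℝ) : ℂ) =
      ((2 * M * ∑ ν, ‖y ν‖ ^ 2 : ℝ) : ℂ) := by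
    have h1 : ∀ z : ℂ, ((‖z‖ ^ 2 : ℝ) : ℂ) = z * conj z := by
      intro z
      rw [Complex.mul_conj, Complex.normSq_eq_norm_sq]
    calc ∑ m : Fin (2 * M), ((‖∑ ν, y ν * carrier M m (ν : ℕ)‖ ^ 2 : ℝ) : ℂ)
        = ∑ m : Fin (2 * M), ∑ ν, ∑ ν', y ν * conj (y ν') *
            (carrier M m (ν : ℕ) * conj (carrier M m (ν' : ℕ))) := by
          refine Finset.sum_congr rfl fun m _ => ?_
          rw [h1, map_sum, Finset.sum_mul_sum]
          refine Finset.sum_congr rfl fun ν _ => Finset.sum_congr rfl fun ν' _ => ?_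
          rw [map_mul]
          ring
      _ = ∑ ν, ∑ ν', y ν * conj (y ν') * (if ν = ν' then 2 * (M : ℂ) else 0) := by
          rw [Finset.sum_comm]
          refine Finset.sum_congr rfl fun ν _ => ?_
          rw [Finset.sum_comm]
          refine Finset.sum_congr rfl fun ν' _ => ?_
          rw [← Finset.mul_sum, sum_carrier_mul_conj_carrier hM]
      _ = _ := by
          simp only [mul_ite, mul_zero, Finset.sum_ite_eq, Finset.mem_univ, if_true]
          push_cast
          rw [Finset.mul_sum]
          refine Finset.sum_congr rfl fun ν _ => ?_
          have := h1 (y ν)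
          push_cast at this
          rw [this]
          ring
  exact_mod_cast key

/-- Folding the `κ` symbol periods covered by a pulse onto a single one. -/
lemma sum_fin_fold {M κ : ℕ} {α : Type*} [AddCommMonoid α] (f : Fin (κ * (2 * M)) → α) :
    ∑ i, f i = ∑ ν : Fin (2 * M), ∑ a : Fin κ, f (finProdFinEquiv (a, ν)) := by
  rw [← finProdFinEquiv.sum_comp, Fintype.sum_prod_type, Finset.sum_comm]

lemma coe_finProdFinEquiv {M κ : ℕ} (a : Fin κ) (ν : Fin (2 * M)) :
    (((finProdFinEquiv (a, ν) : Fin (κ * (2 * M))) : ℕ) : ℤ) = ((ν : ℕ) : ℤ) + 2 * M * (a : ℕ) := by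
  simp [finProdFinEquiv]

/-- Energy bound for the demodulation of a bounded sequence of `κ` symbol periods. -/
lemma sum_norm_sq_demod_le {M κ : ℕ} (hM : M ≠ 0) (y : Fin (κ * (2 * M)) → ℂ) (Y : ℝ)
    (hY : ∀ i, ‖y i‖ ≤ Y) :
    ∑ m : Fin (2 * M), ‖∑ i, y i * carrier M m (i : ℕ)‖ ^ 2 ≤ (2 * M * (κ * Y)) ^ 2 := by
  have hfold : ∀ m : Fin (2 * M), ∑ i, y i * carrier M m (i : ℕ) =
      ∑ ν : Fin (2 * M), (∑ a : Fin κ, y (finProdFinEquiv (a, ν))) * carrier M m (ν : ℕ) := by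
    intro m
    rw [sum_fin_fold]
    refine Finset.sum_congr rfl fun ν _ => ?_
    rw [Finset.sum_mul]
    refine Finset.sum_congr rfl fun a _ => ?_
    rw [coe_finProdFinEquiv, carrier_add_period]
  simp only [hfold]
  rw [sum_norm_sq_carrier_transform hM]
  have hν : ∀ ν : Fin (2 * M), ‖∑ a : Fin κ, y (finProdFinEquiv (a, ν))‖ ^ 2 ≤ (κ * Y) ^ 2 := by
    intro ν
    refine pow_le_pow_left₀ (norm_nonneg _) ?_ 2
    refine (norm_sum_le_of_le _ (fun a _ => hY _)).trans ?_
    simp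
  calc 2 * (M : ℝ) * ∑ ν : Fin (2 * M), ‖∑ a : Fin κ, y (finProdFinEquiv (a, ν))‖ ^ 2
      ≤ 2 * M * ∑ ν : Fin (2 * M), (κ * Y) ^ 2 := by
        exact mul_le_mul_of_nonneg_left (Finset.sum_le_sum fun ν _ => hν ν) (by positivity)
    _ = (2 * M * (κ * Y)) ^ 2 := by
        simp
        ring

/-! ### Reflections of the rows -/

/-- An index of the first half. -/
def topIdx {M : ℕ} (i : Fin M) : Fin (2 * M) := (halves M).symm (Sum.inl i)

/-- An index of the second half. -/
def botIdx {M : ℕ} (i : Fin M) : Fin (2 * M) := (halves M).symm (Sum.inr i)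

@[simp] lemma coe_topIdx {M : ℕ} (i : Fin M) : ((topIdx i : Fin (2 * M)) : ℕ) = i := by
  simp [topIdx, halves]

@[simp] lemma coe_botIdx {M : ℕ} (i : Fin M) : ((botIdx i : Fin (2 * M)) : ℕ) = M + i := by
  simp [botIdx, halves, add_comm]

@[simp] lemma halves_topIdx {M : ℕ} (i : Fin M) : halves M (topIdx i) = Sum.inl i := by
  simp [topIdx]

@[simp] lemma halves_botIdx {M : ℕ} (i : Fin M) : halves M (botIdx i) = Sum.inr i := by
  simp [botIdx]

lemma topIdx_or_botIdx {M : ℕ} (ν : Fin (2 * M)) :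
    (∃ i, ν = topIdx i) ∨ ∃ i, ν = botIdx i := by
  rcases h : halves M ν with i | i
  · exact Or.inl ⟨i, by rw [topIdx, ← h, Equiv.symm_apply_apply]⟩
  · exact Or.inr ⟨i, by rw [botIdx, ← h, Equiv.symm_apply_apply]⟩

/-- Reversal of the order inside each half. -/
def flip {M : ℕ} : Equiv.Perm (Fin (2 * M)) :=
  (halves M).trans ((Equiv.sumCongr Fin.revPerm Fin.revPerm).trans (halves M).symm)

/-- Exchange of the two halves. -/
def swapHalves {M : ℕ} : Equiv.Perm (Fin (2 * M)) :=
  (halves M).trans ((Equiv.sumComm _ _).trans (halves M).symm)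

@[simp] lemma flip_topIdx {M : ℕ} (i : Fin M) : flip (topIdx i) = topIdx i.rev := by
  simp [flip, topIdx]

@[simp] lemma flip_botIdx {M : ℕ} (i : Fin M) : flip (botIdx i) = botIdx i.rev := by
  simp [flip, botIdx]

@[simp] lemma swapHalves_topIdx {M : ℕ} (i : Fin M) : swapHalves (topIdx i) = botIdx i := by
  simp [swapHalves, topIdx, botIdx]

@[simp] lemma swapHalves_botIdx {M : ℕ} (i : Fin M) : swapHalves (botIdx i) = topIdx i := by
  simp [swapHalves, topIdx, botIdx]

@[simp] lemma flip_flip {M : ℕ} (ν : Fin (2 * M)) : flip (flip ν) = ν := by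
  rcases topIdx_or_botIdx ν with ⟨i, rfl⟩ | ⟨i, rfl⟩ <;> simp

lemma rev_topIdx {M : ℕ} (i : Fin M) : (topIdx i).rev = botIdx i.rev := by
  ext
  have := i.isLt
  simp only [Fin.val_rev, coe_topIdx, coe_botIdx]
  omega

lemma rev_botIdx {M : ℕ} (i : Fin M) : (botIdx i).rev = topIdx i.rev := by
  ext
  have := i.isLt
  simp only [Fin.val_rev, coe_topIdx, coe_botIdx]
  omega

lemma swapHalves_rev {M : ℕ} (ν : Fin (2 * M)) : swapHalves ν.rev = (swapHalves ν).rev := by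
  rcases topIdx_or_botIdx ν with ⟨i, rfl⟩ | ⟨i, rfl⟩ <;> simp [rev_topIdx, rev_botIdx]

lemma carrier_flip {M : ℕ} (m ν : Fin (2 * M)) :
    carrier M m (flip ν : Fin (2 * M)) = conj (carrier M m (ν : ℕ)) := by
  rcases topIdx_or_botIdx ν with ⟨i, rfl⟩ | ⟨i, rfl⟩
  · refine carrier_reflect m _ _ 1 ?_
    have := i.isLt
    simp only [flip_topIdx, coe_topIdx, Fin.val_rev]
    omega
  · refine carrier_reflect m _ _ 2 ?_
    have := i.isLt
    simp only [flip_botIdx, coe_botIdx, Fin.val_rev]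
    omega

lemma carrier_rev {M : ℕ} (m ν : Fin (2 * M)) :
    carrier M m (ν.rev : Fin (2 * M)) = (-1) ^ (m : ℕ) * conj (carrier M m (ν : ℕ)) := by
  have h1 : carrier M m (((ν.rev : Fin (2 * M)) : ℕ) + (M : ℤ)) = conj (carrier M m (ν : ℕ)) := by
    refine carrier_reflect m _ _ 2 ?_
    have := ν.isLt
    simp only [Fin.val_rev]
    omega
  rw [← h1, carrier_add_half, ← mul_assoc, ← mul_pow]
  simp

lemma relPhase_flip {M : ℕ} (m m' ν : Fin (2 * M)) :
    relPhase m m' (flip ν) = conj (relPhase m m' ν) := by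
  simp [relPhase, carrier_flip]

lemma relPhase_rev {M : ℕ} (m m' ν : Fin (2 * M)) :
    relPhase m m' ν.rev = (-1) ^ ((m : ℕ) + (m' : ℕ)) * conj (relPhase m m' ν) := by
  simp only [relPhase, carrier_rev, map_mul, map_pow, map_neg, map_one, Complex.conj_conj]
  ring

/-! ### The matrices `U⁺`, `U⁻` and the traces -/

lemma Uplus_apply {M : ℕ} (a b : Fin (2 * M)) :
    Uplus M a b = (if b = a then 1 else 0) + if b = flip a then 1 else 0 := by
  obtain ⟨a, rfl⟩ := (halves M).symm.surjective a
  obtain ⟨b, rfl⟩ := (halves M).symm.surjective b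
  rcases a with a | a <;> rcases b with b | b <;>
    simp [Uplus, blocks, flip, antiId, Matrix.one_apply, eq_comm]

lemma Uminus_apply {M : ℕ} (a b : Fin (2 * M)) :
    Uminus M a b = (if b = a then 1 else 0) - if b = flip a then 1 else 0 := by
  obtain ⟨a, rfl⟩ := (halves M).symm.surjective a
  obtain ⟨b, rfl⟩ := (halves M).symm.surjective b
  rcases a with a | a <;> rcases b with b | b <;>
    simp [Uminus, blocks, flip, antiId, Matrix.one_apply, eq_comm]

lemma Uplus_mul_apply {M : ℕ} {γ : Type*} (A : Matrix (Fin (2 * M)) γ ℝ) (ν : Fin (2 * M))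
    (c : γ) : (Uplus M * A) ν c = A ν c + A (flip ν) c := by
  simp [Matrix.mul_apply, Uplus_apply, add_mul, Finset.sum_add_distrib]

lemma Uminus_mul_apply {M : ℕ} {γ : Type*} (A : Matrix (Fin (2 * M)) γ ℝ) (ν : Fin (2 * M))
    (c : γ) : (Uminus M * A) ν c = A ν c - A (flip ν) c := by
  simp [Matrix.mul_apply, Uminus_apply, sub_mul, Finset.sum_sub_distrib]

/-- The Fourier transform along a column, at the frequency of `m'` relative to that of `m`. -/
def colTransform {M : ℕ} {γ : Type*} (Y : Matrix (Fin (2 * M)) γ ℝ) (m m' : Fin (2 * M))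
    (c : γ) : ℂ := ∑ ν, (Y ν c : ℂ) * relPhase m m' ν

lemma conj_colTransform {M : ℕ} {γ : Type*} (Y : Matrix (Fin (2 * M)) γ ℝ) (m m' : Fin (2 * M))
    (c : γ) : conj (colTransform Y m m' c) = ∑ ν, (Y ν c : ℂ) * conj (relPhase m m' ν) := by
  simp [colTransform]

lemma sum_flip_mul_conj_relPhase {M : ℕ} {γ : Type*} (Y : Matrix (Fin (2 * M)) γ ℝ)
    (m m' : Fin (2 * M)) (c : γ) :
    ∑ ν, (Y (flip ν) c : ℂ) * conj (relPhase m m' ν) = colTransform Y m m' c := by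
  rw [colTransform, ← Equiv.sum_comp flip]
  simp [relPhase_flip]

lemma circ_diagonal_apply {M : ℕ} (d : Fin (2 * M) → ℝ) (m a b : Fin (2 * M)) :
    circ (Matrix.diagonal d) m a b =
      (4 * (M : ℂ) ^ 2)⁻¹ * ∑ m', (d m' : ℂ) * (conj (relPhase m m' a) * relPhase m m' b) := by
  have hphase : ∀ m' : Fin (2 * M), conj (relPhase m m' a) * relPhase m m' b =
      conj (Complex.exp (Complex.I * (2 * Real.pi / (2 * M) * (m' : ℕ) * (a : ℕ) : ℝ))) *
      Complex.exp (Complex.I * (2 * Real.pi / (2 * M) * (m' : ℕ) * (b : ℕ) : ℝ)) *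
      (Complex.exp (Complex.I * (2 * Real.pi / (2 * M) * (a : ℕ) * (m : ℕ) : ℝ)) *
      conj (Complex.exp (Complex.I * (2 * Real.pi / (2 * M) * (b : ℕ) * (m : ℕ) : ℝ)))) := by
    intro m'
    rw [relPhase, relPhase, map_mul, Complex.conj_conj, conj_carrier, conj_carrier, carrier,
      carrier]
    simp only [← Complex.exp_conj, map_mul, Complex.conj_I, Complex.conj_ofReal,
      ← Complex.exp_add, neg_mul, centralFreq]
    congr 1
    push_cast
    ring
  simp only [circ, Matrix.hadamard_apply, Matrix.vecMulVec_apply]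
  rw [Matrix.diagonal_map Complex.ofReal_zero, Matrix.mul_apply, Finset.sum_mul, Finset.mul_sum]
  refine Finset.sum_congr rfl fun m' _ => ?_
  rw [Matrix.mul_diagonal, hphase, Matrix.conjTranspose_apply]
  simp only [fourier, Matrix.of_apply, RCLike.star_def, map_mul, map_inv₀,
    Complex.conj_ofReal]
  rw [show (4 * (M : ℂ) ^ 2)⁻¹ = (2 * (M : ℂ))⁻¹ * (2 * (M : ℂ))⁻¹ by rw [← mul_inv]; ring,
    ← inv_sqrt_mul_inv_sqrt]
  ring

lemma transpose_Uplus (M : ℕ) : (Uplus M)ᵀ = Uplus M := by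
  ext a b
  rw [Matrix.transpose_apply, Uplus_apply, Uplus_apply]
  congr 1
  · simp [eq_comm]
  · refine if_congr ⟨?_, ?_⟩ rfl rfl <;> rintro rfl <;> simp

lemma transpose_Uminus (M : ℕ) : (Uminus M)ᵀ = Uminus M := by
  ext a b
  rw [Matrix.transpose_apply, Uminus_apply, Uminus_apply]
  congr 1
  · simp [eq_comm]
  · refine if_congr ⟨?_, ?_⟩ rfl rfl <;> rintro rfl <;> simp

lemma tr3_mul_transpose {M : ℕ} {γ : Type*} [Fintype γ] (U : Matrix (Fin (2 * M)) (Fin (2 * M)) ℝ)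
    (hU : Uᵀ = U) (d : Fin (2 * M) → ℝ) (m : Fin (2 * M)) (Y Z : Matrix (Fin (2 * M)) γ ℝ) :
    tr3 U (circ (Matrix.diagonal d) m) (Y * Zᵀ) =
      (4 * (M : ℂ) ^ 2)⁻¹ * ∑ m', (d m' : ℂ) *
        ∑ c, colTransform Y m m' c * conj (colTransform (U * Z) m m' c) := by
  rw [tr3, Matrix.mul_assoc, Matrix.trace_mul_comm, Matrix.mul_assoc]
  have hmap : (Y * Zᵀ).map Complex.ofReal * U.map Complex.ofReal =
      (Y * (U * Z)ᵀ).map Complex.ofReal := by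
    rw [Matrix.transpose_mul, hU, ← Matrix.mul_assoc]
    exact (Matrix.map_mul (f := Complex.ofRealHom)).symm
  rw [hmap]
  have hentry : ∀ a b, circ (Matrix.diagonal d) m a b * ((Y * (U * Z)ᵀ) b a : ℂ) =
      ∑ m', ∑ c, (4 * (M : ℂ) ^ 2)⁻¹ * (d m' : ℂ) *
        ((Y b c * relPhase m m' b) * ((U * Z) a c * conj (relPhase m m' a))) := by
    intro a b
    rw [circ_diagonal_apply, Matrix.mul_apply]
    simp only [Matrix.transpose_apply (U * Z)]
    push_cast
    rw [Finset.mul_sum]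
    refine Eq.trans (Finset.sum_congr rfl fun c _ => ?_) Finset.sum_comm
    rw [Finset.mul_sum, Finset.sum_mul]
    refine Finset.sum_congr rfl fun m' _ => ?_
    ring
  have hcol : ∀ m' c, colTransform Y m m' c * conj (colTransform (U * Z) m m' c) =
      ∑ a, ∑ b, (Y b c * relPhase m m' b) * ((U * Z) a c * conj (relPhase m m' a)) := by
    intro m' c
    rw [conj_colTransform, colTransform, Finset.sum_mul_sum, Finset.sum_comm]
  simp only [Matrix.trace, Matrix.diag_apply, Matrix.mul_apply (M := circ _ _), Matrix.map_apply,
    hentry, hcol, Finset.mul_sum]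
  calc _ = ∑ a, ∑ m', ∑ b, ∑ c, (4 * (M : ℂ) ^ 2)⁻¹ * (d m' : ℂ) *
        ((Y b c * relPhase m m' b) * ((U * Z) a c * conj (relPhase m m' a))) :=
        Finset.sum_congr rfl fun a _ => Finset.sum_comm
    _ = ∑ m', ∑ a, ∑ c, ∑ b, (4 * (M : ℂ) ^ 2)⁻¹ * (d m' : ℂ) *
        ((Y b c * relPhase m m' b) * ((U * Z) a c * conj (relPhase m m' a))) := by
        rw [Finset.sum_comm]
        exact Finset.sum_congr rfl fun m' _ => Finset.sum_congr rfl fun a _ => Finset.sum_comm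
    _ = _ := by
        refine Finset.sum_congr rfl fun m' _ => ?_
        rw [Finset.sum_comm]
        simp only [mul_assoc]

lemma colTransform_Uplus_mul {M : ℕ} {γ : Type*} (Z : Matrix (Fin (2 * M)) γ ℝ)
    (m m' : Fin (2 * M)) (c : γ) :
    conj (colTransform (Uplus M * Z) m m' c) =
      conj (colTransform Z m m' c) + colTransform Z m m' c := by
  rw [conj_colTransform, conj_colTransform Z, ← sum_flip_mul_conj_relPhase,
    ← Finset.sum_add_distrib]
  simp only [Uplus_mul_apply, Complex.ofReal_add, add_mul]

lemma colTransform_Uminus_mul {M : ℕ} {γ : Type*} (Z : Matrix (Fin (2 * M)) γ ℝ)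
    (m m' : Fin (2 * M)) (c : γ) :
    conj (colTransform (Uminus M * Z) m m' c) =
      conj (colTransform Z m m' c) - colTransform Z m m' c := by
  rw [conj_colTransform, conj_colTransform Z, ← sum_flip_mul_conj_relPhase,
    ← Finset.sum_sub_distrib]
  simp only [Uminus_mul_apply, Complex.ofReal_sub, sub_mul]

/-- The matrix `U⁺` extracts the real part of the transform of the second factor. -/
lemma tr3_Uplus_mul_transpose {M : ℕ} {γ : Type*} [Fintype γ] (d : Fin (2 * M) → ℝ)
    (m : Fin (2 * M)) (Y Z : Matrix (Fin (2 * M)) γ ℝ) :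
    tr3 (Uplus M) (circ (Matrix.diagonal d) m) (Y * Zᵀ) =
      (2 * (M : ℂ) ^ 2)⁻¹ * ∑ m', (d m' : ℂ) *
        ∑ c, colTransform Y m m' c * ((colTransform Z m m' c).re : ℂ) := by
  rw [tr3_mul_transpose _ (transpose_Uplus M)]
  simp only [colTransform_Uplus_mul, add_comm (conj _), Complex.add_conj, Finset.mul_sum]
  refine Finset.sum_congr rfl fun m' _ => Finset.sum_congr rfl fun c _ => ?_
  push_cast
  ring

/-- The matrix `U⁻` extracts the imaginary part of the transform of the second factor. -/
lemma tr3_Uminus_mul_transpose {M : ℕ} {γ : Type*} [Fintype γ] (d : Fin (2 * M) → ℝ)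
    (m : Fin (2 * M)) (Y Z : Matrix (Fin (2 * M)) γ ℝ) :
    tr3 (Uminus M) (circ (Matrix.diagonal d) m) (Y * Zᵀ) =
      (2 * (M : ℂ) ^ 2)⁻¹ * ∑ m', (d m' : ℂ) *
        ∑ c, colTransform Y m m' c * (-Complex.I * ((colTransform Z m m' c).im : ℂ)) := by
  rw [tr3_mul_transpose _ (transpose_Uminus M)]
  simp only [colTransform_Uminus_mul, Finset.mul_sum]
  refine Finset.sum_congr rfl fun m' _ => Finset.sum_congr rfl fun c _ => ?_
  rw [← neg_sub (colTransform Z m m' c), Complex.sub_conj]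
  push_cast
  ring

/-! ### Taps and the entries of the polyphase products -/

lemma tap_coe {M κ : ℕ} (p : Pulse M κ) (i : Fin (κ * (2 * M))) : tap p ((i : ℕ) : ℤ) = p i := by
  rw [tap, dif_pos ⟨by omega, by simp⟩]
  congr 1

lemma tap_of_neg {M κ : ℕ} (p : Pulse M κ) {t : ℤ} (h : t < 0) : tap p t = 0 := by
  rw [tap, dif_neg]
  omega

lemma tap_of_le {M κ : ℕ} (p : Pulse M κ) {t : ℤ} (h : κ * (2 * M) ≤ t) : tap p t = 0 := by
  rw [tap, dif_neg]
  rintro ⟨h0, h1⟩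
  have : (t.toNat : ℤ) < (κ * (2 * M) : ℕ) := by exact_mod_cast h1
  rw [Int.toNat_of_nonneg h0] at this
  push_cast at this
  omega

lemma tap_reflect {M κ : ℕ} {q : Pulse M κ} {s : ℝ} (hq : ∀ i, q i.rev = s * q i) (t : ℤ) :
    tap q (κ * (2 * M) - 1 - t) = s * tap q t := by
  by_cases h0 : t < 0
  · rw [tap_of_neg q h0, tap_of_le q (by omega), mul_zero]
  by_cases h1 : κ * (2 * M) ≤ t
  · rw [tap_of_le q h1, tap_of_neg q (by omega), mul_zero]
  obtain ⟨i, rfl⟩ : ∃ i : Fin (κ * (2 * M)), t = ((i : ℕ) : ℤ) := by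
    refine ⟨⟨t.toNat, ?_⟩, ?_⟩
    · have : (t.toNat : ℤ) < (κ * (2 * M) : ℕ) := by
        rw [Int.toNat_of_nonneg (by omega)]
        push_cast
        omega
      exact_mod_cast this
    · simp only
      omega
  rw [tap_coe, ← hq, ← tap_coe q]
  congr 1
  have := i.isLt
  have h2 : ((i.rev : ℕ) : ℤ) = ((κ * (2 * M) : ℕ) : ℤ) - 1 - (i : ℕ) := by
    rw [Fin.val_rev]
    omega
  rw [h2]
  push_cast
  ring

lemma polyphase_apply {M κ : ℕ} (p : Pulse M κ) (ν : Fin (2 * M)) (a : Fin κ) :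
    polyphase p ν a = tap p ((ν : ℕ) + 2 * M * (a : ℕ)) := by
  rw [← coe_finProdFinEquiv, tap_coe]
  rfl

/-- The range of the row-wise convolution is implied by the vanishing of the taps outside the pulse. -/
lemma sum_ite_add_eq_tap {M κ : ℕ} (q : Pulse M κ) (x : Fin (2 * M)) (a c : ℕ) (y : ℝ) :
    ∑ b : Fin κ, (if a + (b : ℕ) = c then y * tap q ((x : ℕ) + 2 * M * (b : ℕ)) else 0) =
      y * tap q ((x : ℕ) + 2 * M * ((c : ℤ) - a)) := by
  have hx := x.isLt
  have hM : 0 < M := by omega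
  by_cases h : a ≤ c ∧ c - a < κ
  · rw [Finset.sum_eq_single ⟨c - a, h.2⟩]
    · have : ((c - a : ℕ) : ℤ) = (c : ℤ) - a := by omega
      simp only [← this]
      rw [if_pos]
      omega
    · intro b _ hb
      rw [if_neg]
      intro h'
      exact hb (Fin.ext (by simp only; omega))
    · simp
  · rw [Finset.sum_eq_zero]
    · rcases lt_or_ge c a with h' | h'
      · rw [tap_of_neg, mul_zero]
        nlinarith
      · rw [tap_of_le, mul_zero]
        have : (κ : ℤ) ≤ (c : ℤ) - a := by omega
        nlinarith
    · intro b _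
      have := b.isLt
      rw [if_neg]
      omega

lemma antiId_mul_apply {M : ℕ} {γ : Type*} (A : Matrix (Fin M) γ ℝ) (i : Fin M) (c : γ) :
    (antiId M * A) i c = A i.rev c := by
  simp [antiId, Matrix.mul_apply]

lemma stack_topIdx {M : ℕ} {γ : Type*} (A B : Matrix (Fin M) γ ℝ) (i : Fin M) (c : γ) :
    stack A B (topIdx i) c = A i c := by
  simp [stack]

lemma stack_botIdx {M : ℕ} {γ : Type*} (A B : Matrix (Fin M) γ ℝ) (i : Fin M) (c : γ) :
    stack A B (botIdx i) c = B i c := by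
  simp [stack]

lemma upper_apply {M : ℕ} {γ : Type*} (A : Matrix (Fin (2 * M)) γ ℝ) (i : Fin M) (c : γ) :
    upper A i c = A (topIdx i) c := rfl

lemma lower_apply {M : ℕ} {γ : Type*} (A : Matrix (Fin (2 * M)) γ ℝ) (i : Fin M) (c : γ) :
    lower A i c = A (botIdx i) c := rfl

lemma rowConv_polyphase {M κ : ℕ} {ι : Type*} (p q : Pulse M κ) (A B : Matrix ι (Fin κ) ℝ) (i : ι)
    (μ x : Fin (2 * M)) (hA : ∀ a, A i a = polyphase p μ a) (hB : ∀ b, B i b = polyphase q x b)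
    (c : Fin (2 * κ - 1)) :
    rowConv A B i c =
      ∑ a : Fin κ, polyphase p μ a * tap q ((x : ℕ) + 2 * M * ((c : ℕ) - (a : ℕ))) := by
  simp only [rowConv, Matrix.of_apply]
  refine Finset.sum_congr rfl fun a _ => ?_
  simp only [hA, hB, polyphase_apply q]
  exact sum_ite_add_eq_tap q x a c _

/-- The products of the taps of the transmit pulse congruent to `μ` modulo `2 M` with the receive
pulse read backwards from sample `T`, summed. The rows of `𝓡` and `𝓢` are instances of it. -/
def foldedProduct {M κ : ℕ} (p q : Pulse M κ) (μ : Fin (2 * M)) (T : ℤ) : ℝ :=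
  ∑ a : Fin κ, polyphase p μ a * tap q (T - (μ : ℕ) - 2 * M * (a : ℕ))

lemma recR_apply {M κ : ℕ} (p q : Pulse M κ) (ν : Fin (2 * M)) (c : Fin (2 * κ - 1)) :
    recR p q ν c = foldedProduct p q ν (2 * M * ((c : ℕ) + 1) - 1) := by
  rcases topIdx_or_botIdx ν with ⟨i, rfl⟩ | ⟨i, rfl⟩
  · rw [recR, stack_topIdx, rowConv_polyphase p q _ _ i (topIdx i) (botIdx i.rev) (fun a => rfl)
      (fun b => by rw [antiId_mul_apply]; rfl)]
    refine Finset.sum_congr rfl fun a _ => ?_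
    congr 2
    have := i.isLt
    have h : ((i.rev : ℕ) : ℤ) = M - 1 - (i : ℕ) := by rw [Fin.val_rev]; omega
    simp only [coe_topIdx, coe_botIdx]
    push_cast
    rw [h]
    ring
  · rw [recR, stack_botIdx, rowConv_polyphase p q _ _ i (botIdx i) (topIdx i.rev) (fun a => rfl)
      (fun b => by rw [antiId_mul_apply]; rfl)]
    refine Finset.sum_congr rfl fun a _ => ?_
    congr 2
    have := i.isLt
    have h : ((i.rev : ℕ) : ℤ) = M - 1 - (i : ℕ) := by rw [Fin.val_rev]; omega
    simp only [coe_topIdx, coe_botIdx]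
    push_cast
    rw [h]
    ring

lemma recS_topIdx {M κ : ℕ} (p q : Pulse M κ) (i : Fin M) (c : Fin (2 * κ - 1)) :
    recS p q (topIdx i) c = foldedProduct p q (botIdx i) (2 * M * ((c : ℕ) + 2) - M - 1) := by
  rw [recS, stack_topIdx, rowConv_polyphase p q _ _ i (botIdx i) (botIdx i.rev) (fun a => rfl)
    (fun b => by rw [antiId_mul_apply]; rfl)]
  refine Finset.sum_congr rfl fun a _ => ?_
  congr 2
  have := i.isLt
  have h : ((i.rev : ℕ) : ℤ) = M - 1 - (i : ℕ) := by rw [Fin.val_rev]; omega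
  simp only [coe_botIdx]
  push_cast
  rw [h]
  ring

lemma recS_botIdx {M κ : ℕ} (p q : Pulse M κ) (i : Fin M) (c : Fin (2 * κ - 1)) :
    recS p q (botIdx i) c = foldedProduct p q (topIdx i) (2 * M * ((c : ℕ) + 1) - M - 1) := by
  rw [recS, stack_botIdx, rowConv_polyphase p q _ _ i (topIdx i) (topIdx i.rev) (fun a => rfl)
    (fun b => by rw [antiId_mul_apply]; rfl)]
  refine Finset.sum_congr rfl fun a _ => ?_
  congr 2
  have := i.isLt
  have h : ((i.rev : ℕ) : ℤ) = M - 1 - (i : ℕ) := by rw [Fin.val_rev]; omega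
  simp only [coe_topIdx]
  rw [h]
  ring

/-- The matrix `[0, 𝓢₁; 𝓢₂, 0]` that collects the response to the staggered symbols. -/
def stackedS {M κ : ℕ} (p q : Pulse M κ) : Matrix (Fin (2 * M)) (Fin (2 * κ - 1 + 1)) ℝ :=
  stack (padLeft (upper (recS p q))) (padRight (lower (recS p q)))

lemma padLeft_mul_padLeft {M n : ℕ} (A B : Matrix (Fin M) (Fin n) ℝ) :
    padLeft A * (padLeft B)ᵀ = A * Bᵀ := by
  ext i j
  simp [Matrix.mul_apply, padLeft, Fin.sum_univ_succ]

lemma padRight_mul_padRight {M n : ℕ} (A B : Matrix (Fin M) (Fin n) ℝ) :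
    padRight A * (padRight B)ᵀ = A * Bᵀ := by
  ext i j
  simp [Matrix.mul_apply, padRight, Fin.sum_univ_castSucc]

lemma XS_eq_mul_transpose {M κ : ℕ} (p q₁ q₂ : Pulse M κ) :
    XS p q₁ q₂ = stackedS p q₁ * (stackedS p q₂)ᵀ := by
  rw [XS, ← padLeft_mul_padLeft (upper _), ← padRight_mul_padRight (lower _)]
  ext a b
  rcases topIdx_or_botIdx a with ⟨i, rfl⟩ | ⟨i, rfl⟩ <;>
    rcases topIdx_or_botIdx b with ⟨j, rfl⟩ | ⟨j, rfl⟩ <;>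
    simp [blocks, stackedS, Matrix.mul_apply, stack_topIdx, stack_botIdx]

/-- Row `swapHalves μ` of `[0, 𝓢₁; 𝓢₂, 0]` comes from row `μ` of the transmit pulse. -/
lemma stackedS_apply {M κ : ℕ} (p q : Pulse M κ) (μ : Fin (2 * M)) (c : Fin (2 * κ - 1 + 1)) :
    stackedS p q (swapHalves μ) c = foldedProduct p q μ (2 * M * ((c : ℕ) + 1) - M - 1) := by
  have hμ := μ.isLt
  have hM : 0 < M := by omega
  rcases topIdx_or_botIdx μ with ⟨i, rfl⟩ | ⟨i, rfl⟩
  · rw [swapHalves_topIdx, stackedS, stack_botIdx]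
    refine Fin.lastCases ?_ (fun c => ?_) c
    · simp only [padRight, Matrix.of_apply, Fin.snoc_last, Fin.val_last]
      rw [foldedProduct, Finset.sum_eq_zero]
      intro a _
      have hi := i.isLt
      have ha := a.isLt
      rw [tap_of_le, mul_zero]
      have : ((2 * κ - 1 : ℕ) : ℤ) = 2 * κ - 1 := by omega
      rw [this, coe_topIdx]
      nlinarith
    · simp only [padRight, Matrix.of_apply, Fin.snoc_castSucc, Fin.val_castSucc]
      rw [lower_apply, recS_botIdx]
  · rw [swapHalves_botIdx, stackedS, stack_topIdx]
    refine Fin.cases ?_ (fun c => ?_) c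
    · simp only [padLeft, Matrix.of_apply, Fin.cons_zero, Fin.val_zero]
      rw [foldedProduct, Finset.sum_eq_zero]
      intro a _
      rw [tap_of_neg, mul_zero]
      rw [coe_botIdx]
      push_cast
      nlinarith [a.isLt]
    · simp only [padLeft, Matrix.of_apply, Fin.cons_succ, Fin.val_succ]
      rw [upper_apply, recS_topIdx]
      congr 1

/-! ### Symmetries -/

/-- Reversal of both pulses reverses the instants `0, …, 2 (N - 1)` at which they can meet. -/
lemma foldedProduct_rev {M κ : ℕ} {p q : Pulse M κ} {s : ℝ} (hp : IsSymm p)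
    (hq : ∀ i, q i.rev = s * q i) (μ : Fin (2 * M)) (T : ℤ) :
    foldedProduct p q μ.rev (4 * M * κ - 2 - T) = s * foldedProduct p q μ T := by
  rw [foldedProduct, foldedProduct, ← Equiv.sum_comp Fin.revPerm, Finset.mul_sum]
  refine Finset.sum_congr rfl fun a _ => ?_
  have hμ := μ.isLt
  have ha := a.isLt
  have h1 : ((μ.rev : ℕ) : ℤ) = 2 * M - 1 - (μ : ℕ) := by rw [Fin.val_rev]; omega
  have h2 : ((a.rev : ℕ) : ℤ) = κ - 1 - (a : ℕ) := by rw [Fin.val_rev]; omega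
  have hpp : polyphase p μ.rev a.rev = polyphase p μ a := by
    rw [polyphase_apply, polyphase_apply]
    have := tap_reflect (q := p) (s := 1) (fun i => by rw [hp, one_mul])
      ((μ : ℕ) + 2 * M * (a : ℕ))
    rw [one_mul] at this
    rw [← this, h1, h2]
    congr 1
    ring
  rw [Fin.revPerm_apply, hpp, mul_left_comm, ← tap_reflect hq, h1, h2]
  congr 2
  ring

lemma recR_rev {M κ : ℕ} {p q : Pulse M κ} {s : ℝ} (hp : IsSymm p)
    (hq : ∀ i, q i.rev = s * q i) (ν : Fin (2 * M)) (c : Fin (2 * κ - 1)) :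
    recR p q ν.rev c.rev = s * recR p q ν c := by
  rw [recR_apply, recR_apply, ← foldedProduct_rev hp hq]
  congr 1
  have hc := c.isLt
  have h : ((c.rev : ℕ) : ℤ) = 2 * κ - 2 - (c : ℕ) := by rw [Fin.val_rev]; omega
  rw [h]
  ring

lemma stackedS_rev {M κ : ℕ} (hκ : 1 ≤ κ) {p q : Pulse M κ} {s : ℝ} (hp : IsSymm p)
    (hq : ∀ i, q i.rev = s * q i) (ν : Fin (2 * M)) (c : Fin (2 * κ - 1 + 1)) :
    stackedS p q ν.rev c.rev = s * stackedS p q ν c := by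
  obtain ⟨μ, rfl⟩ := swapHalves.surjective ν
  rw [← swapHalves_rev, stackedS_apply, stackedS_apply, ← foldedProduct_rev hp hq]
  congr 1
  have hc := c.isLt
  have h : ((c.rev : ℕ) : ℤ) = 2 * κ - 1 - (c : ℕ) := by rw [Fin.val_rev]; omega
  rw [h]
  ring

lemma centralOnes_rev {M κ : ℕ} (ν ν' : Fin (2 * M)) (c : Fin (2 * κ - 1)) :
    centralOnes M κ ν c.rev = centralOnes M κ ν' c := by
  have hc := c.isLt
  simp only [centralOnes, Matrix.of_apply, Fin.val_rev]
  refine if_congr ?_ rfl rfl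
  omega

lemma recD_rev {M κ : ℕ} {p q : Pulse M κ} (hp : IsSymm p) (hq : IsSymm q)
    (ν : Fin (2 * M)) (c : Fin (2 * κ - 1)) :
    recD p q ν.rev c.rev = recD p q ν c := by
  have h := recR_rev (q := q) (s := 1) hp (fun i => by rw [hq, one_mul]) ν c
  rw [one_mul] at h
  simp only [recD, Matrix.sub_apply, Matrix.smul_apply, h, centralOnes_rev ν.rev ν]

/-- The first perfect-reconstruction condition makes `𝓓` odd inside each half. -/
lemma recD_flip {M κ : ℕ} {p q : Pulse M κ} (h : IsPR p q) (ν : Fin (2 * M))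
    (c : Fin (2 * κ - 1)) : recD p q (flip ν) c = -recD p q ν c := by
  have h1 := congrFun (congrFun h.1 ν) c
  rw [Uplus_mul_apply] at h1
  have h2 : centralOnes M κ (flip ν) c = centralOnes M κ ν c := rfl
  simp only [recD, Matrix.sub_apply, Matrix.smul_apply, smul_eq_mul, h2]
  linarith

/-- The second perfect-reconstruction condition makes `𝓢` even inside each half. -/
lemma recS_flip {M κ : ℕ} {p q : Pulse M κ} (h : IsPR p q) (ν : Fin (2 * M))
    (c : Fin (2 * κ - 1)) : recS p q (flip ν) c = recS p q ν c := by
  have h1 := congrFun (congrFun h.2 ν) c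
  rw [Uminus_mul_apply, Matrix.zero_apply] at h1
  linarith

lemma stackedS_flip {M κ : ℕ} {p q : Pulse M κ} (h : IsPR p q) (ν : Fin (2 * M))
    (c : Fin (2 * κ - 1 + 1)) : stackedS p q (flip ν) c = stackedS p q ν c := by
  rcases topIdx_or_botIdx ν with ⟨i, rfl⟩ | ⟨i, rfl⟩
  · rw [flip_topIdx, stackedS, stack_topIdx, stack_topIdx]
    refine Fin.cases rfl (fun c => ?_) c
    simp only [padLeft, Matrix.of_apply, Fin.cons_succ]
    rw [upper_apply, upper_apply, ← flip_topIdx, recS_flip h]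
  · rw [flip_botIdx, stackedS, stack_botIdx, stack_botIdx]
    refine Fin.lastCases ?_ (fun c => ?_) c
    · simp [padRight]
    · simp only [padRight, Matrix.of_apply, Fin.snoc_castSucc]
      rw [lower_apply, lower_apply, ← flip_botIdx, recS_flip h]

lemma colTransform_rev {M n : ℕ} {Y : Matrix (Fin (2 * M)) (Fin n) ℝ} {s : ℝ}
    (hY : ∀ ν c, Y ν.rev c.rev = s * Y ν c) (m m' : Fin (2 * M)) (c : Fin n) :
    colTransform Y m m' c.rev =
      (s * (-1) ^ ((m : ℕ) + (m' : ℕ)) : ℝ) * conj (colTransform Y m m' c) := by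
  rw [conj_colTransform, colTransform, ← Equiv.sum_comp Fin.revPerm, Finset.mul_sum]
  refine Finset.sum_congr rfl fun ν _ => ?_
  rw [Fin.revPerm_apply, hY, relPhase_rev]
  push_cast
  ring

lemma conj_colTransform_of_flip {M : ℕ} {γ : Type*} {Y : Matrix (Fin (2 * M)) γ ℝ} {s : ℝ}
    (hY : ∀ ν c, Y (flip ν) c = s * Y ν c) (m m' : Fin (2 * M)) (c : γ) :
    conj (colTransform Y m m' c) = s * colTransform Y m m' c := by
  rw [conj_colTransform, colTransform, ← Equiv.sum_comp flip, Finset.mul_sum]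
  refine Finset.sum_congr rfl fun ν _ => ?_
  rw [hY, relPhase_flip, Complex.conj_conj]
  push_cast
  ring

/-! ### Quadratic sums over the columns -/

lemma sum_eq_zero_of_rev {n : ℕ} (f : Fin n → ℝ) (hf : ∀ c, f c.rev = -f c) : ∑ c, f c = 0 := by
  have h := Equiv.sum_comp Fin.revPerm f
  simp only [Fin.revPerm_apply, hf, Finset.sum_neg_distrib] at h
  linarith

/-- Reversal of the columns conjugates `S`, up to a sign `t`; it does the same to the response `G₁`
to the odd pulse `q'` up to `-t`, and to the response `G₂` to the even pulse `q''` up to `t`. -/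
structure ColumnSymmetry {n : ℕ} (t : ℝ) (S G₁ G₂ : Fin n → ℂ) : Prop where
  sq_eq_one : t * t = 1
  re_eq_zero : ∀ c, (S c).re = 0
  rev_S : ∀ c, S c.rev = t * conj (S c)
  rev_one : ∀ c, G₁ c.rev = (-t : ℝ) * conj (G₁ c)
  rev_two : ∀ c, G₂ c.rev = t * conj (G₂ c)

namespace ColumnSymmetry

variable {n : ℕ} {t : ℝ} {S G₁ G₂ : Fin n → ℂ}

lemma sum_zero_zero (h : ColumnSymmetry t S G₁ G₂) (w : ℂ) :
    ∑ c, (w * S c).re * (w * S c).re = w.im ^ 2 * ∑ c, (S c).im * (S c).im := by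
  rw [Finset.mul_sum]
  refine Finset.sum_congr rfl fun c _ => ?_
  rw [Complex.mul_re, h.re_eq_zero]
  ring

lemma sum_zero_one (h : ColumnSymmetry t S G₁ G₂) (w v : ℂ) :
    ∑ c, (w * S c).re * (-Complex.I * v * G₁ c).re =
      -(w.im * v.im) * ∑ c, (S c).im * (G₁ c).re := by
  have h0 : ∑ c, (S c).im * (G₁ c).im = 0 := by
    refine sum_eq_zero_of_rev _ fun c => ?_
    rw [h.rev_S, h.rev_one, Complex.im_ofReal_mul, Complex.im_ofReal_mul, Complex.conj_im,
      Complex.conj_im]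
    linear_combination -(S c).im * (G₁ c).im * h.sq_eq_one
  calc _ = -(w.im * v.im) * ∑ c, (S c).im * (G₁ c).re
        + -(w.im * v.re) * ∑ c, (S c).im * (G₁ c).im := by
        rw [Finset.mul_sum, Finset.mul_sum, ← Finset.sum_add_distrib]
        refine Finset.sum_congr rfl fun c _ => ?_
        simp only [Complex.mul_re, Complex.mul_im, Complex.neg_re, Complex.neg_im, Complex.I_re,
          Complex.I_im, h.re_eq_zero]
        ring
    _ = _ := by rw [h0]; ring

lemma sum_zero_two (h : ColumnSymmetry t S G₁ G₂) (w v : ℂ) :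
    ∑ c, (w * S c).re * (-v * G₂ c).re = -(w.im * v.im) * ∑ c, (S c).im * (G₂ c).im := by
  have h0 : ∑ c, (S c).im * (G₂ c).re = 0 := by
    refine sum_eq_zero_of_rev _ fun c => ?_
    rw [h.rev_S, h.rev_two, Complex.im_ofReal_mul, Complex.re_ofReal_mul, Complex.conj_im,
      Complex.conj_re]
    linear_combination -(S c).im * (G₂ c).re * h.sq_eq_one
  calc _ = -(w.im * v.im) * ∑ c, (S c).im * (G₂ c).im
        + (w.im * v.re) * ∑ c, (S c).im * (G₂ c).re := by
        rw [Finset.mul_sum, Finset.mul_sum, ← Finset.sum_add_distrib]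
        refine Finset.sum_congr rfl fun c _ => ?_
        simp only [Complex.mul_re, Complex.neg_re, Complex.neg_im, h.re_eq_zero]
        ring
    _ = _ := by rw [h0]; ring

lemma sum_one_one (h : ColumnSymmetry t S G₁ G₂) (v : ℂ) :
    ∑ c, (-Complex.I * v * G₁ c).re * (-Complex.I * v * G₁ c).re =
      v.im ^ 2 * ∑ c, (G₁ c).re * (G₁ c).re + v.re ^ 2 * ∑ c, (G₁ c).im * (G₁ c).im := by
  have h0 : ∑ c, (G₁ c).re * (G₁ c).im = 0 := by
    refine sum_eq_zero_of_rev _ fun c => ?_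
    rw [h.rev_one, Complex.im_ofReal_mul, Complex.re_ofReal_mul, Complex.conj_im,
      Complex.conj_re]
    linear_combination -(G₁ c).re * (G₁ c).im * h.sq_eq_one
  calc _ = v.im ^ 2 * ∑ c, (G₁ c).re * (G₁ c).re + v.re ^ 2 * ∑ c, (G₁ c).im * (G₁ c).im
        + 2 * v.re * v.im * ∑ c, (G₁ c).re * (G₁ c).im := by
        rw [Finset.mul_sum, Finset.mul_sum, Finset.mul_sum, ← Finset.sum_add_distrib,
          ← Finset.sum_add_distrib]
        refine Finset.sum_congr rfl fun c _ => ?_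
        simp only [Complex.mul_re, Complex.mul_im, Complex.neg_re, Complex.neg_im, Complex.I_re,
          Complex.I_im]
        ring
    _ = _ := by rw [h0]; ring

end ColumnSymmetry

/-- The responses to the real parts of the symbols. -/
lemma columnSymmetry_recR {M κ : ℕ} {p q q₁ q₂ : Pulse M κ} (hPR : IsPR p q) (hp : IsSymm p)
    (hq : IsSymm q) (hq₁ : ∀ i, q₁ i.rev = -1 * q₁ i) (hq₂ : IsSymm q₂) (m m' : Fin (2 * M)) :
    ColumnSymmetry ((-1) ^ ((m : ℕ) + (m' : ℕ))) (colTransform (recD p q) m m')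
      (colTransform (recR p q₁) m m') (colTransform (recR p q₂) m m') where
  sq_eq_one := by rw [← mul_pow]; simp
  re_eq_zero c := by
    have h := conj_colTransform_of_flip (s := -1)
      (fun ν c => by rw [recD_flip hPR, neg_one_mul]) m m' c (Y := recD p q)
    have h2 := congrArg Complex.re h
    rw [Complex.re_ofReal_mul, Complex.conj_re] at h2
    linarith
  rev_S c := by
    rw [colTransform_rev (s := 1) (fun ν c => by rw [recD_rev hp hq, one_mul]), one_mul]
  rev_one c := by
    rw [colTransform_rev (s := -1) (fun ν c => recR_rev hp hq₁ ν c), neg_one_mul]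
  rev_two c := by
    rw [colTransform_rev (s := 1) (fun ν c => recR_rev hp (fun i => by rw [hq₂, one_mul]) ν c),
      one_mul]

/-- The responses to the imaginary parts of the symbols, whose factor `j` exchanges real and
imaginary parts. -/
lemma columnSymmetry_stackedS {M κ : ℕ} (hκ : 1 ≤ κ) {p q q₁ q₂ : Pulse M κ} (hPR : IsPR p q)
    (hp : IsSymm p) (hq : IsSymm q) (hq₁ : ∀ i, q₁ i.rev = -1 * q₁ i) (hq₂ : IsSymm q₂)
    (m m' : Fin (2 * M)) :
    ColumnSymmetry (-(-1) ^ ((m : ℕ) + (m' : ℕ)))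
      (fun c => Complex.I * colTransform (stackedS p q) m m' c)
      (fun c => Complex.I * colTransform (stackedS p q₁) m m' c)
      (fun c => Complex.I * colTransform (stackedS p q₂) m m' c) where
  sq_eq_one := by rw [neg_mul_neg, ← mul_pow]; simp
  re_eq_zero c := by
    have h := conj_colTransform_of_flip (s := 1)
      (fun ν c => by rw [stackedS_flip hPR, one_mul]) m m' c (Y := stackedS p q)
    have h2 := congrArg Complex.im h
    rw [Complex.im_ofReal_mul, Complex.conj_im] at h2
    rw [Complex.I_mul_re]
    linarith
  rev_S c := by
    rw [colTransform_rev (s := 1)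
      (fun ν c => stackedS_rev hκ hp (fun i => by rw [hq, one_mul]) ν c), map_mul, Complex.conj_I]
    push_cast
    ring
  rev_one c := by
    rw [colTransform_rev (s := -1) (fun ν c => stackedS_rev hκ hp hq₁ ν c), map_mul,
      Complex.conj_I]
    push_cast
    ring
  rev_two c := by
    rw [colTransform_rev (s := 1)
      (fun ν c => stackedS_rev hκ hp (fun i => by rw [hq₂, one_mul]) ν c), map_mul,
      Complex.conj_I]
    push_cast
    ring

/-! ### The terms of the formula as quadratic forms -/

section Traces

variable {M : ℕ} {γ : Type*} [Fintype γ] (d : Fin (2 * M) → ℝ) (m : Fin (2 * M))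
  (Y Z : Matrix (Fin (2 * M)) γ ℝ)

lemma tr3_Uplus_eq :
    tr3 (Uplus M) (circ (Matrix.diagonal d) m) (Y * Zᵀ) =
      ((2 * (M : ℝ) ^ 2)⁻¹ * ∑ m', d m' *
        ∑ c, (colTransform Y m m' c).re * (colTransform Z m m' c).re : ℝ) +
      ((2 * (M : ℝ) ^ 2)⁻¹ * ∑ m', d m' *
        ∑ c, (colTransform Y m m' c).im * (colTransform Z m m' c).re : ℝ) * Complex.I := by
  rw [tr3_Uplus_mul_transpose]
  push_cast
  simp only [mul_assoc, ← mul_add, Finset.sum_mul, ← Finset.sum_add_distrib]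
  congr 1
  refine Finset.sum_congr rfl fun m' _ => ?_
  congr 1
  refine Finset.sum_congr rfl fun c _ => ?_
  conv_lhs => rw [← Complex.re_add_im (colTransform Y m m' c)]
  ring

lemma tr3_Uminus_eq :
    tr3 (Uminus M) (circ (Matrix.diagonal d) m) (Y * Zᵀ) =
      ((2 * (M : ℝ) ^ 2)⁻¹ * ∑ m', d m' *
        ∑ c, (colTransform Y m m' c).im * (colTransform Z m m' c).im : ℝ) +
      ((2 * (M : ℝ) ^ 2)⁻¹ * ∑ m', d m' *
        ∑ c, -((colTransform Y m m' c).re * (colTransform Z m m' c).im) : ℝ) * Complex.I := by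
  rw [tr3_Uminus_mul_transpose]
  push_cast
  simp only [mul_assoc, ← mul_add, Finset.sum_mul, ← Finset.sum_add_distrib]
  congr 1
  refine Finset.sum_congr rfl fun m' _ => ?_
  congr 1
  refine Finset.sum_congr rfl fun c _ => ?_
  conv_lhs => rw [← Complex.re_add_im (colTransform Y m m' c)]
  linear_combination (-(colTransform Y m m' c).im * (colTransform Z m m' c).im : ℂ) *
    Complex.I_mul_I

end Traces

/-- The quadratic form in which the responses `S`, `V` to real and imaginary parts of the symbols of
power `d` enter the distortion. -/
def quadForm {M n n' : ℕ} (d : Fin (2 * M) → ℝ) (S S' : Fin (2 * M) → Fin n → ℂ)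
    (V V' : Fin (2 * M) → Fin n' → ℂ) : ℝ :=
  ((M : ℝ) ^ 2)⁻¹ * ∑ m', d m' *
    (∑ c, (S m' c).re * (S' m' c).re + ∑ c, (V m' c).re * (V' m' c).re)

/-- Response to the staggered imaginary parts of the symbols; the modulation contributes the
factor `j`. -/
def staggeredTransform {M κ : ℕ} (p q : Pulse M κ) (m m' : Fin (2 * M))
    (c : Fin (2 * κ - 1 + 1)) : ℂ := Complex.I * colTransform (stackedS p q) m m' c

/-- The symmetries of the responses to real and imaginary parts of the symbols of all
subcarriers. -/
structure ResponseSymmetry {M κ : ℕ} (p q q₁ q₂ : Pulse M κ) (m : Fin (2 * M)) : Prop where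
  exists_recR : ∀ m', ∃ t, ColumnSymmetry t (colTransform (recD p q) m m')
    (colTransform (recR p q₁) m m') (colTransform (recR p q₂) m m')
  exists_stackedS : ∀ m', ∃ t, ColumnSymmetry t (staggeredTransform p q m m')
    (staggeredTransform p q₁ m m') (staggeredTransform p q₂ m m')

lemma responseSymmetry {M κ : ℕ} (hκ : 1 ≤ κ) {p q q₁ q₂ : Pulse M κ} (hPR : IsPR p q)
    (hp : IsSymm p) (hq : IsSymm q) (hq₁ : ∀ i, q₁ i.rev = -1 * q₁ i) (hq₂ : IsSymm q₂)
    (m : Fin (2 * M)) : ResponseSymmetry p q q₁ q₂ m where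
  exists_recR m' := ⟨_, columnSymmetry_recR hPR hp hq hq₁ hq₂ m m'⟩
  exists_stackedS m' := ⟨_, columnSymmetry_stackedS hκ hPR hp hq hq₁ hq₂ m m'⟩

section Eta

variable {M κ : ℕ} {p q q₁ q₂ : Pulse M κ} (d : Fin (2 * M) → ℝ) (m : Fin (2 * M))

lemma quad_combine (u : ℝ) (A B : Fin (2 * M) → ℝ) :
    2 * u * ((2 * (M : ℝ) ^ 2)⁻¹ * ∑ m', d m' * A m' + (2 * (M : ℝ) ^ 2)⁻¹ * ∑ m', d m' * B m') =
      ((M : ℝ) ^ 2)⁻¹ * ∑ m', d m' * (u * A m' + u * B m') := by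
  simp only [mul_add, Finset.sum_add_distrib, Finset.mul_sum, mul_inv]
  congr 1 <;> refine Finset.sum_congr rfl fun m' _ => ?_ <;> ring

lemma eta00_eq_quadForm (h : ResponseSymmetry p q q₁ q₂ m) (w : ℂ) :
    eta00 p q (circ (Matrix.diagonal d) m) w =
      quadForm d (fun m' c => w * colTransform (recD p q) m m' c)
        (fun m' c => w * colTransform (recD p q) m m' c)
        (fun m' c => w * staggeredTransform p q m m' c)
        (fun m' c => w * staggeredTransform p q m m' c) := by
  choose t hR using h.exists_recR
  choose s hS using h.exists_stackedS
  rw [eta00, XS_eq_mul_transpose, tr3_Uminus_eq, tr3_Uplus_eq, quadForm]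
  simp only [Complex.add_re, Complex.ofReal_re, Complex.re_ofReal_mul, Complex.I_re, mul_zero,
    add_zero, (hR _).sum_zero_zero, (hS _).sum_zero_zero]
  rw [quad_combine]
  simp only [staggeredTransform, Complex.I_mul_im]

lemma eta01_eq_quadForm (h : ResponseSymmetry p q q₁ q₂ m) (w v : ℂ) :
    eta01 p q q₁ (circ (Matrix.diagonal d) m) w v =
      quadForm d (fun m' c => w * colTransform (recD p q) m m' c)
        (fun m' c => -Complex.I * v * colTransform (recR p q₁) m m' c)
        (fun m' c => w * staggeredTransform p q m m' c)
        (fun m' c => -Complex.I * v * staggeredTransform p q₁ m m' c) := by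
  choose t hR using h.exists_recR
  choose s hS using h.exists_stackedS
  rw [eta01, XS_eq_mul_transpose, tr3_Uminus_eq, tr3_Uplus_eq, quadForm]
  simp only [Complex.add_im, Complex.ofReal_im, Complex.im_ofReal_mul, Complex.I_im, mul_one,
    zero_add, (hR _).sum_zero_one, (hS _).sum_zero_one]
  rw [show -2 * w.im * v.im = 2 * -(w.im * v.im) by ring, quad_combine]
  simp only [staggeredTransform, Complex.I_mul_im, Complex.I_mul_re, mul_neg]

lemma eta02_eq_quadForm (h : ResponseSymmetry p q q₁ q₂ m) (w v : ℂ) :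
    eta02 p q q₂ (circ (Matrix.diagonal d) m) w v =
      quadForm d (fun m' c => w * colTransform (recD p q) m m' c)
        (fun m' c => -v * colTransform (recR p q₂) m m' c)
        (fun m' c => w * staggeredTransform p q m m' c)
        (fun m' c => -v * staggeredTransform p q₂ m m' c) := by
  choose t hR using h.exists_recR
  choose s hS using h.exists_stackedS
  rw [eta02, XS_eq_mul_transpose, tr3_Uminus_eq, tr3_Uplus_eq, quadForm]
  simp only [Complex.add_re, Complex.ofReal_re, Complex.re_ofReal_mul, Complex.I_re, mul_zero,
    add_zero, (hR _).sum_zero_two, (hS _).sum_zero_two]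
  rw [show -2 * w.im * v.im = 2 * -(w.im * v.im) by ring, quad_combine]
  simp only [staggeredTransform, Complex.I_mul_im]

lemma eta11_eq_quadForm (h : ResponseSymmetry p q q₁ q₂ m) (v : ℂ) :
    eta11 p q₁ (circ (Matrix.diagonal d) m) v =
      quadForm d (fun m' c => -Complex.I * v * colTransform (recR p q₁) m m' c)
        (fun m' c => -Complex.I * v * colTransform (recR p q₁) m m' c)
        (fun m' c => -Complex.I * v * staggeredTransform p q₁ m m' c)
        (fun m' c => -Complex.I * v * staggeredTransform p q₁ m m' c) := by
  choose t hR using h.exists_recR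
  choose s hS using h.exists_stackedS
  rw [eta11, XS_eq_mul_transpose, tr3_Uminus_eq, tr3_Uplus_eq, tr3_Uminus_eq, tr3_Uplus_eq,
    quadForm]
  simp only [Complex.add_re, Complex.ofReal_re, Complex.re_ofReal_mul, Complex.I_re, mul_zero,
    add_zero, (hR _).sum_one_one, (hS _).sum_one_one]
  rw [quad_combine, quad_combine, ← mul_add, ← Finset.sum_add_distrib]
  congr 1
  refine Finset.sum_congr rfl fun m' _ => ?_
  simp only [staggeredTransform, Complex.I_mul_im, Complex.I_mul_re, neg_mul_neg]
  ring

end Eta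

/-! ### Extension of the analog pulse by zero -/

/-- The `r`-th derivative of the analog pulse, extended by zero to the whole line. -/
def extendedDeriv (κ : ℕ) (Ts : ℝ) (q : ℝ → ℝ) (r : ℕ) : ℝ → ℝ :=
  (pulseDomain κ Ts).indicator (iteratedDerivWithin r q (pulseDomain κ Ts))

section Extension

variable {κ : ℕ} {Ts : ℝ} {q : ℝ → ℝ}

lemma endpoints_lt (hκ : 1 ≤ κ) (hTs : 0 < Ts) : -(κ * Ts / 2) < κ * Ts / 2 := by
  have : (0 : ℝ) < κ := by exact_mod_cast hκ
  have : 0 < κ * Ts := by positivity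
  linarith

lemma uniqueDiffOn_pulseDomain (hκ : 1 ≤ κ) (hTs : 0 < Ts) :
    UniqueDiffOn ℝ (pulseDomain κ Ts) :=
  uniqueDiffOn_Icc (endpoints_lt hκ hTs)

lemma extendedDeriv_eq_zero_of_mem_frontier (hq : IsAnalogPulse κ Ts q) {r : ℕ} (hr : r ≤ 2)
    {x : ℝ} (hx : x = -(κ * Ts / 2) ∨ x = κ * Ts / 2) : extendedDeriv κ Ts q r x = 0 := by
  rw [extendedDeriv, Set.indicator_apply_eq_zero]
  rintro -
  rcases hx with rfl | rfl
  · exact hq.left_zero r hr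
  · exact hq.right_zero r hr

/-- Since the pulse and its derivatives vanish at the end points, the extension is differentiable
there too. -/
lemma hasDerivAt_extendedDeriv (hκ : 1 ≤ κ) (hTs : 0 < Ts) (hq : IsAnalogPulse κ Ts q) {r : ℕ}
    (hr : r < 2) (x : ℝ) :
    HasDerivAt (extendedDeriv κ Ts q r) (extendedDeriv κ Ts q (r + 1) x) x := by
  by_cases hx : x ∈ pulseDomain κ Ts
  · have hD : HasDerivWithinAt (extendedDeriv κ Ts q r) (extendedDeriv κ Ts q (r + 1) x)
        (pulseDomain κ Ts) x := by
      have h1 := (hq.contDiffOn.differentiableOn_iteratedDerivWithin (m := r)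
        (by exact_mod_cast hr) (uniqueDiffOn_pulseDomain hκ hTs) x hx).hasDerivWithinAt
      rw [← iteratedDerivWithin_succ] at h1
      rw [extendedDeriv, extendedDeriv, Set.indicator_of_mem hx]
      exact h1.congr (fun y hy => Set.indicator_of_mem hy _) (Set.indicator_of_mem hx _)
    by_cases hfr : x = -(κ * Ts / 2) ∨ x = κ * Ts / 2
    · have h0 := extendedDeriv_eq_zero_of_mem_frontier hq hr.le hfr
      have h1 := extendedDeriv_eq_zero_of_mem_frontier hq (Nat.succ_le_of_lt hr) hfr
      have hC : HasDerivWithinAt (extendedDeriv κ Ts q r) (extendedDeriv κ Ts q (r + 1) x)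
          (pulseDomain κ Ts)ᶜ x := by
        rw [Nat.succ_eq_add_one] at h1
        rw [h1]
        exact (hasDerivWithinAt_const x _ (0 : ℝ)).congr
          (fun y hy => Set.indicator_of_notMem hy _) h0
      have := hD.union hC
      rwa [Set.union_compl_self, hasDerivWithinAt_univ] at this
    · rw [not_or] at hfr
      exact hD.hasDerivAt (Icc_mem_nhds (lt_of_le_of_ne hx.1 (Ne.symm hfr.1))
        (lt_of_le_of_ne hx.2 hfr.2))
  · have h1 : extendedDeriv κ Ts q (r + 1) x = 0 := Set.indicator_of_notMem hx _
    rw [h1]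
    refine (hasDerivAt_const x (0 : ℝ)).congr_of_eventuallyEq ?_
    filter_upwards [isClosed_Icc.isOpen_compl.mem_nhds hx] with y hy
    exact Set.indicator_of_notMem hy _

lemma continuous_extendedDeriv (hκ : 1 ≤ κ) (hTs : 0 < Ts) (hq : IsAnalogPulse κ Ts q) {r : ℕ}
    (hr : r ≤ 2) : Continuous (extendedDeriv κ Ts q r) := by
  refine continuous_indicator ?_ ?_
  · intro a ha
    rw [pulseDomain, frontier_Icc (endpoints_lt hκ hTs).le] at ha
    have := extendedDeriv_eq_zero_of_mem_frontier hq hr ha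
    rwa [extendedDeriv, Set.indicator_of_mem] at this
    rcases ha with rfl | rfl
    · exact Set.left_mem_Icc.2 (endpoints_lt hκ hTs).le
    · exact Set.right_mem_Icc.2 (endpoints_lt hκ hTs).le
  · rw [pulseDomain, isClosed_Icc.closure_eq]
    exact hq.contDiffOn.continuousOn_iteratedDerivWithin (by exact_mod_cast hr)
      (uniqueDiffOn_pulseDomain hκ hTs)

lemma hasCompactSupport_extendedDeriv (r : ℕ) : HasCompactSupport (extendedDeriv κ Ts q r) :=
  HasCompactSupport.intro (K := pulseDomain κ Ts) isCompact_Icc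
    fun _ hx => Set.indicator_of_notMem hx _

end Extension

/-- Abscissa of the `τ`-th sample of the receive pulse. -/
def samplePoint (κ : ℕ) (Ts : ℝ) (M : ℕ) (τ : ℤ) : ℝ :=
  ((τ : ℝ) + 1 / 2 - M * κ) * (Ts / (2 * M))

lemma tap_sampled {κ : ℕ} {Ts : ℝ} (hTs : 0 < Ts) (q : ℝ → ℝ) (r : ℕ) {M : ℕ} (hM : 0 < M)
    (τ : ℤ) :
    tap (sampled κ Ts q r M) τ = Ts ^ r * extendedDeriv κ Ts q r (samplePoint κ Ts M τ) := by
  have hM' : (0 : ℝ) < M := by exact_mod_cast hM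
  have hstep : 0 < Ts / (2 * M) := by positivity
  have hend : κ * Ts / 2 = (M * κ) * (Ts / (2 * M)) := by field_simp
  by_cases h : 0 ≤ τ ∧ τ.toNat < κ * (2 * M)
  · have h1 : ((τ.toNat : ℕ) : ℝ) = τ := by
      have : ((τ.toNat : ℕ) : ℤ) = τ := Int.toNat_of_nonneg h.1
      exact_mod_cast this
    have h2 : (τ : ℝ) + 1 ≤ κ * (2 * M) := by
      rw [← h1]
      exact_mod_cast h.2
    have h3 : (0 : ℝ) ≤ τ := by exact_mod_cast h.1
    have hmem : samplePoint κ Ts M τ ∈ pulseDomain κ Ts := by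
      rw [pulseDomain, samplePoint, hend, Set.mem_Icc, ← neg_mul]
      constructor <;> refine mul_le_mul_of_nonneg_right ?_ hstep.le <;> linarith
    rw [tap, dif_pos h, sampled, extendedDeriv, Set.indicator_of_mem hmem, samplePoint]
    simp only [h1]
    congr 3
    ring
  · have hmem : samplePoint κ Ts M τ ∉ pulseDomain κ Ts := by
      rw [pulseDomain, samplePoint, hend, Set.mem_Icc, ← neg_mul]
      rintro ⟨ha, hb⟩
      have ha' := le_of_mul_le_mul_right ha hstep
      have hb' := le_of_mul_le_mul_right hb hstep
      have h0 : (0 : ℤ) ≤ τ := by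
        have : (-1 : ℝ) < τ := by linarith
        have : (-1 : ℤ) < τ := by exact_mod_cast this
        omega
      refine h ⟨h0, ?_⟩
      have : (τ : ℝ) < κ * (2 * M) := by linarith
      have : τ < ((κ * (2 * M) : ℕ) : ℤ) := by
        push_cast
        exact_mod_cast this
      omega
    rw [tap, dif_neg h, extendedDeriv, Set.indicator_of_notMem hmem, mul_zero]

/-! ### Parity of the analog pulse -/

/-- The sampling instants become dense as `M` grows, so that the symmetry of all the sampled pulses
makes the analog pulse even. -/
lemma extendedDeriv_zero_neg {κ : ℕ} {Ts : ℝ} {q : ℝ → ℝ} (hκ : 1 ≤ κ) (hTs : 0 < Ts)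
    (hq : IsAnalogPulse κ Ts q) (hsymm : ∀ M, IsSymm (sampled κ Ts q 0 M)) (x : ℝ) :
    extendedDeriv κ Ts q 0 (-x) = extendedDeriv κ Ts q 0 x := by
  set g := extendedDeriv κ Ts q 0
  have hg : Continuous g := continuous_extendedDeriv hκ hTs hq (by norm_num)
  have hsample : ∀ (M : ℕ), 0 < M → ∀ τ, g (-samplePoint κ Ts M τ) = g (samplePoint κ Ts M τ) := by
    intro M hM τ
    have h := tap_reflect (q := sampled κ Ts q 0 M) (s := 1) (fun i => by rw [hsymm M, one_mul]) τ
    rw [one_mul, tap_sampled hTs q 0 hM, tap_sampled hTs q 0 hM, pow_zero, one_mul, one_mul] at h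
    refine Eq.trans ?_ h
    congr 1
    simp only [samplePoint]
    push_cast
    ring
  let τ : ℕ → ℤ := fun M => ⌊x * (2 * M) / Ts⌋ + M * κ
  have hlim : Tendsto (fun M : ℕ => samplePoint κ Ts M (τ M)) atTop (𝓝 x) := by
    have h1 : Tendsto (fun M : ℕ => Ts / (2 * (M : ℝ))) atTop (𝓝 0) := by
      refine Tendsto.const_div_atTop ?_ _
      exact tendsto_natCast_atTop_atTop.const_mul_atTop (by norm_num)
    rw [tendsto_iff_norm_sub_tendsto_zero]
    refine squeeze_zero' (Eventually.of_forall fun _ => norm_nonneg _) ?_ h1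
    filter_upwards [eventually_gt_atTop 0] with M hM
    have hM' : (0 : ℝ) < M := by exact_mod_cast hM
    have hstep : 0 < Ts / (2 * M) := by positivity
    have hx : x = (x * (2 * M) / Ts) * (Ts / (2 * M)) := by field_simp
    have heq : samplePoint κ Ts M (τ M) - x =
        ((⌊x * (2 * M) / Ts⌋ : ℝ) + 1 / 2 - x * (2 * M) / Ts) * (Ts / (2 * M)) := by
      rw [sub_mul _ (x * (2 * M) / Ts), ← hx, samplePoint]
      simp only [τ]
      push_cast
      ring
    rw [heq, norm_mul, Real.norm_eq_abs, Real.norm_eq_abs, abs_of_pos hstep]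
    refine mul_le_of_le_one_left hstep.le ?_
    have h2 := Int.floor_le (x * (2 * M) / Ts)
    have h3 := Int.lt_floor_add_one (x * (2 * M) / Ts)
    rw [abs_le]
    constructor <;> linarith
  refine tendsto_nhds_unique ((hg.tendsto (-x)).comp hlim.neg) ?_
  refine ((hg.tendsto x).comp hlim).congr' ?_
  filter_upwards [eventually_gt_atTop 0] with M hM
  exact (hsample M hM _).symm

lemma deriv_parity {g g' : ℝ → ℝ} (hg : ∀ x, HasDerivAt g (g' x) x) {s : ℝ}
    (hs : ∀ x, g (-x) = s * g x) (x : ℝ) : g' (-x) = -s * g' x := by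
  have h1 := (hg (-x)).comp x (hasDerivAt_neg x)
  have h2 : HasDerivAt (g ∘ Neg.neg) (s * g' x) x :=
    ((hg x).const_mul s).congr_of_eventuallyEq (Eventually.of_forall hs)
  have := h1.unique h2
  linarith

lemma sampled_rev {κ : ℕ} {Ts : ℝ} {q : ℝ → ℝ} (hTs : 0 < Ts) {r : ℕ} {s : ℝ}
    (hs : ∀ x, extendedDeriv κ Ts q r (-x) = s * extendedDeriv κ Ts q r x) {M : ℕ} (hM : 0 < M)
    (i : Fin (κ * (2 * M))) :
    sampled κ Ts q r M i.rev = s * sampled κ Ts q r M i := by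
  rw [← tap_coe (sampled κ Ts q r M), ← tap_coe (sampled κ Ts q r M), tap_sampled hTs q r hM,
    tap_sampled hTs q r hM, mul_left_comm s, ← hs]
  congr 2
  have hi := i.isLt
  have h : ((i.rev : ℕ) : ℤ) = κ * (2 * M) - 1 - (i : ℕ) := by
    rw [Fin.val_rev, Nat.cast_sub (by omega)]
    push_cast
    ring
  rw [h, samplePoint, samplePoint]
  push_cast
  ring

/-! ### Second-order Taylor expansion with a uniform remainder -/

/-- A bounded uniformly continuous function has a bounded modulus of continuity. -/
lemma exists_modulus {g : ℝ → ℝ} (hg : UniformContinuous g) {A : ℝ} (hA : ∀ x, |g x| ≤ A) :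
    ∃ θ : ℝ → ℝ, (∀ s, 0 ≤ θ s ∧ θ s ≤ 2 * A) ∧ Tendsto θ (𝓝 0) (𝓝 0) ∧
      ∀ x y s, |x - y| ≤ s → |g x - g y| ≤ θ s := by
  have hA0 : 0 ≤ A := (abs_nonneg _).trans (hA 0)
  have hdiff : ∀ x y, |g x - g y| ≤ 2 * A := fun x y => by
    have := abs_sub (g x) (g y)
    linarith [hA x, hA y]
  let θ : ℝ → ℝ := fun s => ⨆ z : {z : ℝ × ℝ // |z.1 - z.2| ≤ s}, |g z.1.1 - g z.1.2|
  have hbdd : ∀ s, BddAbove (Set.range fun z : {z : ℝ × ℝ // |z.1 - z.2| ≤ s} =>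
      |g z.1.1 - g z.1.2|) := by
    intro s
    refine ⟨2 * A, ?_⟩
    rintro _ ⟨z, rfl⟩
    exact hdiff _ _
  have hθ0 : ∀ s, 0 ≤ θ s := fun s => Real.iSup_nonneg fun z => abs_nonneg _
  refine ⟨θ, fun s => ⟨hθ0 s, Real.iSup_le (fun z => hdiff _ _) (by positivity)⟩, ?_, ?_⟩
  · rw [Metric.tendsto_nhds]
    intro ε hε
    obtain ⟨η, hη, h⟩ := Metric.uniformContinuous_iff.1 hg (ε / 2) (by positivity)
    filter_upwards [Metric.ball_mem_nhds (0 : ℝ) hη] with s hs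
    rw [Real.dist_eq, sub_zero, abs_of_nonneg (hθ0 s)]
    refine lt_of_le_of_lt (Real.iSup_le (fun z => ?_) (by positivity : 0 ≤ ε / 2)) (by linarith)
    refine (h (a := z.1.1) (b := z.1.2) ?_).le
    rw [Metric.mem_ball, Real.dist_eq, sub_zero] at hs
    rw [Real.dist_eq]
    exact z.2.trans_lt ((le_abs_self s).trans_lt hs)
  · intro x y s hxy
    exact le_ciSup (hbdd s) ⟨(x, y), hxy⟩

lemma abs_taylor_two_le {g₀ g₁ g₂ : ℝ → ℝ} (h₀ : ∀ x, HasDerivAt g₀ (g₁ x) x)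
    (h₁ : ∀ x, HasDerivAt g₁ (g₂ x) x) {θ x δ : ℝ}
    (hθ : ∀ y, |y - x| ≤ |δ| → |g₂ y - g₂ x| ≤ θ) :
    |g₀ (x + δ) - (g₀ x + δ * g₁ x + δ ^ 2 / 2 * g₂ x)| ≤ θ * δ ^ 2 := by
  have hconv : Convex ℝ (Metric.closedBall x |δ|) := convex_closedBall x _
  have hx : x ∈ Metric.closedBall x |δ| := Metric.mem_closedBall_self (abs_nonneg _)
  have hθ0 : 0 ≤ θ := (abs_nonneg _).trans (hθ x (by simp))
  have hball : ∀ y ∈ Metric.closedBall x |δ|, |y - x| ≤ |δ| := fun y hy => by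
    rwa [Metric.mem_closedBall, Real.dist_eq] at hy
  have hR1 : ∀ y ∈ Metric.closedBall x |δ|, ‖g₁ y - g₁ x - (y - x) * g₂ x‖ ≤ θ * |δ| := by
    intro y hy
    have h := hconv.norm_image_sub_le_of_norm_hasDerivWithin_le
      (f := fun y => g₁ y - g₁ x - (y - x) * g₂ x) (f' := fun y => g₂ y - g₂ x) (C := θ)
      (fun z _ => by
        have := (((h₁ z).sub_const (g₁ x)).sub
          (((hasDerivAt_id z).sub_const x).mul_const (g₂ x))).hasDerivWithinAt
          (s := Metric.closedBall x |δ|)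
        refine this.congr_deriv ?_
        simp)
      (fun z hz => hθ z (hball z hz)) hx hy
    simp only [sub_self, zero_mul, sub_zero] at h
    refine h.trans ?_
    exact mul_le_mul_of_nonneg_left (hball y hy) hθ0
  have h := hconv.norm_image_sub_le_of_norm_hasDerivWithin_le
    (f := fun y => g₀ y - g₀ x - (y - x) * g₁ x - (y - x) ^ 2 / 2 * g₂ x)
    (f' := fun y => g₁ y - g₁ x - (y - x) * g₂ x) (C := θ * |δ|)
    (fun z _ => by
      have := ((((h₀ z).sub_const (g₀ x)).sub
        (((hasDerivAt_id z).sub_const x).mul_const (g₁ x))).sub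
        (((((hasDerivAt_id z).sub_const x).pow 2).div_const 2).mul_const (g₂ x))).hasDerivWithinAt
        (s := Metric.closedBall x |δ|)
      refine this.congr_deriv ?_
      simp)
    hR1 hx (y := x + δ) (by simp [Metric.mem_closedBall])
  simp only [sub_self, zero_mul, sub_zero, add_sub_cancel_left, ne_eq, OfNat.ofNat_ne_zero,
    not_false_eq_true, zero_pow, zero_div, Real.norm_eq_abs] at h
  rw [mul_assoc, abs_mul_abs_self, ← sq] at h
  refine le_trans (le_of_eq ?_) h
  congr 1
  ring

/-! ### The channel and its frequency response -/

lemma norm_exp_neg_I_mul (x : ℝ) : ‖Complex.exp (-Complex.I * (x : ℂ))‖ = 1 := by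
  rw [show -Complex.I * (x : ℂ) = ((-x : ℝ) : ℂ) * Complex.I by push_cast; ring]
  exact Complex.norm_exp_ofReal_mul_I _

lemma summable_pow_mul_norm {h : ℤ → ℂ} (hh : Summable fun l : ℤ => (l : ℝ) ^ 2 * ‖h l‖) {r : ℕ}
    (hr : r ≤ 2) : Summable fun l : ℤ => |(l : ℝ)| ^ r * ‖h l‖ := by
  have h0 : Summable fun l : ℤ => if l = 0 then ‖h 0‖ else 0 :=
    summable_of_ne_finset_zero (s := {0}) fun l hl => by
      rw [if_neg (by simpa using hl)]
  refine Summable.of_nonneg_of_le (fun l => by positivity) (fun l => ?_) (hh.add h0)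
  by_cases hl : l = 0
  · subst hl
    rw [if_pos rfl]
    have : |((0 : ℤ) : ℝ)| ^ r ≤ 1 := by
      rw [Int.cast_zero, abs_zero]
      exact pow_le_one₀ le_rfl zero_le_one
    nlinarith [norm_nonneg (h 0)]
  · rw [if_neg hl, add_zero, ← sq_abs]
    have h1 : (1 : ℝ) ≤ |(l : ℝ)| := by
      exact_mod_cast Int.one_le_abs hl
    exact mul_le_mul_of_nonneg_right (pow_le_pow_right₀ h1 hr) (norm_nonneg _)

/-- The `r`-th derivative of the frequency response, as a series. -/
def freqMoment (h : ℤ → ℂ) (r : ℕ) (ω : ℝ) : ℂ :=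
  ∑' l : ℤ, (-Complex.I * (l : ℂ)) ^ r *
    (h l * Complex.exp (-Complex.I * (ω * (l : ℝ) : ℝ)))

lemma norm_freqMoment_term (h : ℤ → ℂ) (r : ℕ) (ω : ℝ) (l : ℤ) :
    ‖(-Complex.I * (l : ℂ)) ^ r * (h l * Complex.exp (-Complex.I * (ω * (l : ℝ) : ℝ)))‖ =
      |(l : ℝ)| ^ r * ‖h l‖ := by
  rw [norm_mul, norm_mul, norm_exp_neg_I_mul, norm_pow, norm_mul]
  simp

lemma summable_freqMoment {h : ℤ → ℂ} (hh : Summable fun l : ℤ => (l : ℝ) ^ 2 * ‖h l‖) {r : ℕ}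
    (hr : r ≤ 2) (ω : ℝ) : Summable fun l : ℤ => (-Complex.I * (l : ℂ)) ^ r *
      (h l * Complex.exp (-Complex.I * (ω * (l : ℝ) : ℝ))) := by
  refine Summable.of_norm ?_
  simp only [norm_freqMoment_term]
  exact summable_pow_mul_norm hh hr

lemma norm_freqMoment_le {h : ℤ → ℂ} (hh : Summable fun l : ℤ => (l : ℝ) ^ 2 * ‖h l‖) {r : ℕ}
    (hr : r ≤ 2) (ω : ℝ) : ‖freqMoment h r ω‖ ≤ ∑' l : ℤ, |(l : ℝ)| ^ r * ‖h l‖ :=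
  tsum_of_norm_bounded (summable_pow_mul_norm hh hr).hasSum
    fun l => (norm_freqMoment_term h r ω l).le

lemma hasDerivAt_freqMoment {h : ℤ → ℂ} (hh : Summable fun l : ℤ => (l : ℝ) ^ 2 * ‖h l‖) {r : ℕ}
    (hr : r < 2) (ω : ℝ) : HasDerivAt (freqMoment h r) (freqMoment h (r + 1) ω) ω := by
  refine hasDerivAt_tsum (summable_pow_mul_norm hh (Nat.succ_le_of_lt hr)) (fun l y => ?_)
    (fun l y => (norm_freqMoment_term h (r + 1) y l).le) (summable_freqMoment hh hr.le ω) ω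
  have h1 : HasDerivAt (fun y : ℝ => -Complex.I * ((y * (l : ℝ) : ℝ) : ℂ))
      (-Complex.I * (l : ℂ)) y := by
    have := (((hasDerivAt_id y).mul_const (l : ℝ)).ofReal_comp).const_mul (-Complex.I)
    simpa using this
  refine ((h1.cexp.const_mul (h l)).const_mul ((-Complex.I * (l : ℂ)) ^ r)).congr_deriv ?_
  ring

lemma freqResp_eq_freqMoment (h : ℤ → ℂ) : freqResp h = freqMoment h 0 := by
  ext ω
  simp [freqResp, freqMoment]

lemma iteratedDeriv_freqResp {h : ℤ → ℂ} (hh : Summable fun l : ℤ => (l : ℝ) ^ 2 * ‖h l‖) {r : ℕ}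
    (hr : r ≤ 2) : iteratedDeriv r (freqResp h) = freqMoment h r := by
  induction r with
  | zero => rw [iteratedDeriv_zero, freqResp_eq_freqMoment]
  | succ r ih =>
    rw [iteratedDeriv_succ, ih (by omega)]
    ext ω
    exact (hasDerivAt_freqMoment hh (by omega) ω).deriv

/-- The receive pulse filtered by the channel, after demodulation at frequency `ω`. -/
def filteredPulse {M κ : ℕ} (h : ℤ → ℂ) (ω : ℝ) (q : Pulse M κ) (τ : ℤ) : ℂ :=
  ∑' l : ℤ, h l * Complex.exp (-Complex.I * (ω * (l : ℝ) : ℝ)) * (tap q (τ - l) : ℂ)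

/-- The second-order approximation of the filtered receive pulse. -/
def filteredPulseApprox (κ : ℕ) (Ts : ℝ) (q : ℝ → ℝ) (h : ℤ → ℂ) (ω : ℝ) (M : ℕ) (τ : ℤ) : ℂ :=
  freqMoment h 0 ω * (tap (sampled κ Ts q 0 M) τ : ℂ) +
    (2 * (M : ℂ))⁻¹ * (-Complex.I * freqMoment h 1 ω * (tap (sampled κ Ts q 1 M) τ : ℂ)) +
    (2 * (M : ℂ))⁻¹ ^ 2 / 2 * (-freqMoment h 2 ω * (tap (sampled κ Ts q 2 M) τ : ℂ))

/-- Over the delays of the channel, the receive pulse is given by its Taylor expansion, with an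
error `o(M⁻²)` that is uniform in time and frequency. -/
lemma exists_filteredPulse_bound {κ : ℕ} {Ts : ℝ} {q : ℝ → ℝ} (hκ : 1 ≤ κ) (hTs : 0 < Ts)
    (hq : IsAnalogPulse κ Ts q) {h : ℤ → ℂ} (hh : Summable fun l : ℤ => (l : ℝ) ^ 2 * ‖h l‖) :
    ∃ ε : ℕ → ℝ, (∀ M, 0 ≤ ε M) ∧ Tendsto (fun M : ℕ => (M : ℝ) ^ 2 * ε M) atTop (𝓝 0) ∧
      ∀ M : ℕ, 0 < M → ∀ (ω : ℝ) (τ : ℤ),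
        ‖filteredPulse h ω (sampled κ Ts q 0 M) τ - filteredPulseApprox κ Ts q h ω M τ‖ ≤ ε M := by
  have hcont : Continuous (extendedDeriv κ Ts q 2) := continuous_extendedDeriv hκ hTs hq le_rfl
  have hsupp : HasCompactSupport (extendedDeriv κ Ts q 2) := hasCompactSupport_extendedDeriv 2
  obtain ⟨A, hA⟩ := hsupp.exists_bound_of_continuous hcont
  obtain ⟨θ, hθ, hθ0, hmod⟩ := exists_modulus (hsupp.uniformContinuous_of_continuous hcont) hA
  have hsum : Summable fun l : ℤ => 2 * A * (Ts / 2) ^ 2 * ((l : ℝ) ^ 2 * ‖h l‖) :=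
    hh.mul_left _
  have hbound : ∀ (M : ℕ) (l : ℤ),
      θ (|(l : ℝ)| * Ts / (2 * M)) * (Ts / 2) ^ 2 * ((l : ℝ) ^ 2 * ‖h l‖) ≤
        2 * A * (Ts / 2) ^ 2 * ((l : ℝ) ^ 2 * ‖h l‖) := by
    intro M l
    have := (hθ (|(l : ℝ)| * Ts / (2 * M))).2
    gcongr
  have hnonneg : ∀ (M : ℕ) (l : ℤ),
      0 ≤ θ (|(l : ℝ)| * Ts / (2 * M)) * (Ts / 2) ^ 2 * ((l : ℝ) ^ 2 * ‖h l‖) := by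
    intro M l
    have := (hθ (|(l : ℝ)| * Ts / (2 * M))).1
    positivity
  have hsumM : ∀ M : ℕ, Summable fun l : ℤ =>
      θ (|(l : ℝ)| * Ts / (2 * M)) * (Ts / 2) ^ 2 * ((l : ℝ) ^ 2 * ‖h l‖) := fun M =>
    Summable.of_nonneg_of_le (hnonneg M) (hbound M) hsum
  refine ⟨fun M => ((M : ℝ) ^ 2)⁻¹ * ∑' l : ℤ,
    θ (|(l : ℝ)| * Ts / (2 * M)) * (Ts / 2) ^ 2 * ((l : ℝ) ^ 2 * ‖h l‖),
    fun M => mul_nonneg (by positivity) (tsum_nonneg (hnonneg M)), ?_, ?_⟩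
  · have hlim := tendsto_tsum_of_dominated_convergence (𝓕 := atTop)
      (f := fun (M : ℕ) (l : ℤ) =>
        θ (|(l : ℝ)| * Ts / (2 * M)) * (Ts / 2) ^ 2 * ((l : ℝ) ^ 2 * ‖h l‖))
      (g := fun _ => 0) hsum (fun l => ?_)
      (Eventually.of_forall fun M l => by
        rw [Real.norm_eq_abs, abs_of_nonneg (hnonneg M l)]
        exact hbound M l)
    · rw [tsum_zero] at hlim
      refine hlim.congr' ?_
      filter_upwards [eventually_gt_atTop 0] with M hM
      have hM' : (M : ℝ) ≠ 0 := by exact_mod_cast hM.ne'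
      rw [mul_inv_cancel_left₀ (pow_ne_zero 2 hM')]
    · have h1 : Tendsto (fun M : ℕ => |(l : ℝ)| * Ts / (2 * (M : ℝ))) atTop (𝓝 0) :=
        Tendsto.const_div_atTop
          (tendsto_natCast_atTop_atTop.const_mul_atTop (by norm_num)) _
      have h2 := ((hθ0.comp h1).mul_const ((Ts / 2) ^ 2)).mul_const ((l : ℝ) ^ 2 * ‖h l‖)
      simpa only [zero_mul, Function.comp_def] using h2
  · intro M hM ω τ
    have hM' : (0 : ℝ) < M := by exact_mod_cast hM
    -- the Taylor remainder at delay `l`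
    let R : ℤ → ℝ := fun l => tap (sampled κ Ts q 0 M) (τ - l) -
      (tap (sampled κ Ts q 0 M) τ - l / (2 * M) * tap (sampled κ Ts q 1 M) τ +
        l ^ 2 / (8 * M ^ 2) * tap (sampled κ Ts q 2 M) τ)
    have hR : ∀ l, |R l| ≤ ((M : ℝ) ^ 2)⁻¹ *
        (θ (|(l : ℝ)| * Ts / (2 * M)) * (Ts / 2) ^ 2 * (l : ℝ) ^ 2) := by
      intro l
      have hδ : |-(l * Ts / (2 * (M : ℝ)))| = |(l : ℝ)| * Ts / (2 * M) := by
        rw [abs_neg, abs_div, abs_mul, abs_of_pos hTs, abs_of_pos (by positivity : (0 : ℝ) < 2 * M)]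
      have h1 := abs_taylor_two_le (x := samplePoint κ Ts M τ) (δ := -(l * Ts / (2 * (M : ℝ))))
        (θ := θ (|(l : ℝ)| * Ts / (2 * M)))
        (hasDerivAt_extendedDeriv hκ hTs hq (r := 0) (by norm_num))
        (hasDerivAt_extendedDeriv hκ hTs hq (r := 1) (by norm_num))
        (fun y hy => hmod _ _ _ (hy.trans_eq hδ))
      have h2 : samplePoint κ Ts M (τ - l) =
          samplePoint κ Ts M τ + -(l * Ts / (2 * (M : ℝ))) := by
        simp only [samplePoint]
        push_cast
        field_simp
        ring
      have h3 : R l = extendedDeriv κ Ts q 0 (samplePoint κ Ts M τ + -(l * Ts / (2 * (M : ℝ)))) -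
          (extendedDeriv κ Ts q 0 (samplePoint κ Ts M τ) +
            -(l * Ts / (2 * (M : ℝ))) * extendedDeriv κ Ts q (0 + 1) (samplePoint κ Ts M τ) +
            (-(l * Ts / (2 * (M : ℝ)))) ^ 2 / 2 *
              extendedDeriv κ Ts q (1 + 1) (samplePoint κ Ts M τ)) := by
        simp only [R]
        rw [tap_sampled hTs q 0 hM, tap_sampled hTs q 0 hM, tap_sampled hTs q 1 hM,
          tap_sampled hTs q 2 hM, h2]
        field_simp
        ring
      rw [h3]
      refine h1.trans_eq ?_
      field_simp
    have hS0 := (summable_freqMoment hh (r := 0) (by norm_num) ω).hasSum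
    have hS1 := (summable_freqMoment hh (r := 1) (by norm_num) ω).hasSum
    have hS2 := (summable_freqMoment hh (r := 2) le_rfl ω).hasSum
    have hmain := ((hS0.mul_right (tap (sampled κ Ts q 0 M) τ : ℂ)).add
      (hS1.mul_left ((2 * (M : ℂ))⁻¹ * (-Complex.I * (tap (sampled κ Ts q 1 M) τ : ℂ))))).add
      (hS2.mul_left ((2 * (M : ℂ))⁻¹ ^ 2 / 2 * (-(tap (sampled κ Ts q 2 M) τ : ℂ))))
    have herr : ∀ l : ℤ, ‖h l * Complex.exp (-Complex.I * (ω * (l : ℝ) : ℝ)) * (R l : ℂ)‖ ≤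
        ((M : ℝ) ^ 2)⁻¹ *
          (θ (|(l : ℝ)| * Ts / (2 * M)) * (Ts / 2) ^ 2 * ((l : ℝ) ^ 2 * ‖h l‖)) := by
      intro l
      rw [norm_mul, norm_mul, norm_exp_neg_I_mul, mul_one, Complex.norm_real, Real.norm_eq_abs]
      refine (mul_le_mul_of_nonneg_left (hR l) (norm_nonneg _)).trans_eq ?_
      ring
    have hsumerr : Summable fun l : ℤ =>
        h l * Complex.exp (-Complex.I * (ω * (l : ℝ) : ℝ)) * (R l : ℂ) :=
      Summable.of_norm_bounded ((hsumM M).mul_left _) herr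
    have htotal := hmain.add hsumerr.hasSum
    have heq : filteredPulse h ω (sampled κ Ts q 0 M) τ - filteredPulseApprox κ Ts q h ω M τ =
        ∑' l : ℤ, h l * Complex.exp (-Complex.I * (ω * (l : ℝ) : ℝ)) * (R l : ℂ) := by
      rw [sub_eq_iff_eq_add', filteredPulse]
      refine (tsum_congr fun l => ?_).trans (htotal.tsum_eq.trans ?_)
      · simp only [R]
        push_cast
        linear_combination (-(h l * Complex.exp (-Complex.I * (ω * (l : ℂ)))) *
          ((2 * (M : ℂ))⁻¹ * l * (tap (sampled κ Ts q 1 M) τ : ℂ) -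
            (2 * (M : ℂ))⁻¹ ^ 2 / 2 * l ^ 2 * (tap (sampled κ Ts q 2 M) τ : ℂ))) * Complex.I_mul_I
      · simp only [filteredPulseApprox, freqMoment]
        ring
    rw [heq]
    exact tsum_of_norm_bounded ((hsumM M).hasSum.mul_left _) herr

/-! ### The filterbank output as a linear function of the symbols -/

lemma exists_eq_of_tap_ne_zero {M κ : ℕ} {p : Pulse M κ} {t : ℤ} (h : tap p t ≠ 0) :
    ∃ i : Fin (κ * (2 * M)), ((i : ℕ) : ℤ) = t := by
  rw [tap] at h
  split_ifs at h with ht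
  · exact ⟨⟨t.toNat, ht.2⟩, by simp [ht.1]⟩
  · exact absurd rfl h

lemma tsum_tap_mul {M κ : ℕ} (p : Pulse M κ) (o : ℤ) (f : ℤ → ℂ) :
    ∑' t : ℤ, (tap p (t - o) : ℂ) * f t = ∑ i : Fin (κ * (2 * M)), (p i : ℂ) * f ((i : ℕ) + o) := by
  have hinj : Function.Injective fun i : Fin (κ * (2 * M)) => ((i : ℕ) : ℤ) + o := by
    intro i j hij
    ext
    simpa using hij
  rw [← hinj.tsum_eq, tsum_fintype]
  · simp [tap_coe]
  · intro t ht
    have h1 : tap p (t - o) ≠ 0 := by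
      intro h0
      simp [h0] at ht
    obtain ⟨i, hi⟩ := exists_eq_of_tap_ne_zero h1
    exact ⟨i, by simp only; omega⟩

lemma sum_tap_mul {M κ : ℕ} (p : Pulse M κ) (o : ℤ) (f : ℤ → ℂ) (F : Finset ℤ)
    (hF : ∀ i : Fin (κ * (2 * M)), ((i : ℕ) : ℤ) + o ∈ F) :
    ∑ t ∈ F, (tap p (t - o) : ℂ) * f t = ∑ i : Fin (κ * (2 * M)), (p i : ℂ) * f ((i : ℕ) + o) := by
  rw [← tsum_tap_mul, tsum_eq_sum]
  intro t ht
  have h0 : tap p (t - o) = 0 := by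
    by_contra h1
    obtain ⟨i, hi⟩ := exists_eq_of_tap_ne_zero h1
    exact ht (by have := hF i; rwa [hi, sub_add_cancel] at this)
  rw [h0, Complex.ofReal_zero, zero_mul]

lemma analysisOdd_channelOut {M κ : ℕ} (q : Pulse M κ) (h : ℤ → ℂ) (s : ℤ → ℂ) (F : Finset ℤ)
    (hs : ∀ t, t ∉ F → s t = 0) (m : Fin (2 * M)) (c : ℤ) :
    analysisOdd q (channelOut h s) m c = 2 * ((Real.sqrt (2 * M) : ℝ) : ℂ)⁻¹ *
      ∑ t ∈ F, s t * (conj (carrier M m t) *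
        filteredPulse h (centralFreq M m) q (2 * M * (c + 1) - 1 - t)) := by
  have hch : ∀ t, channelOut h s t = ∑ v ∈ F, h (t - v) * s v := by
    intro t
    rw [channelOut, ← (Equiv.subLeft t).tsum_eq, tsum_eq_sum (s := F)]
    · simp
    · intro v hv
      simp [hs v hv]
  have hfp : ∀ τ, filteredPulse h (centralFreq M m) q τ = ∑ u : Fin (κ * (2 * M)), (q u : ℂ) *
      (h (τ - (u : ℕ)) *
        Complex.exp (-Complex.I * (centralFreq M m * ((τ - (u : ℕ) : ℤ) : ℝ) : ℝ))) := by
    intro τ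
    have := tsum_tap_mul q 0 (fun u => h (τ - u) *
      Complex.exp (-Complex.I * (centralFreq M m * ((τ - u : ℤ) : ℝ) : ℝ)))
    simp only [sub_zero, add_zero] at this
    rw [← this, filteredPulse, ← (Equiv.subLeft τ).tsum_eq]
    refine tsum_congr fun u => ?_
    simp only [Equiv.subLeft_apply, sub_sub_cancel]
    ring
  rw [analysisOdd]
  congr 1
  simp only [hch, hfp, Finset.mul_sum]
  rw [Finset.sum_comm]
  refine Finset.sum_congr rfl fun t _ => Finset.sum_congr rfl fun u _ => ?_
  have hcar := carrier_add_channel_delay m t (2 * M * (c + 1) - 1 - t - (u : ℕ))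
  rw [show t + (2 * M * (c + 1) - 1 - t - (u : ℕ)) = 2 * M * (c + 1) - 1 - (u : ℕ) by ring] at hcar
  rw [hcar, show (2 * M * (c + 1) - 1 - (u : ℕ) - t : ℤ) = 2 * M * (c + 1) - 1 - t - (u : ℕ) by ring]
  ring

/-- The contribution to the output at subcarrier `m`, read at time `T` by the receive sequence `X`,
of a unit symbol sent at time `o` on subcarrier `m'`. -/
def symbolResponse {M κ : ℕ} (p : Pulse M κ) (X : ℤ → ℂ) (T : ℤ) (m m' : Fin (2 * M)) (o : ℤ) : ℂ :=
  (M : ℂ)⁻¹ * ∑ i : Fin (κ * (2 * M)), (p i : ℂ) *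
    (carrier M m' (i : ℕ) * conj (carrier M m ((i : ℕ) + o)) * X (T - o - (i : ℕ)))

/-- The instant at which the receive filter of the `n`-th symbol is read. -/
def readTime (M κ : ℕ) {Ns : ℕ} (n : Fin Ns) : ℤ := 2 * M * ((n : ℕ) + κ) - 1

lemma zOdd_eq_sum {M κ Ns : ℕ} (p q : Pulse M κ) (h : ℤ → ℂ) (W : Fin (2 * M) → ℂ)
    (b c : Fin (2 * M) → Fin Ns → ℝ) (m : Fin (2 * M)) (n : Fin Ns) :
    zOdd p q h W b c m n = ∑ m', ∑ n' : Fin Ns,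
      ((b m' n' : ℂ) * (W m * symbolResponse p (filteredPulse h (centralFreq M m) q)
          (readTime M κ n) m m' (2 * M * (n' : ℕ))) +
       (c m' n' : ℂ) * (W m * (Complex.I * symbolResponse p
          (filteredPulse h (centralFreq M m) q) (readTime M κ n) m m'
          (2 * M * (n' : ℕ) + M)))) := by
  have hM := pos_of_subcarrier m
  let F : Finset ℤ := Finset.Ico 0 (2 * M * (Ns + κ))
  have hF : ∀ (n' : Fin Ns) (i : Fin (κ * (2 * M))) (e : ℤ), 0 ≤ e → e ≤ M →
      ((i : ℕ) : ℤ) + (2 * M * (n' : ℕ) + e) ∈ F := by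
    intro n' i e he he'
    have h1 : ((i : ℕ) : ℤ) < κ * (2 * M) := by exact_mod_cast i.isLt
    have h2 : ((n' : ℕ) : ℤ) + 1 ≤ Ns := by exact_mod_cast n'.isLt
    rw [Finset.mem_Ico]
    constructor
    · positivity
    · have hM' : (0 : ℤ) < M := by exact_mod_cast hM
      nlinarith
  have hs : ∀ t, t ∉ F → txSignal p b c t = 0 := by
    intro t ht
    have hz : ∀ (n' : Fin Ns) (e : ℤ), 0 ≤ e → e ≤ M →
        tap p (t - 2 * M * (n' : ℕ) - e) = 0 := by
      intro n' e he he'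
      by_contra h1
      obtain ⟨i, hi⟩ := exists_eq_of_tap_ne_zero h1
      refine ht ?_
      have := hF n' i e he he'
      rwa [hi, show t - 2 * M * (n' : ℕ) - e + (2 * M * (n' : ℕ) + e) = t by ring] at this
    rw [txSignal, Finset.sum_eq_zero, mul_zero]
    intro m' _
    refine Finset.sum_eq_zero fun n' _ => ?_
    have h0 := hz n' 0 le_rfl (by positivity)
    rw [sub_zero] at h0
    rw [h0, hz n' M (by positivity) le_rfl]
    simp
  set r : ℂ := ((Real.sqrt (2 * M) : ℝ) : ℂ)⁻¹ with hr
  set X := filteredPulse h (centralFreq M m) q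
  have hT : 2 * (M : ℤ) * ((n : ℕ) + κ - 1 + 1) - 1 = readTime M κ n := by
    rw [readTime]
    ring
  rw [zOdd, analysisOdd_channelOut q h _ F hs, hT]
  have hresp : ∀ (m' : Fin (2 * M)) (n' : Fin Ns) (e : ℤ), 0 ≤ e → e ≤ M →
      ∑ t ∈ F, (tap p (t - (2 * M * (n' : ℕ) + e)) : ℂ) *
        (carrier M m' (t - (2 * M * (n' : ℕ) + e)) * conj (carrier M m t) *
          X (readTime M κ n - t)) =
      M * symbolResponse p X (readTime M κ n) m m' (2 * M * (n' : ℕ) + e) := by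
    intro m' n' e he he'
    have hMC : (M : ℂ) ≠ 0 := by exact_mod_cast hM.ne'
    rw [sum_tap_mul p _ _ F (fun i => hF n' i e he he'), symbolResponse, mul_inv_cancel_left₀ hMC]
    refine Finset.sum_congr rfl fun i _ => ?_
    rw [add_sub_cancel_right, sub_sub (readTime M κ n), add_comm (2 * (M : ℤ) * (n' : ℕ) + e)]
  have hterm : ∀ (m' : Fin (2 * M)) (n' : Fin Ns),
      (b m' n' : ℂ) * (W m * symbolResponse p X (readTime M κ n) m m' (2 * M * (n' : ℕ))) +
       (c m' n' : ℂ) * (W m * (Complex.I * symbolResponse p X (readTime M κ n) m m'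
          (2 * M * (n' : ℕ) + M))) =
      W m * (2 * r * ∑ t ∈ F, r * ((b m' n' : ℂ) * (tap p (t - 2 * M * (n' : ℕ)) : ℂ) *
        carrier M m' (t - 2 * M * (n' : ℕ)) +
      Complex.I * (c m' n' : ℂ) * (tap p (t - 2 * M * (n' : ℕ) - M) : ℂ) *
        carrier M m' (t - 2 * M * (n' : ℕ) - M)) *
          (conj (carrier M m t) * X (readTime M κ n - t))) := by
    intro m' n'
    have hMC : (M : ℂ) ≠ 0 := by exact_mod_cast hM.ne'
    have h0 := hresp m' n' 0 le_rfl (by positivity)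
    have h1 := hresp m' n' M (by positivity) le_rfl
    simp only [add_zero] at h0
    have hsplit : ∑ t ∈ F, r * ((b m' n' : ℂ) * (tap p (t - 2 * M * (n' : ℕ)) : ℂ) *
        carrier M m' (t - 2 * M * (n' : ℕ)) +
      Complex.I * (c m' n' : ℂ) * (tap p (t - 2 * M * (n' : ℕ) - M) : ℂ) *
        carrier M m' (t - 2 * M * (n' : ℕ) - M)) *
          (conj (carrier M m t) * X (readTime M κ n - t)) =
        r * (b m' n' : ℂ) * (M * symbolResponse p X (readTime M κ n) m m' (2 * M * (n' : ℕ))) +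
        r * (Complex.I * (c m' n' : ℂ)) * (M * symbolResponse p X (readTime M κ n) m m'
          (2 * M * (n' : ℕ) + M)) := by
      rw [← h0, ← h1, Finset.mul_sum, Finset.mul_sum, ← Finset.sum_add_distrib]
      refine Finset.sum_congr rfl fun t _ => ?_
      rw [← sub_sub]
      ring
    rw [hsplit]
    have : 2 * (r * r) * M = 1 := by
      rw [hr, inv_sqrt_mul_inv_sqrt]
      field_simp
    linear_combination (-W m * (b m' n' * symbolResponse p X (readTime M κ n) m m'
      (2 * M * (n' : ℕ)) + Complex.I * c m' n' * symbolResponse p X (readTime M κ n) m m'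
          (2 * M * (n' : ℕ) + M))) * this
  simp only [hterm, txSignal, ← hr, Finset.mul_sum, Finset.sum_mul]
  rw [Finset.sum_comm]
  refine Finset.sum_congr rfl fun m' _ => ?_
  rw [Finset.sum_comm]

/-! ### Responses to the symbols -/

/-- The taps of a receive pulse as a complex sequence. -/
def tapSeq {M κ : ℕ} (q : Pulse M κ) (τ : ℤ) : ℂ := (tap q τ : ℂ)

lemma symbolResponse_filteredPulse {M κ : ℕ} (p : Pulse M κ) (Ts : ℝ) (q : ℝ → ℝ) (h : ℤ → ℂ)
    (ω : ℝ) (T : ℤ) (m m' : Fin (2 * M)) (o : ℤ) :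
    symbolResponse p (filteredPulse h ω (sampled κ Ts q 0 M)) T m m' o =
      freqMoment h 0 ω * symbolResponse p (tapSeq (sampled κ Ts q 0 M)) T m m' o +
      (2 * (M : ℂ))⁻¹ * (-Complex.I * freqMoment h 1 ω *
        symbolResponse p (tapSeq (sampled κ Ts q 1 M)) T m m' o) +
      (2 * (M : ℂ))⁻¹ ^ 2 / 2 * (-freqMoment h 2 ω *
        symbolResponse p (tapSeq (sampled κ Ts q 2 M)) T m m' o) +
      symbolResponse p (fun τ => filteredPulse h ω (sampled κ Ts q 0 M) τ -
        filteredPulseApprox κ Ts q h ω M τ) T m m' o := by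
  simp only [symbolResponse, Finset.mul_sum, ← Finset.sum_add_distrib]
  refine Finset.sum_congr rfl fun i _ => ?_
  simp only [filteredPulseApprox, tapSeq]
  ring

lemma sum_norm_sq_symbolResponse_le {M κ : ℕ} {p : Pulse M κ} {X : ℤ → ℂ} {A Y : ℝ}
    (hp : ∀ i, |p i| ≤ A) (hX : ∀ τ, ‖X τ‖ ≤ Y) (T : ℤ) (m : Fin (2 * M)) (o : ℤ) :
    ∑ m', ‖symbolResponse p X T m m' o‖ ^ 2 ≤ (2 * κ * (A * Y)) ^ 2 := by
  have hM := pos_of_subcarrier m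
  have hM' : (M : ℝ) ≠ 0 := by exact_mod_cast hM.ne'
  have h1 := sum_norm_sq_demod_le hM.ne'
    (fun i : Fin (κ * (2 * M)) => (p i : ℂ) * (conj (carrier M m ((i : ℕ) + o)) *
      X (T - o - (i : ℕ)))) (A * Y) (fun i => by
        rw [norm_mul, norm_mul, RCLike.norm_conj, norm_carrier, one_mul, Complex.norm_real]
        exact mul_le_mul (hp i) (hX _) (norm_nonneg _) ((abs_nonneg _).trans (hp i)))
  have h2 : ∀ m', ‖symbolResponse p X T m m' o‖ ^ 2 = ((M : ℝ)⁻¹) ^ 2 *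
      ‖∑ i : Fin (κ * (2 * M)), (p i : ℂ) * (conj (carrier M m ((i : ℕ) + o)) *
        X (T - o - (i : ℕ))) * carrier M m' (i : ℕ)‖ ^ 2 := by
    intro m'
    rw [symbolResponse, norm_mul, mul_pow, norm_inv, Complex.norm_natCast]
    congr 4
    ext i
    ring
  simp only [h2]
  rw [← Finset.mul_sum]
  refine (mul_le_mul_of_nonneg_left h1 (by positivity)).trans_eq ?_
  field_simp

/-- Response to the real part of a symbol, when the receive filter is read `c + 1 - κ` symbol
periods after the instant matched to that symbol. -/
def realColumn {M κ : ℕ} (p q : Pulse M κ) (m m' : Fin (2 * M)) (c : ℤ) : ℂ :=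
  ∑ ν, relPhase m m' ν * (foldedProduct p q ν (2 * M * (c + 1) - 1) : ℂ)

/-- Response to the imaginary part of a symbol, staggered by half a symbol period. -/
def imagColumn {M κ : ℕ} (p q : Pulse M κ) (m m' : Fin (2 * M)) (c : ℤ) : ℂ :=
  ∑ μ, relPhase m m' (swapHalves μ) * (foldedProduct p q μ (2 * M * (c + 1) - M - 1) : ℂ)

lemma foldedProduct_eq_zero {M κ : ℕ} (p q : Pulse M κ) (μ : Fin (2 * M)) {T : ℤ}
    (hT : T < 0 ∨ 4 * M * κ - 1 ≤ T) : foldedProduct p q μ T = 0 := by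
  rw [foldedProduct, Finset.sum_eq_zero]
  intro a _
  have hμ : ((μ : ℕ) : ℤ) + 1 ≤ 2 * M := by exact_mod_cast μ.isLt
  have ha : ((a : ℕ) : ℤ) + 1 ≤ κ := by exact_mod_cast a.isLt
  rcases hT with hT | hT
  · rw [tap_of_neg, mul_zero]
    have : (0 : ℤ) ≤ 2 * M * (a : ℕ) := by positivity
    omega
  · rw [tap_of_le, mul_zero]
    have : (M : ℤ) * ((a : ℕ) + 1) ≤ M * κ := mul_le_mul_of_nonneg_left ha (by positivity)
    linarith

lemma realColumn_coe {M κ : ℕ} (p q : Pulse M κ) (m m' : Fin (2 * M)) (c : Fin (2 * κ - 1)) :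
    realColumn p q m m' ((c : ℕ) : ℤ) = colTransform (recR p q) m m' c := by
  rw [realColumn, colTransform]
  refine Finset.sum_congr rfl fun ν _ => ?_
  rw [recR_apply, mul_comm]

lemma imagColumn_coe {M κ : ℕ} (p q : Pulse M κ) (m m' : Fin (2 * M))
    (c : Fin (2 * κ - 1 + 1)) :
    imagColumn p q m m' ((c : ℕ) : ℤ) = colTransform (stackedS p q) m m' c := by
  rw [imagColumn, colTransform]
  refine Eq.trans ?_ (Equiv.sum_comp swapHalves _)
  refine Finset.sum_congr rfl fun ν _ => ?_
  rw [stackedS_apply, mul_comm]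

lemma realColumn_eq_zero {M κ : ℕ} (hκ : 1 ≤ κ) (p q : Pulse M κ) (m m' : Fin (2 * M)) {c : ℤ}
    (hc : c < 0 ∨ ((2 * κ - 1 : ℕ) : ℤ) ≤ c) : realColumn p q m m' c = 0 := by
  have hM : (0 : ℤ) < M := by exact_mod_cast pos_of_subcarrier m
  rw [realColumn, Finset.sum_eq_zero]
  intro ν _
  rw [foldedProduct_eq_zero, Complex.ofReal_zero, mul_zero]
  rcases hc with hc | hc
  · left
    nlinarith
  · right
    have : 2 * (κ : ℤ) - 1 ≤ c := by omega
    nlinarith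

lemma imagColumn_eq_zero {M κ : ℕ} (hκ : 1 ≤ κ) (p q : Pulse M κ) (m m' : Fin (2 * M)) {c : ℤ}
    (hc : c < 0 ∨ ((2 * κ - 1 + 1 : ℕ) : ℤ) ≤ c) : imagColumn p q m m' c = 0 := by
  have hM : (0 : ℤ) < M := by exact_mod_cast pos_of_subcarrier m
  rw [imagColumn, Finset.sum_eq_zero]
  intro ν _
  rw [foldedProduct_eq_zero, Complex.ofReal_zero, mul_zero]
  rcases hc with hc | hc
  · left
    nlinarith
  · right
    have : 2 * (κ : ℤ) ≤ c := by omega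
    nlinarith

/-- The column in which the `n'`-th symbol appears when the `n`-th one is read. -/
def columnOf (κ : ℕ) {Ns : ℕ} (n n' : Fin Ns) : ℤ := (n : ℕ) - (n' : ℕ) + κ - 1

lemma symbolResponse_tapSeq {M κ Ns : ℕ} (p q : Pulse M κ) (n n' : Fin Ns) (m m' : Fin (2 * M)) :
    symbolResponse p (tapSeq q) (readTime M κ n) m m' (2 * M * (n' : ℕ)) =
      (M : ℂ)⁻¹ * realColumn p q m m' (columnOf κ n n') := by
  rw [symbolResponse, sum_fin_fold, realColumn]
  congr 1
  refine Finset.sum_congr rfl fun ν _ => ?_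
  rw [foldedProduct, Complex.ofReal_sum, Finset.mul_sum]
  refine Finset.sum_congr rfl fun a _ => ?_
  rw [polyphase_apply, ← coe_finProdFinEquiv, tap_coe, carrier_add_period, coe_finProdFinEquiv,
    carrier_add_period, carrier_add_period, relPhase, tapSeq, Complex.ofReal_mul]
  rw [show readTime M κ n - 2 * M * (n' : ℕ) - ((ν : ℕ) + 2 * M * (a : ℕ)) =
    2 * M * (columnOf κ n n' + 1) - 1 - (ν : ℕ) - 2 * M * (a : ℕ) by
      rw [readTime, columnOf]; ring]
  ring

lemma carrier_swapHalves {M : ℕ} (m μ : Fin (2 * M)) :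
    carrier M m (swapHalves μ : Fin (2 * M)) = carrier M m ((μ : ℕ) + (M : ℤ)) := by
  rcases topIdx_or_botIdx μ with ⟨i, rfl⟩ | ⟨i, rfl⟩
  · rw [swapHalves_topIdx, coe_topIdx, coe_botIdx]
    congr 1
    push_cast
    ring
  · rw [swapHalves_botIdx, coe_topIdx, coe_botIdx, ← carrier_add_period m _ 1]
    congr 1
    push_cast
    ring

lemma symbolResponse_tapSeq_staggered {M κ Ns : ℕ} (p q : Pulse M κ) (n n' : Fin Ns)
    (m m' : Fin (2 * M)) :
    symbolResponse p (tapSeq q) (readTime M κ n) m m' (2 * M * (n' : ℕ) + M) =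
      (-1) ^ (m' : ℕ) * ((M : ℂ)⁻¹ * imagColumn p q m m' (columnOf κ n n')) := by
  rw [symbolResponse, sum_fin_fold, imagColumn, mul_left_comm ((-1 : ℂ) ^ (m' : ℕ))]
  congr 1
  rw [Finset.mul_sum]
  refine Finset.sum_congr rfl fun ν _ => ?_
  rw [foldedProduct, Complex.ofReal_sum, Finset.mul_sum, Finset.mul_sum]
  refine Finset.sum_congr rfl fun a _ => ?_
  have hsign : ((-1 : ℂ) ^ (m' : ℕ)) * (-1) ^ (m' : ℕ) = 1 := by rw [← mul_pow]; simp
  rw [polyphase_apply, ← coe_finProdFinEquiv, tap_coe, coe_finProdFinEquiv, carrier_add_period,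
    show ((ν : ℕ) : ℤ) + 2 * M * (a : ℕ) + (2 * M * (n' : ℕ) + M) =
      (ν : ℕ) + M + 2 * M * ((a : ℕ) + (n' : ℕ)) by ring, carrier_add_period, relPhase,
    carrier_swapHalves, carrier_swapHalves, carrier_add_half m', tapSeq, Complex.ofReal_mul,
    show readTime M κ n - (2 * M * (n' : ℕ) + M) - ((ν : ℕ) + 2 * M * (a : ℕ)) =
    2 * M * (columnOf κ n n' + 1) - M - 1 - (ν : ℕ) - 2 * M * (a : ℕ) by
      rw [readTime, columnOf]; ring]
  linear_combination (-(p (finProdFinEquiv (a, ν)) : ℂ) * (carrier M m' (ν : ℕ) *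
    conj (carrier M m ((ν : ℕ) + (M : ℤ))) *
    (tap q (2 * M * (columnOf κ n n' + 1) - M - 1 - (ν : ℕ) - 2 * M * (a : ℕ)) : ℂ))) * hsign

/-- Away from the edges of the block, the symbols that interfere with the `n`-th one run through all
the columns where the response does not vanish. -/
lemma sum_columnOf {κ Ns L : ℕ} (f : ℤ → ℝ) (hf : ∀ c : ℤ, c < 0 ∨ (L : ℤ) ≤ c → f c = 0)
    (n : Fin Ns) (hL : L ≤ (n : ℕ) + κ) (hn : (n : ℕ) + κ ≤ Ns) :
    ∑ n' : Fin Ns, f (columnOf κ n n') = ∑ c : Fin L, f ((c : ℕ) : ℤ) := by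
  rw [Fin.sum_univ_eq_sum_range (fun c => f (c : ℤ)) L]
  have h1 : ∑ n' : Fin Ns, f (columnOf κ n n') =
      ∑ j ∈ Finset.range Ns, f (((n : ℕ) : ℤ) - (j : ℕ) + κ - 1) :=
    Fin.sum_univ_eq_sum_range (fun j => f (((n : ℕ) : ℤ) - (j : ℕ) + κ - 1)) Ns
  rw [h1, ← Finset.sum_subset (Finset.range_subset_range.2 hn) (fun j _ hj => hf _ (Or.inl (by
    rw [Finset.mem_range] at hj
    omega)))]
  rw [← Finset.sum_range_reflect, Finset.sum_subset (Finset.range_subset_range.2 hL)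
    (f := fun c : ℕ => f c) (fun c _ hc => hf _ (Or.inr (by
    rw [Finset.mem_range] at hc
    omega)))]
  refine Finset.sum_congr rfl fun j hj => ?_
  rw [Finset.mem_range] at hj
  congr 1
  omega

/-- The response to the symbol of interest itself supplies the central column of ones. -/
lemma realColumn_sub_eq {M κ : ℕ} (p q : Pulse M κ) (m m' : Fin (2 * M)) (c : Fin (2 * κ - 1)) :
    (M : ℂ)⁻¹ * realColumn p q m m' ((c : ℕ) : ℤ) -
      (if m' = m ∧ ((c : ℕ) : ℤ) = κ - 1 then 1 else 0) =
      (M : ℂ)⁻¹ * colTransform (recD p q) m m' c := by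
  have hM : (M : ℂ) ≠ 0 := by exact_mod_cast (pos_of_subcarrier m).ne'
  have h1 : colTransform (recD p q) m m' c = colTransform (recR p q) m m' c -
      (if (c : ℕ) + 1 = κ then 1 / 2 else 0) * ∑ ν, relPhase m m' ν := by
    rw [colTransform, colTransform, Finset.mul_sum, ← Finset.sum_sub_distrib]
    refine Finset.sum_congr rfl fun ν _ => ?_
    simp only [recD, centralOnes, Matrix.sub_apply, Matrix.smul_apply, Matrix.of_apply,
      smul_eq_mul]
    split_ifs <;> push_cast <;> ring
  rw [realColumn_coe, h1, sum_relPhase]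
  by_cases hm : m' = m
  · by_cases hc : (c : ℕ) + 1 = κ
    · have hc' : ((c : ℕ) : ℤ) = κ - 1 := by omega
      rw [if_pos ⟨hm, hc'⟩, if_pos hc, if_pos hm]
      field_simp
    · have hc' : ¬((c : ℕ) : ℤ) = κ - 1 := by omega
      rw [if_neg (fun h => hc' h.2), if_neg hc, zero_mul, sub_zero, sub_zero]
  · rw [if_neg (fun h => hm h.1), if_neg hm, mul_zero, sub_zero, sub_zero]

/-! ### Second moments of the symbols -/

section SecondMoments

variable {Ω : Type*} [MeasurableSpace Ω] {μ : Measure Ω}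

/-- Pythagoras for centred, pairwise independent variables. -/
lemma integral_sq_sum_of_indep {ι : Type*} [Fintype ι] {X : ι → Ω → ℝ}
    (hX : ∀ i, MemLp (X i) 2 μ) (h0 : ∀ i, ∫ x, X i x ∂μ = 0)
    (hind : ∀ i j, i ≠ j → IndepFun (X i) (X j) μ) (r : ι → ℝ) :
    ∫ x, (∑ i, X i x * r i) ^ 2 ∂μ = ∑ i, (∫ x, X i x ^ 2 ∂μ) * r i ^ 2 := by
  classical
  have hint : ∀ i j, Integrable (fun x => X i x * X j x) μ := fun i j =>
    (hX i).integrable_mul (hX j)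
  have hexp : ∀ x, (∑ i, X i x * r i) ^ 2 = ∑ i, ∑ j, X i x * X j x * (r i * r j) := by
    intro x
    rw [sq, Finset.sum_mul_sum]
    exact Finset.sum_congr rfl fun i _ => Finset.sum_congr rfl fun j _ => by ring
  simp only [hexp]
  rw [integral_finsetSum _ fun i _ => integrable_finsetSum _ fun j _ => (hint i j).mul_const _]
  refine Finset.sum_congr rfl fun i _ => ?_
  rw [integral_finsetSum _ fun j _ => (hint i j).mul_const _, Finset.sum_eq_single i]
  · rw [integral_mul_const, sq (r i)]
    simp only [sq]
  · intro j _ hj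
    rw [integral_mul_const]
    have := (hind i j hj.symm).integral_fun_mul_eq_mul_integral (hX i).aestronglyMeasurable
      (hX j).aestronglyMeasurable
    rw [this, h0, zero_mul, zero_mul]
  · simp

variable {M K Ns : ℕ} {owner : Fin (2 * M) → Fin K}
  {B C : Fin K → Fin (2 * M) → Fin Ns → Ω → ℝ} {σ2 : Fin K → Fin (2 * M) → ℝ}

lemma IsSymbolModel.secondMoment_eq (h : IsSymbolModel μ owner B C σ2) (k : Fin K) (n : Fin Ns) :
    secondMoment μ (B k) n = Matrix.diagonal (σ2 k) := by
  ext i j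
  rw [secondMoment, Matrix.of_apply]
  by_cases hij : i = j
  · subst hij
    rw [Matrix.diagonal_apply_eq, ← h.var_B k i n]
    simp only [sq]
  · rw [Matrix.diagonal_apply_ne _ hij]
    have hind := h.indep.indepFun (i := Sum.inl (k, i, n)) (j := Sum.inl (k, j, n))
      (by simp [hij])
    have := hind.integral_fun_mul_eq_mul_integral (h.memLp_B k i n).aestronglyMeasurable
      (h.memLp_B k j n).aestronglyMeasurable
    simp only [Sum.elim_inl] at this
    rw [this, h.mean_B, zero_mul]

lemma IsSymbolModel.variance_nonneg (h : IsSymbolModel μ owner B C σ2) (k : Fin K)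
    (m : Fin (2 * M)) (n : Fin Ns) : 0 ≤ σ2 k m := by
  rw [← h.var_B k m n]
  exact integral_nonneg fun x => sq_nonneg _

/-- Output power for weights `a` of the real parts and `b` of the imaginary parts of the symbols of
one user. -/
lemma IsSymbolModel.integral_sq_eq (h : IsSymbolModel μ owner B C σ2) (k : Fin K)
    (a b : Fin (2 * M) → Fin Ns → ℝ) :
    ∫ x, (∑ m', ∑ n', (B k m' n' x * a m' n' + C k m' n' x * b m' n')) ^ 2 ∂μ =
      ∑ m', σ2 k m' * ∑ n', (a m' n' ^ 2 + b m' n' ^ 2) := by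
  let e : (Fin (2 * M) × Fin Ns) ⊕ (Fin (2 * M) × Fin Ns) →
      (Fin K × Fin (2 * M) × Fin Ns) ⊕ (Fin K × Fin (2 * M) × Fin Ns) :=
    Sum.map (fun i => (k, i)) (fun i => (k, i))
  have he : Function.Injective e :=
    Function.Injective.sumMap (Prod.mk_right_injective k) (Prod.mk_right_injective k)
  let X : (Fin (2 * M) × Fin Ns) ⊕ (Fin (2 * M) × Fin Ns) → Ω → ℝ := fun i =>
    Sum.elim (fun i : Fin K × Fin (2 * M) × Fin Ns => B i.1 i.2.1 i.2.2)
      (fun i : Fin K × Fin (2 * M) × Fin Ns => C i.1 i.2.1 i.2.2) (e i)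
  have := integral_sq_sum_of_indep (μ := μ) (X := X)
    (by rintro (i | i); exacts [h.memLp_B k _ _, h.memLp_C k _ _])
    (by rintro (i | i); exacts [h.mean_B k _ _, h.mean_C k _ _])
    (fun i j hij => h.indep.indepFun (he.ne hij))
    (Sum.elim (fun i => a i.1 i.2) (fun i => b i.1 i.2))
  simp only [Fintype.sum_sum_type, Fintype.sum_prod_type, X, e, Sum.elim_inl, Sum.elim_inr,
    Sum.map_inl, Sum.map_inr, h.var_B, h.var_C] at this
  simp only [Finset.sum_add_distrib]
  rw [this]
  simp only [mul_add, Finset.mul_sum, Finset.sum_add_distrib]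

end SecondMoments

/-! ### Perturbation of a quadratic form -/

lemma abs_sum_mul_mul_le {ι : Type*} [Fintype ι] {σ x y : ι → ℝ} {A X Y : ℝ} (hσ : ∀ i, 0 ≤ σ i)
    (hA : ∀ i, σ i ≤ A) (hA0 : 0 ≤ A) (hX : 0 ≤ X) (hY : 0 ≤ Y) (hx : ∑ i, x i ^ 2 ≤ X ^ 2)
    (hy : ∑ i, y i ^ 2 ≤ Y ^ 2) : |∑ i, σ i * (x i * y i)| ≤ A * (X * Y) := by
  have h1 : |∑ i, σ i * (x i * y i)| ≤ A * ∑ i, |x i| * |y i| := by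
    rw [Finset.mul_sum]
    refine (Finset.abs_sum_le_sum_abs _ _).trans (Finset.sum_le_sum fun i _ => ?_)
    rw [abs_mul, abs_mul, abs_of_nonneg (hσ i)]
    exact mul_le_mul_of_nonneg_right (hA i) (by positivity)
  refine h1.trans (mul_le_mul_of_nonneg_left ?_ hA0)
  have h2 := Finset.sum_mul_sq_le_sq_mul_sq Finset.univ (fun i => |x i|) (fun i => |y i|)
  simp only [sq_abs] at h2
  refine le_of_sq_le_sq ?_ (by positivity)
  rw [mul_pow]
  refine h2.trans (mul_le_mul hx hy (Finset.sum_nonneg fun i _ => sq_nonneg _) (sq_nonneg _))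

/-- In the square of a second-order expansion, all but the terms up to `t²` is bounded by `t³` and by the
size `ε` of the remainder `e`. -/
lemma abs_quadratic_expansion_le {ι : Type*} [Fintype ι] {σ a₀ a₁ a₂ e : ι → ℝ} {A D ε t : ℝ}
    (hσ : ∀ i, 0 ≤ σ i) (hA : ∀ i, σ i ≤ A) (hA0 : 0 ≤ A) (hD : 0 ≤ D) (hε : 0 ≤ ε) (ht : 0 ≤ t)
    (ht1 : t ≤ 1) (h₀ : ∑ i, a₀ i ^ 2 ≤ D ^ 2) (h₁ : ∑ i, a₁ i ^ 2 ≤ D ^ 2)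
    (h₂ : ∑ i, a₂ i ^ 2 ≤ D ^ 2) (he : ∑ i, e i ^ 2 ≤ ε ^ 2) :
    |∑ i, σ i * (a₀ i + t * a₁ i + t ^ 2 / 2 * a₂ i + e i) ^ 2 -
      (∑ i, σ i * (a₀ i * a₀ i) + 2 * t * ∑ i, σ i * (a₀ i * a₁ i) +
        t ^ 2 * ∑ i, σ i * (a₀ i * a₂ i) + t ^ 2 * ∑ i, σ i * (a₁ i * a₁ i))| ≤
      A * (2 * D ^ 2 * t ^ 3 + 5 * D * ε + ε ^ 2) := by
  have hexp : ∑ i, σ i * (a₀ i + t * a₁ i + t ^ 2 / 2 * a₂ i + e i) ^ 2 -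
      (∑ i, σ i * (a₀ i * a₀ i) + 2 * t * ∑ i, σ i * (a₀ i * a₁ i) +
        t ^ 2 * ∑ i, σ i * (a₀ i * a₂ i) + t ^ 2 * ∑ i, σ i * (a₁ i * a₁ i)) =
      t ^ 3 * ∑ i, σ i * (a₁ i * a₂ i) + t ^ 4 / 4 * ∑ i, σ i * (a₂ i * a₂ i) +
        2 * ∑ i, σ i * (a₀ i * e i) + 2 * t * ∑ i, σ i * (a₁ i * e i) +
        t ^ 2 * ∑ i, σ i * (a₂ i * e i) + ∑ i, σ i * (e i * e i) := by
    simp only [Finset.mul_sum, ← Finset.sum_add_distrib, ← Finset.sum_sub_distrib]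
    exact Finset.sum_congr rfl fun i _ => by ring
  have b12 := abs_le.1 (abs_sum_mul_mul_le hσ hA hA0 hD hD h₁ h₂)
  have b22 := abs_le.1 (abs_sum_mul_mul_le hσ hA hA0 hD hD h₂ h₂)
  have b0 := abs_le.1 (abs_sum_mul_mul_le hσ hA hA0 hD hε h₀ he)
  have b1 := abs_le.1 (abs_sum_mul_mul_le hσ hA hA0 hD hε h₁ he)
  have b2 := abs_le.1 (abs_sum_mul_mul_le hσ hA hA0 hD hε h₂ he)
  have be := abs_le.1 (abs_sum_mul_mul_le hσ hA hA0 hε hε he he)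
  have hmul : ∀ {s S Z u : ℝ}, 0 ≤ s → s ≤ u → 0 ≤ Z → -Z ≤ S ∧ S ≤ Z →
      |s * S| ≤ u * Z := by
    intro s S Z u hs hu hZ hS
    rw [abs_mul, abs_of_nonneg hs]
    exact mul_le_mul hu (abs_le.2 hS) (abs_nonneg _) (hs.trans hu)
  have t2 : t ^ 2 ≤ 1 := pow_le_one₀ ht ht1
  have t4 : t ^ 4 ≤ t ^ 3 := pow_le_pow_of_le_one ht ht1 (by norm_num)
  have c1 := abs_le.1 (hmul (pow_nonneg ht 3) le_rfl (by positivity) b12)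
  have c2 := abs_le.1 (hmul (s := t ^ 4 / 4) (u := t ^ 3) (by positivity)
    (by have := pow_nonneg ht 4; linarith) (by positivity) b22)
  have c3 := abs_le.1 (hmul (s := 2) (by norm_num) le_rfl (by positivity) b0)
  have c4 := abs_le.1 (hmul (s := 2 * t) (u := 2) (by positivity) (by linarith) (by positivity) b1)
  have c5 := abs_le.1 (hmul (s := t ^ 2) (by positivity) t2 (by positivity) b2)
  have hbound : A * (2 * D ^ 2 * t ^ 3 + 5 * D * ε + ε ^ 2) =
      t ^ 3 * (A * (D * D)) + t ^ 3 * (A * (D * D)) + 2 * (A * (D * ε)) + 2 * (A * (D * ε)) +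
        1 * (A * (D * ε)) + A * (ε * ε) := by ring
  rw [hexp, hbound, abs_le]
  constructor <;> linarith [c1.1, c1.2, c2.1, c2.2, c3.1, c3.2, c4.1, c4.2, c5.1, c5.2, be.1, be.2]

/-! ### The distortion at a fixed number of subcarriers -/

/-- The sum over the symbols of products of two responses is the sum over the columns; a common sign
`s` of the responses drops out. -/
lemma sum_mul_columnOf {M κ Ns L : ℕ} {F G : ℤ → ℂ} {f g : Fin L → ℂ} {s : ℝ} (hs : s * s = 1)
    (hF : ∀ c : Fin L, F ((c : ℕ) : ℤ) = s * ((M : ℂ)⁻¹ * f c))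
    (hG : ∀ c : Fin L, G ((c : ℕ) : ℤ) = s * ((M : ℂ)⁻¹ * g c))
    (hF0 : ∀ c : ℤ, c < 0 ∨ (L : ℤ) ≤ c → F c = 0) (w v : ℂ) (n : Fin Ns)
    (hL : L ≤ (n : ℕ) + κ) (hn : (n : ℕ) + κ ≤ Ns) :
    ∑ n' : Fin Ns, (w * F (columnOf κ n n')).re * (v * G (columnOf κ n n')).re =
      ((M : ℝ) ^ 2)⁻¹ * ∑ c, (w * f c).re * (v * g c).re := by
  rw [sum_columnOf (fun c => (w * F c).re * (v * G c).re)
    (fun c hc => by simp only [hF0 c hc, mul_zero, Complex.zero_re, zero_mul]) n hL hn,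
    Finset.mul_sum]
  refine Finset.sum_congr rfl fun c _ => ?_
  have h : ∀ w f : ℂ, (w * (s * ((M : ℂ)⁻¹ * f))).re = s * (M : ℝ)⁻¹ * (w * f).re := by
    intro w f
    rw [← Complex.re_ofReal_mul]
    congr 1
    push_cast
    ring
  rw [hF, hG, h, h]
  linear_combination (((M : ℝ) ^ 2)⁻¹ * (w * f c).re * (v * g c).re) * hs

lemma sum_sq_symbolResponse_le {M κ Ns : ℕ} {p : Pulse M κ} {X : ℤ → ℂ} {A Y : ℝ}
    (hp : ∀ i, |p i| ≤ A) (hX : ∀ τ, ‖X τ‖ ≤ Y) (T : ℤ) (m : Fin (2 * M)) (w : ℂ) :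
    ∑ m', ∑ n' : Fin Ns, ((w * symbolResponse p X T m m' (2 * M * (n' : ℕ))).re ^ 2 +
      (w * (Complex.I * symbolResponse p X T m m' (2 * M * (n' : ℕ) + M))).re ^ 2) ≤
      2 * Ns * (‖w‖ * (2 * κ * (A * Y))) ^ 2 := by
  have hre : ∀ z : ℂ, z.re ^ 2 ≤ ‖z‖ ^ 2 := fun z => by
    rw [← sq_abs]
    exact pow_le_pow_left₀ (abs_nonneg _) (Complex.abs_re_le_norm z) 2
  have h1 : ∀ (o : ℤ), ∑ m', ‖w * symbolResponse p X T m m' o‖ ^ 2 ≤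
      (‖w‖ * (2 * κ * (A * Y))) ^ 2 := by
    intro o
    simp only [norm_mul, mul_pow ‖w‖]
    rw [← Finset.mul_sum]
    exact mul_le_mul_of_nonneg_left (sum_norm_sq_symbolResponse_le hp hX T m o) (sq_nonneg _)
  rw [Finset.sum_comm]
  refine (Finset.sum_le_sum (g := fun _ => 2 * (‖w‖ * (2 * κ * (A * Y))) ^ 2)
    fun n' _ => ?_).trans_eq ?_
  · rw [Finset.sum_add_distrib, two_mul ((‖w‖ * (2 * κ * (A * Y))) ^ 2)]
    refine add_le_add ((Finset.sum_le_sum fun m' _ => hre _).trans (h1 _))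
      ((Finset.sum_le_sum fun m' _ => ?_).trans (h1 (2 * M * (n' : ℕ) + M)))
    refine (hre _).trans_eq ?_
    rw [norm_mul, norm_mul, norm_mul, Complex.norm_I, one_mul]
  · simp
    ring

section FixedSize

variable {Ω : Type*} [MeasurableSpace Ω] {μ : Measure Ω} {M κ K Ns : ℕ}

/-- The weights with which the symbols enter the error of the output at subcarrier `m`. -/
lemma distortion_eq_sum {owner : Fin (2 * M) → Fin K} {B C : Fin K → Fin (2 * M) → Fin Ns → Ω → ℝ}
    {σ2 : Fin K → Fin (2 * M) → ℝ} (hmodel : IsSymbolModel μ owner B C σ2) (p q : Pulse M κ)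
    (h : ℤ → ℂ) (W : Fin (2 * M) → ℂ) (k : Fin K) (m : Fin (2 * M)) (n : Fin Ns) :
    distortion μ p q h W (B k) (C k) m n = 2 * ∑ m', σ2 k m' * ∑ n' : Fin Ns,
      ((W m * symbolResponse p (filteredPulse h (centralFreq M m) q) (readTime M κ n) m m'
          (2 * M * (n' : ℕ)) -
          (if m' = m ∧ n' = n then W m * freqMoment h 0 (centralFreq M m) else 0)).re ^ 2 +
        (W m * (Complex.I * symbolResponse p (filteredPulse h (centralFreq M m) q)
          (readTime M κ n) m m' (2 * M * (n' : ℕ) + M))).re ^ 2) := by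
  rw [distortion, ← hmodel.integral_sq_eq]
  congr 2
  ext x
  rw [sq_abs, zOdd_eq_sum, freqResp_eq_freqMoment]
  congr 1
  have hδ : W m * freqMoment h 0 (centralFreq M m) * (B k m n x : ℂ) = ∑ m', ∑ n' : Fin Ns,
      (B k m' n' x : ℂ) *
        (if m' = m ∧ n' = n then W m * freqMoment h 0 (centralFreq M m) else 0) := by
    simp only [ite_and, mul_ite, mul_zero, Finset.sum_ite_eq', Finset.sum_ite_irrel,
      Finset.mem_univ, if_true, Finset.sum_const_zero]
    ring
  rw [hδ, ← Finset.sum_sub_distrib]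
  simp only [← Finset.sum_sub_distrib, Complex.re_sum]
  refine Finset.sum_congr rfl fun m' _ => Finset.sum_congr rfl fun n' _ => ?_
  rw [← Complex.re_ofReal_mul, ← Complex.re_ofReal_mul, ← Complex.add_re]
  congr 1
  ring

/-- The deviation between distortion and formula, in terms of the bound `ε` on the Taylor remainder
of the filtered receive pulse. -/
lemma abs_distortion_sub_le (hκ : 1 ≤ κ) {Ts : ℝ} {p : Pulse M κ} {q : ℝ → ℝ}
    (hPR : IsPR p (sampled κ Ts q 0 M)) (hp : IsSymm p) (hq : IsSymm (sampled κ Ts q 0 M))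
    (hq₁ : ∀ i, sampled κ Ts q 1 M i.rev = -1 * sampled κ Ts q 1 M i)
    (hq₂ : IsSymm (sampled κ Ts q 2 M))
    {h : ℤ → ℂ} (hh : Summable fun l : ℤ => (l : ℝ) ^ 2 * ‖h l‖)
    {W : Fin (2 * M) → ℂ} {owner : Fin (2 * M) → Fin K}
    {B C : Fin K → Fin (2 * M) → Fin Ns → Ω → ℝ} {σ2 : Fin K → Fin (2 * M) → ℝ}
    (hmodel : IsSymbolModel μ owner B C σ2)
    {P Y A H S ε : ℝ} (hP : ∀ i, |p i| ≤ P)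
    (hY : ∀ r ≤ 2, ∀ τ, |tap (sampled κ Ts q r M) τ| ≤ Y) (hA : ∀ m, ‖W m‖ ≤ A)
    (hH : ∀ r ≤ 2, ∀ ω, ‖freqMoment h r ω‖ ≤ H) (hS : ∀ k m, σ2 k m ≤ S)
    (hε : ∀ ω τ, ‖filteredPulse h ω (sampled κ Ts q 0 M) τ -
      filteredPulseApprox κ Ts q h ω M τ‖ ≤ ε)
    (k : Fin K) (m : Fin (2 * M)) (n : Fin Ns) (hn : κ ≤ (n : ℕ)) (hn' : (n : ℕ) + κ ≤ Ns) :
    |distortion μ p (sampled κ Ts q 0 M) h W (B k) (C k) m n -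
        predictedDistortion μ Ts p q h W (B k) m n| ≤
      2 * (S * (2 * (2 * (Ns + 1) * (A * H * (2 * κ * (P * Y) + 1))) ^ 2 * (2 * (M : ℝ))⁻¹ ^ 3 +
        5 * (2 * (Ns + 1) * (A * H * (2 * κ * (P * Y) + 1))) *
          (2 * (Ns + 1) * (A * (2 * κ * (P * ε)))) +
        (2 * (Ns + 1) * (A * (2 * κ * (P * ε)))) ^ 2)) := by
  have hM := pos_of_subcarrier m
  have hM1 : (1 : ℝ) ≤ M := by exact_mod_cast hM
  have hA0 : 0 ≤ A := (norm_nonneg _).trans (hA m)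
  have hH0 : 0 ≤ H := (norm_nonneg _).trans (hH 0 (by norm_num) 0)
  have hY0 : 0 ≤ Y := (abs_nonneg _).trans (hY 0 (by norm_num) 0)
  have hε0 : 0 ≤ ε := (norm_nonneg _).trans (hε 0 0)
  have hS0 : 0 ≤ S := (hmodel.variance_nonneg k m n).trans (hS k m)
  have hP0 : 0 ≤ P := (abs_nonneg _).trans (hP ⟨0, by positivity⟩)
  set ω := centralFreq M m
  set w₀ := W m * freqMoment h 0 ω with hw₀
  set w₁ := W m * freqMoment h 1 ω with hw₁
  set w₂ := W m * freqMoment h 2 ω with hw₂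
  have hw : ∀ r ≤ 2, ‖W m * freqMoment h r ω‖ ≤ A * H := fun r hr => by
    rw [norm_mul]
    exact mul_le_mul (hA m) (hH r hr ω) (norm_nonneg _) hA0
  let R : (ℤ → ℂ) → Fin (2 * M) × Fin Ns → ℂ := fun X i =>
    symbolResponse p X (readTime M κ n) m i.1 (2 * M * (i.2 : ℕ))
  let V : (ℤ → ℂ) → Fin (2 * M) × Fin Ns → ℂ := fun X i =>
    Complex.I * symbolResponse p X (readTime M κ n) m i.1 (2 * M * (i.2 : ℕ) + M)
  let X : ℕ → ℤ → ℂ := fun r => tapSeq (sampled κ Ts q r M)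
  let Xe : ℤ → ℂ := fun τ => filteredPulse h ω (sampled κ Ts q 0 M) τ -
    filteredPulseApprox κ Ts q h ω M τ
  let δ : Fin (2 * M) × Fin Ns → ℂ := fun i => if i.1 = m ∧ i.2 = n then 1 else 0
  let ι := (Fin (2 * M) × Fin Ns) ⊕ (Fin (2 * M) × Fin Ns)
  let σ : ι → ℝ := Sum.elim (fun i => σ2 k i.1) (fun i => σ2 k i.1)
  let a₀ : ι → ℝ := Sum.elim (fun i => (w₀ * (R (X 0) i - δ i)).re) (fun i => (w₀ * V (X 0) i).re)
  let a₁ : ι → ℝ := Sum.elim (fun i => (-Complex.I * w₁ * R (X 1) i).re)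
    (fun i => (-Complex.I * w₁ * V (X 1) i).re)
  let a₂ : ι → ℝ := Sum.elim (fun i => (-w₂ * R (X 2) i).re) (fun i => (-w₂ * V (X 2) i).re)
  let e : ι → ℝ := Sum.elim (fun i => (W m * R Xe i).re) (fun i => (W m * V Xe i).re)
  set t : ℝ := (2 * (M : ℝ))⁻¹ with ht
  have ht0 : 0 ≤ t := by positivity
  have ht1 : t ≤ 1 := inv_le_one_of_one_le₀ (by linarith)
  have hresp := responseSymmetry hκ hPR hp hq hq₁ hq₂ m
  -- the exact distortion
  have hdist : distortion μ p (sampled κ Ts q 0 M) h W (B k) (C k) m n =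
      2 * ∑ i, σ i * (a₀ i + t * a₁ i + t ^ 2 / 2 * a₂ i + e i) ^ 2 := by
    have hre : ∀ z₀ z₁ z₂ z₃ : ℂ, (z₀ + (t : ℂ) * z₁ + ((t ^ 2 / 2 : ℝ) : ℂ) * z₂ + z₃).re =
        z₀.re + t * z₁.re + t ^ 2 / 2 * z₂.re + z₃.re := fun z₀ z₁ z₂ z₃ => by
      rw [Complex.add_re, Complex.add_re, Complex.add_re, Complex.re_ofReal_mul,
        Complex.re_ofReal_mul]
    have htC : (t : ℂ) = (2 * (M : ℂ))⁻¹ := by rw [ht]; push_cast; rfl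
    rw [distortion_eq_sum hmodel, Fintype.sum_sum_type, Fintype.sum_prod_type,
      Fintype.sum_prod_type, ← Finset.sum_add_distrib]
    congr 1
    refine Finset.sum_congr rfl fun m' _ => ?_
    rw [Finset.mul_sum, ← Finset.sum_add_distrib]
    refine Finset.sum_congr rfl fun n' _ => ?_
    simp only [σ, a₀, a₁, a₂, e, Sum.elim_inl, Sum.elim_inr]
    rw [← hre, ← hre, mul_add, symbolResponse_filteredPulse, symbolResponse_filteredPulse]
    congr 4
    · simp only [R, X, Xe, δ, ω, w₀, w₁, w₂, Complex.ofReal_div, Complex.ofReal_pow, htC]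
      split_ifs <;> push_cast <;> ring
    · simp only [V, X, Xe, ω, w₀, w₁, w₂, Complex.ofReal_div, Complex.ofReal_pow, htC]
      push_cast
      ring
  -- the four terms of the formula
  have hform : predictedDistortion μ Ts p q h W (B k) m n =
      2 * (∑ i, σ i * (a₀ i * a₀ i) + 2 * t * ∑ i, σ i * (a₀ i * a₁ i) +
        t ^ 2 * ∑ i, σ i * (a₀ i * a₂ i) + t ^ 2 * ∑ i, σ i * (a₁ i * a₁ i)) := by
    let FR : ℕ → Fin (2 * M) → ℤ → ℂ := fun r m' c =>
      (M : ℂ)⁻¹ * realColumn p (sampled κ Ts q r M) m m' c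
    let FD : Fin (2 * M) → ℤ → ℂ := fun m' c => FR 0 m' c - if m' = m ∧ c = κ - 1 then 1 else 0
    let FV : ℕ → Fin (2 * M) → ℤ → ℂ := fun r m' c => (((-1) ^ (m' : ℕ) : ℝ) : ℂ) *
      ((M : ℂ)⁻¹ * (Complex.I * imagColumn p (sampled κ Ts q r M) m m' c))
    have hFR : ∀ r i, R (X r) i = FR r i.1 (columnOf κ n i.2) := fun r i =>
      symbolResponse_tapSeq p _ n i.2 m i.1
    have hFD : ∀ i, R (X 0) i - δ i = FD i.1 (columnOf κ n i.2) := fun i => by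
      simp only [hFR, FD, δ]
      congr 1
      refine if_congr (and_congr_right fun _ => ?_) rfl rfl
      rw [columnOf, Fin.ext_iff]
      omega
    have hFV : ∀ r i, V (X r) i = FV r i.1 (columnOf κ n i.2) := fun r i => by
      simp only [V, X, FV, symbolResponse_tapSeq_staggered]
      push_cast
      ring
    -- the columns beyond the windows vanish
    have hFR0 : ∀ r m' c, c < 0 ∨ ((2 * κ - 1 : ℕ) : ℤ) ≤ c → FR r m' c = 0 := fun r m' c hc => by
      simp only [FR, realColumn_eq_zero hκ p _ m m' hc, mul_zero]
    have hFD0 : ∀ m' c, c < 0 ∨ ((2 * κ - 1 : ℕ) : ℤ) ≤ c → FD m' c = 0 := fun m' c hc => by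
      simp only [FD, hFR0 0 m' c hc]
      rw [if_neg (by omega), sub_zero]
    have hFV0 : ∀ r m' c, c < 0 ∨ ((2 * κ - 1 + 1 : ℕ) : ℤ) ≤ c → FV r m' c = 0 :=
      fun r m' c hc => by
        simp only [FV, imagColumn_eq_zero hκ p _ m m' hc, mul_zero]
    have hFRc : ∀ r m' (c : Fin (2 * κ - 1)), FR r m' ((c : ℕ) : ℤ) =
        ((1 : ℝ) : ℂ) * ((M : ℂ)⁻¹ * colTransform (recR p (sampled κ Ts q r M)) m m' c) :=
      fun r m' c => by simp only [FR, realColumn_coe, Complex.ofReal_one, one_mul]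
    have hFDc : ∀ m' (c : Fin (2 * κ - 1)), FD m' ((c : ℕ) : ℤ) =
        ((1 : ℝ) : ℂ) * ((M : ℂ)⁻¹ * colTransform (recD p (sampled κ Ts q 0 M)) m m' c) :=
      fun m' c => by rw [Complex.ofReal_one, one_mul, ← realColumn_sub_eq]
    have hFVc : ∀ r m' (c : Fin (2 * κ - 1 + 1)), FV r m' ((c : ℕ) : ℤ) =
        (((-1) ^ (m' : ℕ) : ℝ) : ℂ) *
          ((M : ℂ)⁻¹ * staggeredTransform p (sampled κ Ts q r M) m m' c) :=
      fun r m' c => by simp only [FV, imagColumn_coe, staggeredTransform]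
    have hsgn : ∀ m' : Fin (2 * M), ((-1 : ℝ) ^ (m' : ℕ)) * (-1) ^ (m' : ℕ) = 1 := fun m' => by
      rw [← mul_pow]
      simp
    -- a sum over the symbols is a sum over the columns
    have hquad : ∀ (w v : ℂ) (F₁ F₂ : Fin (2 * M) → ℤ → ℂ)
        (f₁ f₂ : Fin (2 * M) → Fin (2 * κ - 1) → ℂ) (r s : ℕ),
        (∀ m' c, c < 0 ∨ ((2 * κ - 1 : ℕ) : ℤ) ≤ c → F₁ m' c = 0) →
        (∀ m' (c : Fin (2 * κ - 1)), F₁ m' ((c : ℕ) : ℤ) =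
          ((1 : ℝ) : ℂ) * ((M : ℂ)⁻¹ * f₁ m' c)) →
        (∀ m' (c : Fin (2 * κ - 1)), F₂ m' ((c : ℕ) : ℤ) =
          ((1 : ℝ) : ℂ) * ((M : ℂ)⁻¹ * f₂ m' c)) →
        quadForm (σ2 k) (fun m' c => w * f₁ m' c) (fun m' c => v * f₂ m' c)
          (fun m' c => w * staggeredTransform p (sampled κ Ts q r M) m m' c)
          (fun m' c => v * staggeredTransform p (sampled κ Ts q s M) m m' c) =
        ∑ i : Fin (2 * M) × Fin Ns, σ2 k i.1 * ((w * F₁ i.1 (columnOf κ n i.2)).re *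
          (v * F₂ i.1 (columnOf κ n i.2)).re) +
        ∑ i : Fin (2 * M) × Fin Ns, σ2 k i.1 * ((w * FV r i.1 (columnOf κ n i.2)).re *
          (v * FV s i.1 (columnOf κ n i.2)).re) := by
      intro w v F₁ F₂ f₁ f₂ r s h0 h1 h2
      rw [quadForm, Fintype.sum_prod_type, Fintype.sum_prod_type, ← Finset.sum_add_distrib,
        Finset.mul_sum]
      refine Finset.sum_congr rfl fun m' _ => ?_
      simp only [← Finset.mul_sum]
      rw [sum_mul_columnOf (mul_one 1) (h1 m') (h2 m') (h0 m') w v n (by omega) hn',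
        sum_mul_columnOf (hsgn m') (hFVc r m') (hFVc s m') (hFV0 r m') w v n (by omega) hn']
      ring
    rw [predictedDistortion, distortionFormula, hmodel.secondMoment_eq,
      iteratedDeriv_freqResp hh (by norm_num), iteratedDeriv_freqResp hh le_rfl,
      freqResp_eq_freqMoment, eta00_eq_quadForm _ _ hresp, eta01_eq_quadForm _ _ hresp,
      eta02_eq_quadForm _ _ hresp, eta11_eq_quadForm _ _ hresp,
      hquad w₀ w₀ FD FD _ _ 0 0 hFD0 hFDc hFDc,
      hquad w₀ (-Complex.I * w₁) FD (FR 1) _ _ 0 1 hFD0 hFDc (hFRc 1),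
      hquad w₀ (-w₂) FD (FR 2) _ _ 0 2 hFD0 hFDc (hFRc 2),
      hquad (-Complex.I * w₁) (-Complex.I * w₁) (FR 1) (FR 1) _ _ 1 1 (hFR0 1) (hFRc 1) (hFRc 1)]
    have hexpand : ∀ x y : ι → ℝ, ∑ i, σ i * (x i * y i) =
        ∑ i : Fin (2 * M) × Fin Ns, σ2 k i.1 * (x (Sum.inl i) * y (Sum.inl i)) +
        ∑ i : Fin (2 * M) × Fin Ns, σ2 k i.1 * (x (Sum.inr i) * y (Sum.inr i)) := fun x y => by
      rw [Fintype.sum_sum_type]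
      rfl
    simp only [hexpand]
    simp only [a₀, a₁, a₂, Sum.elim_inl, Sum.elim_inr, hFD]
    simp only [hFR, hFV]
    have ht2 : 2 / (2 * (M : ℝ)) = 2 * t := by rw [ht, div_eq_mul_inv]
    have ht3 : 1 / (4 * (M : ℝ) ^ 2) = t ^ 2 := by
      rw [ht, inv_pow, mul_pow, one_div]
      norm_num
    rw [ht2, ht3]
  have hσ0 : ∀ i, 0 ≤ σ i := by
    rintro (i | i) <;> exact hmodel.variance_nonneg k _ n
  have hσS : ∀ i, σ i ≤ S := by
    rintro (i | i) <;> exact hS k _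
  set D : ℝ := 2 * (Ns + 1) * (A * H * (2 * κ * (P * Y) + 1)) with hD
  have hD0 : 0 ≤ D := by positivity
  have hsq : ∀ (v : ℂ) (Z : ℤ → ℂ) (z a : ℝ), (∀ τ, ‖Z τ‖ ≤ z) → ‖v‖ ≤ a → 0 ≤ z →
      ∑ i : ι, (Sum.elim (fun i => (v * R Z i).re) (fun i => (v * V Z i).re) i) ^ 2 ≤
        2 * Ns * (a * (2 * κ * (P * z))) ^ 2 := by
    intro v Z z a hZ hv hz
    have := sum_sq_symbolResponse_le (Ns := Ns) hP hZ (readTime M κ n) m v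
    rw [Fintype.sum_sum_type, Fintype.sum_prod_type, Fintype.sum_prod_type]
    simp only [Finset.sum_add_distrib] at this
    refine this.trans ?_
    have : 0 ≤ P * z := mul_nonneg hP0 hz
    gcongr
  have hX : ∀ r ≤ 2, ∀ τ, ‖X r τ‖ ≤ Y := fun r hr τ => by
    simp only [X, tapSeq, Complex.norm_real, Real.norm_eq_abs]
    exact hY r hr τ
  have hx0 : 0 ≤ A * H * (2 * κ * (P * Y)) := by positivity
  have hNs : (0 : ℝ) ≤ Ns := by positivity
  have hAH : 0 ≤ A * H := by positivity
  -- the constant `D` leaves room for the symbol of interest, which `a₀` subtracts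
  have hDsq : 2 * (2 * Ns * (A * H * (2 * κ * (P * Y))) ^ 2) + 2 * (A * H) ^ 2 ≤ D ^ 2 := by
    rw [hD, mul_add (A * H), mul_one]
    set x := A * H * (2 * κ * (P * Y))
    set y := A * H
    have hxy : 0 ≤ x * y := mul_nonneg hx0 hAH
    nlinarith [mul_nonneg hNs (sq_nonneg x), mul_nonneg hNs (sq_nonneg y), mul_nonneg hNs hxy,
      mul_nonneg (mul_nonneg hNs hNs) (sq_nonneg (x + y)), sq_nonneg x, sq_nonneg y]
  have hDsq' : 2 * Ns * (A * H * (2 * κ * (P * Y))) ^ 2 ≤ D ^ 2 := by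
    have := mul_nonneg hNs (sq_nonneg (A * H * (2 * κ * (P * Y))))
    linarith [sq_nonneg (A * H)]
  have h₁ : ∑ i, a₁ i ^ 2 ≤ D ^ 2 := by
    refine (hsq (-Complex.I * w₁) (X 1) Y (A * H) (hX 1 (by norm_num)) ?_ hY0).trans hDsq'
    rw [norm_mul, norm_neg, Complex.norm_I, one_mul]
    exact hw 1 (by norm_num)
  have h₂ : ∑ i, a₂ i ^ 2 ≤ D ^ 2 := by
    refine (hsq (-w₂) (X 2) Y (A * H) (hX 2 le_rfl) ?_ hY0).trans hDsq'
    rw [norm_neg]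
    exact hw 2 le_rfl
  have h₀ : ∑ i, a₀ i ^ 2 ≤ D ^ 2 := by
    have hb := hsq w₀ (X 0) Y (A * H) (hX 0 (by norm_num)) (hw 0 (by norm_num)) hY0
    have hδ : ∑ i : Fin (2 * M) × Fin Ns, (w₀ * δ i).re ^ 2 = w₀.re ^ 2 := by
      rw [Finset.sum_eq_single (m, n)]
      · simp [δ]
      · intro i _ hi
        have : ¬(i.1 = m ∧ i.2 = n) := fun h => hi (Prod.ext h.1 h.2)
        simp [δ, this]
      · simp
    have hw0 : w₀.re ^ 2 ≤ (A * H) ^ 2 := by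
      rw [← sq_abs]
      exact pow_le_pow_left₀ (abs_nonneg _)
        ((Complex.abs_re_le_norm _).trans (hw 0 (by norm_num))) 2
    refine le_trans ?_ hDsq
    rw [Fintype.sum_sum_type] at hb ⊢
    simp only [Sum.elim_inl, Sum.elim_inr, a₀] at hb ⊢
    have h1 : ∑ i, (w₀ * (R (X 0) i - δ i)).re ^ 2 ≤
        2 * ∑ i, (w₀ * R (X 0) i).re ^ 2 + 2 * ∑ i, (w₀ * δ i).re ^ 2 := by
      rw [Finset.mul_sum, Finset.mul_sum, ← Finset.sum_add_distrib]
      refine Finset.sum_le_sum fun i _ => ?_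
      rw [mul_sub, Complex.sub_re]
      nlinarith [sq_nonneg ((w₀ * R (X 0) i).re + (w₀ * δ i).re)]
    have h2 : 0 ≤ ∑ i, (w₀ * V (X 0) i).re ^ 2 := Finset.sum_nonneg fun i _ => sq_nonneg _
    rw [hδ] at h1
    linarith
  have he : ∑ i, e i ^ 2 ≤ (2 * (Ns + 1) * (A * (2 * κ * (P * ε)))) ^ 2 := by
    refine (hsq (W m) Xe ε A (fun τ => hε ω τ) (hA m) hε0).trans ?_
    rw [mul_pow (2 * ((Ns : ℝ) + 1))]
    refine mul_le_mul_of_nonneg_right ?_ (sq_nonneg _)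
    nlinarith [hNs]
  have hmain := abs_quadratic_expansion_le hσ0 hσS hS0 hD0
    (by positivity : 0 ≤ 2 * (Ns + 1) * (A * (2 * κ * (P * ε)))) ht0 ht1 h₀ h₁ h₂ he
  rw [hdist, hform, ← mul_sub, abs_mul, abs_two]
  exact mul_le_mul_of_nonneg_left hmain (by norm_num)

end FixedSize

/-! ### Uniform bounds and conclusion -/

/-- Both forms of the distortion agree when the useful part `W_m H_k(ω_m) b` of the output is
real. -/
lemma distortion'_eq_distortion {Ω : Type*} [MeasurableSpace Ω] (μ : Measure Ω) {M κ Ns : ℕ}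
    (p q : Pulse M κ) (h : ℤ → ℂ) (W : Fin (2 * M) → ℂ) (B C : Fin (2 * M) → Fin Ns → Ω → ℝ)
    (m : Fin (2 * M)) (n : Fin Ns)
    (hreal : (∀ x, B m n x = 0) ∨ (W m * freqResp h (centralFreq M m)).im = 0) :
    distortion' μ p q h W B C m n = distortion μ p q h W B C m n := by
  rw [distortion', distortion]
  congr 2
  ext x
  set w := W m * freqResp h (centralFreq M m)
  have him : (w * (B m n x : ℂ)).im = 0 := by
    rw [Complex.im_mul_ofReal]
    rcases hreal with h0 | h0
    · rw [h0, mul_zero]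
    · rw [h0, zero_mul]
  have hw : w * (B m n x : ℂ) = ((w * (B m n x : ℂ)).re : ℂ) :=
    Complex.ext (by simp) (by simp [him])
  rw [Complex.sub_re, hw, ← Complex.ofReal_sub, Complex.norm_real, Real.norm_eq_abs,
    Complex.ofReal_re]

lemma exists_tap_sampled_bound {κ : ℕ} {Ts : ℝ} {q : ℝ → ℝ} (hκ : 1 ≤ κ) (hTs : 0 < Ts)
    (hq : IsAnalogPulse κ Ts q) :
    ∃ Y : ℝ, ∀ M : ℕ, 0 < M → ∀ r ≤ 2, ∀ τ, |tap (sampled κ Ts q r M) τ| ≤ Y := by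
  have h1 : ∀ r ≤ 2, ∃ Y : ℝ, 0 ≤ Y ∧ ∀ M : ℕ, 0 < M → ∀ τ, |tap (sampled κ Ts q r M) τ| ≤ Y := by
    intro r hr
    obtain ⟨Y, hY⟩ := (hasCompactSupport_extendedDeriv (κ := κ) (Ts := Ts) (q := q)
      r).exists_bound_of_continuous (continuous_extendedDeriv hκ hTs hq hr)
    have hY0 : 0 ≤ Y := (norm_nonneg _).trans (hY 0)
    refine ⟨Ts ^ r * Y, by positivity, fun M hM τ => ?_⟩
    rw [tap_sampled hTs q r hM, abs_mul, abs_of_nonneg (by positivity : 0 ≤ Ts ^ r)]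
    exact mul_le_mul_of_nonneg_left (hY _) (by positivity)
  obtain ⟨Y₀, h00, h0⟩ := h1 0 (by norm_num)
  obtain ⟨Y₁, h10, h1'⟩ := h1 1 (by norm_num)
  obtain ⟨Y₂, h20, h2⟩ := h1 2 le_rfl
  refine ⟨Y₀ + Y₁ + Y₂, fun M hM r hr τ => ?_⟩
  interval_cases r
  · linarith [h0 M hM τ]
  · linarith [h1' M hM τ]
  · linarith [h2 M hM τ]

lemma exists_freqMoment_bound {K : ℕ} {h : Fin K → ℤ → ℂ}
    (hh : ∀ k, Summable fun l : ℤ => (l : ℝ) ^ 2 * ‖h k l‖) :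
    ∃ H : ℝ, ∀ k, ∀ r ≤ 2, ∀ ω, ‖freqMoment (h k) r ω‖ ≤ H := by
  have hnn : ∀ k r, 0 ≤ ∑' l : ℤ, |(l : ℝ)| ^ r * ‖h k l‖ := fun k r =>
    tsum_nonneg fun l => by positivity
  refine ⟨∑ k, ∑ r ∈ Finset.range 3, ∑' l : ℤ, |(l : ℝ)| ^ r * ‖h k l‖, fun k r hr ω => ?_⟩
  refine (norm_freqMoment_le (hh k) hr ω).trans ?_
  refine (Finset.single_le_sum (f := fun r => ∑' l : ℤ, |(l : ℝ)| ^ r * ‖h k l‖)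
    (fun r _ => hnn k r) (Finset.mem_range.2 (by omega : r < 3))).trans ?_
  exact Finset.single_le_sum
    (f := fun k => ∑ r ∈ Finset.range 3, ∑' l : ℤ, |(l : ℝ)| ^ r * ‖h k l‖)
    (fun k _ => Finset.sum_nonneg fun r _ => hnn k r) (Finset.mem_univ k)

lemma isLittleO_error {ε : ℕ → ℝ} (hε : Tendsto (fun M : ℕ => (M : ℝ) ^ 2 * ε M) atTop (𝓝 0))
    (S D c : ℝ) :
    (fun M : ℕ => 2 * (S * (2 * D ^ 2 * (2 * (M : ℝ))⁻¹ ^ 3 + 5 * D * (c * ε M) +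
      (c * ε M) ^ 2))) =o[atTop] fun M : ℕ => ((M : ℝ) ^ 2)⁻¹ := by
  have hinv : Tendsto (fun M : ℕ => ((M : ℝ))⁻¹) atTop (𝓝 0) := tendsto_inv_atTop_nhds_zero_nat
  have hlim : Tendsto (fun M : ℕ => 2 * (S * (D ^ 2 / 4 * ((M : ℝ))⁻¹ +
      5 * D * c * ((M : ℝ) ^ 2 * ε M) +
      c ^ 2 * (((M : ℝ) ^ 2 * ε M) * ((M : ℝ) ^ 2 * ε M)) * ((M : ℝ)⁻¹ * (M : ℝ)⁻¹))))
      atTop (𝓝 (2 * (S * (D ^ 2 / 4 * 0 + 5 * D * c * 0 + c ^ 2 * (0 * 0) * (0 * 0))))) :=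
    ((((hinv.const_mul _).add (hε.const_mul _)).add
      (((hε.mul hε).const_mul _).mul (hinv.mul hinv))).const_mul _).const_mul _
  simp only [mul_zero, add_zero] at hlim
  rw [isLittleO_iff_tendsto']
  · refine hlim.congr' ?_
    filter_upwards [eventually_gt_atTop 0] with M hM
    have hM' : (M : ℝ) ≠ 0 := by exact_mod_cast hM.ne'
    field_simp
    ring
  · filter_upwards [eventually_gt_atTop 0] with M hM h0
    have hM' : (M : ℝ) ≠ 0 := by exact_mod_cast hM.ne'
    exact absurd h0 (inv_ne_zero (pow_ne_zero 2 hM'))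

end

end FBMC

theorem proposition1
    -- overlapping factor, symbol period, number of users, number of multicarrier symbols
    (κ : ℕ) (hκ : 1 ≤ κ) (Ts : ℝ) (hTs : 0 < Ts) (K Ns : ℕ)
    -- transmit pulses, and the function from which the receive pulses are sampled
    (p : (M : ℕ) → FBMC.Pulse M κ) (q : ℝ → ℝ)
    (hp_bdd : FBMC.UniformlyBounded p)
    (hq_bdd : FBMC.UniformlyBounded (FBMC.sampled κ Ts q 0))
    (hq : FBMC.IsAnalogPulse κ Ts q)
    (hPR : ∀ M, FBMC.IsPR (p M) (FBMC.sampled κ Ts q 0 M))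
    (hp_symm : ∀ M, FBMC.IsSymm (p M))
    (hq_symm : ∀ M, FBMC.IsSymm (FBMC.sampled κ Ts q 0 M))
    -- impulse responses of the users' channels, with `∑ l² |h_k[l]| < ∞`
    (h : Fin K → ℤ → ℂ) (hh : ∀ k, Summable fun l : ℤ => (l : ℝ) ^ 2 * ‖h k l‖)
    -- one-tap-per-subcarrier equalizers, bounded uniformly in `M`
    (W : (M : ℕ) → Fin (2 * M) → ℂ) (hW : ∃ A : ℝ, ∀ M m, ‖W M m‖ ≤ A)
    -- subcarrier allocation and transmitted symbols, with powers bounded uniformly in `M`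
    (owner : (M : ℕ) → Fin (2 * M) → Fin K)
    (Ω : ℕ → Type*) [∀ M, MeasurableSpace (Ω M)]
    (μ : (M : ℕ) → Measure (Ω M)) [∀ M, IsProbabilityMeasure (μ M)]
    (B C : (M : ℕ) → Fin K → Fin (2 * M) → Fin Ns → Ω M → ℝ)
    (σ2 : (M : ℕ) → Fin K → Fin (2 * M) → ℝ)
    (hsymb : ∀ M, FBMC.IsSymbolModel (μ M) (owner M) (B M) (C M) (σ2 M))
    (hσ2 : ∃ A : ℝ, ∀ M k m, σ2 M k m ≤ A) :
    ∃ δ : ℕ → ℝ, (δ =o[atTop] fun M : ℕ => ((M : ℝ) ^ 2)⁻¹) ∧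
      -- for all symbols that are not at the edges of the transmitted block
      ∀ (M : ℕ) (k : Fin K) (m : Fin (2 * M)) (n : Fin Ns), κ ≤ (n : ℕ) → (n : ℕ) + κ ≤ Ns →
        |FBMC.distortion (μ M) (p M) (FBMC.sampled κ Ts q 0 M) (h k) (W M) (B M k) (C M k) m n
            - FBMC.predictedDistortion (μ M) Ts (p M) q (h k) (W M) (B M k) m n| ≤ δ M ∧
        (owner M m ≠ k ∨ (W M m * FBMC.freqResp (h k) (FBMC.centralFreq M m)).im = 0 →
          |FBMC.distortion' (μ M) (p M) (FBMC.sampled κ Ts q 0 M) (h k) (W M) (B M k) (C M k) m n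
            - FBMC.predictedDistortion (μ M) Ts (p M) q (h k) (W M) (B M k) m n| ≤ δ M) := by
  obtain ⟨P, hP⟩ := hp_bdd
  obtain ⟨A, hA⟩ := hW
  obtain ⟨S, hS⟩ := hσ2
  obtain ⟨Y, hY⟩ := FBMC.exists_tap_sampled_bound hκ hTs hq
  obtain ⟨H, hH⟩ := FBMC.exists_freqMoment_bound hh
  choose ε hε0 hε hεbound using fun k => FBMC.exists_filteredPulse_bound hκ hTs hq (hh k)
  have heven := FBMC.extendedDeriv_zero_neg hκ hTs hq hq_symm
  have hodd := FBMC.deriv_parity (s := 1)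
    (FBMC.hasDerivAt_extendedDeriv hκ hTs hq (r := 0) (by norm_num)) (by simpa using heven)
  have heven₂ := FBMC.deriv_parity
    (FBMC.hasDerivAt_extendedDeriv hκ hTs hq (r := 1) (by norm_num)) hodd
  refine ⟨fun M => 2 * (S * (2 * (2 * (Ns + 1) * (A * H * (2 * κ * (P * Y) + 1))) ^ 2 *
      (2 * (M : ℝ))⁻¹ ^ 3 + 5 * (2 * (Ns + 1) * (A * H * (2 * κ * (P * Y) + 1))) *
        ((2 * (Ns + 1) * (A * (2 * κ * P))) * ∑ k, ε k M) +
      ((2 * (Ns + 1) * (A * (2 * κ * P))) * ∑ k, ε k M) ^ 2)), ?_, ?_⟩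
  · refine FBMC.isLittleO_error ?_ S _ _
    simp only [Finset.mul_sum]
    rw [← Finset.sum_const_zero (s := (Finset.univ : Finset (Fin K)))]
    exact tendsto_finsetSum _ fun k _ => hε k
  · intro M k m n hn hn'
    have hM := FBMC.pos_of_subcarrier m
    have hmain := FBMC.abs_distortion_sub_le hκ (hPR M) (hp_symm M) (hq_symm M)
      (FBMC.sampled_rev hTs hodd hM)
      (fun i => by
        rw [FBMC.sampled_rev hTs heven₂ hM]
        norm_num)
      (hh k) (hsymb M) (hP M) (hY M hM) (hA M) (hH k) (hS M)
      (fun ω τ => (hεbound k M hM ω τ).trans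
        (Finset.single_le_sum (f := fun k => ε k M) (fun k _ => hε0 k M) (Finset.mem_univ k)))
      k m n hn hn'
    rw [show 2 * ((Ns : ℝ) + 1) * (A * (2 * κ * (P * ∑ k, ε k M))) =
      2 * (Ns + 1) * (A * (2 * κ * P)) * ∑ k, ε k M by ring] at hmain
    refine ⟨hmain, fun hreal => ?_⟩
    rw [FBMC.distortion'_eq_distortion _ _ _ _ _ _ _ _ _
      (hreal.imp_left fun h0 => (hsymb M).null_B k m n h0)]
    exact hmain
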